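/- **Setting.** Let $G=(V,E)$ be a finite connected simple graph, $n=|V|$, $m=|E|$, with edge weights $w:E\to\mathbb{R}\cup\{\infty\}$, and let $xy\in E$ be an edge of an induced path $P_3$ of $G$. A *dominating induced matching* (d.i.m.) of $G$ is a set $M\subseteq E$ such that any two distinct edges of $M$ have distance at least two and every edge outside $M$ shares an endpoint with an edge of $M$. $G$ is *$P_7$-free* if it has no induced path with seven vertices. For a vertex set $U$, $N(t)$ is the neighborhood of $t$, and a component is *nontrivial* if it has an edge. **Notation.** $N_i$ is the set of vertices at distance $i$ from $\{x,y\}$. $M_2$ and $S_2$ are the sets of edges and of isolated vertices of $G[N_2]$; $M_4$ and $S_4$ are those of $G[N_4]$. $T_{one}$ (resp. $T_{two}$) is the set of $t\in N_3$ with exactly one (resp. at least two) neighbors in $S_2$. $S_3$ is the set of vertices of $N_3$ that are in $T_{two}$ or adjacent to an endpoint of an edge of $M_2\cup M_4$. Write $S_2=\{u_1,\dots,u_k\}$ and $T_i=(T_{one}\setminus S_3)\cap N(u_i)$; $Y_i$ is the set of non-isolated vertices of $G[T_i]$ ("$Y_i$ exists" if it is nonempty). $T_i$ and $T_j$ ($i\ne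 j$) are *paired* if there is an edge between them; $T_i$ is *isolated* if it is paired with no $T_j$. A vertex $t\in T_i$ is *green* if it has a neighbor in $S_3\cup S_4$, or two neighbors in $T_i$, or two neighbors in some $T_j$ paired with $T_i$. A *best* vertex of $K\subseteq T_i$ is a $t\in K$ minimizing $w(u_it)$. **Procedure Check($xy$).** 1. Stop unsuccessfully unless all of the following hold: $N_1$ is stable; $G[N_2]$ and $G[N_4]$ are disjoint unions of edges and vertices; $N_5=\emptyset$; $G[N_3\cup S_4]$ is bipartite; $S_3\cup S_4$ is stable; every $T_i$ is nonempty, and $G[T_i]$ is a disjoint union of vertices and at most one star with an edge; for $i\neq j$ there is no edge between $Y_i$ and $T_j$. Put $M:=\{xy\}\cup M_2\cup M_4$. If $S_2=\emptyset$, return $M$. 2. Stop unsuccessfully unless every $T_i$ is paired with at most one $T_j$ and, for paired $T_i,T_j$, not both $Y_i,Y_j$ exist and the nontrivial components of $G[T_i\cup T_j]$ are at most two among $Y_i$, $Y_j$, one star $Y_i'$ with center in $T_i$ and other vertices in $T_j$, and one star $Y_j'$ with center in $T_j$ and other vertices in $T_i$ (a single edge between $T_i$ and $T_j$ may count as either).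 3. Stop unsuccessfully unless every $T_i$ has at most one green vertex and, if $t$ is green in $T_i$, then $G[T_i\setminus N(t)]$ is edgeless. 4. For every isolated $T_i$ add $u_it$ to $M$, where $t$ is the green vertex of $T_i$ if there is one; otherwise a best vertex of $Y_i$ if $Y_i$ exists; otherwise a best vertex of $T_i$. 5. For all paired $T_i,T_j$ add $u_ia$ and $u_jb$ to $M$, with $a\in T_i$, $b\in T_j$ as follows. * If $a^*$ is green in $T_i$ and $b^*$ is green in $T_j$: if $a^*b^*\notin E$ and $G[(T_i\cup T_j)\setminus(N(a^*)\cup N(b^*))]$ is edgeless, then $a=a^*$, $b=b^*$; otherwise stop unsuccessfully. * If only $T_i$ has a green vertex $a^*$: if $T_j\setminus N(a^*)\neq\emptyset$ and $H=G[(T_i\cup T_j)\setminus N(a^*)]$ has at most one nontrivial component, then $a=a^*$ and $b$ is the endpoint in $T_j$ of an edge of $H$ between $T_i$ and $T_j$ if there is one; otherwise a best vertex of $Y_j$ if $Y_j$ exists; otherwise a best vertex of $T_j\setminus N(a^*)$. If the condition fails, stop unsuccessfully. Symmetrically if only $T_j$ has a green vertex. * If neither has a green vertex, let $pq$ be an edge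 with $p\in T_i$, $q\in T_j$. If there is another edge $p'q'$ in $G[T_i\cup T_j]$, take $(a,b)=(z,q)$ with $z$ best in $\{p',q'\}$ if $p',q'\in T_i$; $(a,b)=(p,z)$ with $z$ best in $\{p',q'\}$ if $p',q'\in T_j$; and the better (smaller $w(u_ia)+w(u_jb)$) of $(p',q)$ and $(p,q')$ if $p'\in T_i$, $q'\in T_j$. If there is no other edge, take the better of those of the two alternatives $(z,q)$, $z$ best in $T_i\setminus\{p\}$, and $(p,z')$, $z'$ best in $T_j\setminus\{q\}$, that exist; if $T_i=\{p\}$ and $T_j=\{q\}$, stop unsuccessfully. 6. Return $M$. **Theorem.** Procedure Check($xy$) is correct and runs in linear time: (i) For every $G$, $w$, $xy$ as above the procedure has a result, and whichever ties are chosen: if it returns $M$, then $M$ is a d.i.m. of $G$ containing $xy$, of minimum weight among all d.i.m.'s of $G$ containing $xy$; if it stops unsuccessfully, then $G$ has no d.i.m. containing $xy$ or $G$ is not $P_7$-free. (ii) There are a single random access machine program and a constant $C$ such that for every such $G$ (with $V=\{0,\dots,n-1\}$, given by adjacency lists in any order), $w$ and $xy$, the program halts after at most $C(n+m)$ steps and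 outputs a result of Procedure Check($xy$). The machine has unit-cost instructions for copying and indirect array access, comparison and successor of natural numbers, and addition and comparison of weights. -/

import Mathlib

namespace DimCheck

/-! ### Dominating induced matchings -/

/-- Edge weights: real numbers or `∞`. -/
abbrev Weight := WithTop ℝ

section Graph

variable {V : Type*} (G : SimpleGraph V)

/-- Any two different edges of `M` have distance at least two. -/
def IsInducedMatching (M : Set (Sym2 V)) : Prop :=
  M ⊆ G.edgeSet ∧
    ∀ e ∈ M, ∀ e' ∈ M, e ≠ e' → ∀ u ∈ e, ∀ v ∈ e', u ≠ v ∧ ¬ G.Adj u v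

/-- Every edge outside `M` shares an endpoint with an edge of `M`. -/
def IsDominatingEdgeSet (M : Set (Sym2 V)) : Prop :=
  M ⊆ G.edgeSet ∧ ∀ e ∈ G.edgeSet, e ∉ M → ∃ e' ∈ M, ∃ v, v ∈ e ∧ v ∈ e'

/-- Dominating induced matching (d.i.m.). -/
def IsDIM (M : Set (Sym2 V)) : Prop :=
  IsInducedMatching G M ∧ IsDominatingEdgeSet G M

/-- Total weight of a finite edge set. -/
noncomputable def totalWeight (w : Sym2 V → Weight) (M : Finset (Sym2 V)) : Weight :=
  ∑ e ∈ M, w e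

/-- `M` is a d.i.m. containing the edge `xy`, of minimum weight among these. -/
def IsMinDIMContaining (w : Sym2 V → Weight) (x y : V) (M : Finset (Sym2 V)) : Prop :=
  IsDIM G (M : Set (Sym2 V)) ∧ s(x, y) ∈ M ∧
    ∀ M' : Finset (Sym2 V), IsDIM G (M' : Set (Sym2 V)) → s(x, y) ∈ M' →
      totalWeight w M ≤ totalWeight w M'

/-- `G` has no induced path with seven vertices. -/
def P7Free : Prop := ¬ (SimpleGraph.pathGraph 7).IsIndContained G

/-- `xy` is an edge of an induced path with three vertices. -/
def EdgeInP3 (x y : V) : Prop :=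
  G.Adj x y ∧ ∃ f : SimpleGraph.pathGraph 3 ↪g G, x ∈ Set.range f ∧ y ∈ Set.range f

/-! ### Auxiliary notions for vertex sets -/

/-- `G[U]` is a disjoint union of edges and vertices. -/
def IsEdgesAndVertices (U : Set V) : Prop :=
  ∀ v ∈ U, ∀ a ∈ U, ∀ b ∈ U, G.Adj v a → G.Adj v b → a = b

/-- The edges of `G[U]`. -/
def edgesIn (U : Set V) : Set (Sym2 V) := {e ∈ G.edgeSet | ∀ v ∈ e, v ∈ U}

/-- The isolated vertices of `G[U]`. -/
def isolatedIn (U : Set V) : Set V := {v ∈ U | ∀ a ∈ U, ¬ G.Adj v a}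

/-- `G[U]` is a disjoint union of vertices and at most one star with an edge: it is edgeless, or
all of its edges have a common endpoint. -/
def IsVerticesAndStar (U : Set V) : Prop :=
  G.IsIndepSet U ∨ ∃ c ∈ U, ∀ a ∈ U, ∀ b ∈ U, G.Adj a b → a = c ∨ b = c

/-- The vertex sets of the components of `G[U]` that have at least one edge. -/
def nontrivialComponents (U : Set V) : Set (Set V) :=
  {K | K.Nontrivial ∧ ∃ C : (G.induce U).ConnectedComponent, K = Subtype.val '' C.supp}

/-- `K` is the vertex set of a star whose center is in `A` and whose other vertices (at least
one) are in `B`. -/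
def IsCrossStar (A B K : Set V) : Prop :=
  ∃ c ∈ A, ∃ L ⊆ B, L.Nonempty ∧ G.IsIndepSet L ∧ (∀ l ∈ L, G.Adj c l) ∧ K = insert c L

/-- `t` has two different neighbors in `U`. -/
def HasTwoNeighborsIn (U : Set V) (t : V) : Prop :=
  ∃ a ∈ U, ∃ b ∈ U, a ≠ b ∧ G.Adj t a ∧ G.Adj t b

/-- `t` is a best vertex of `K` with respect to `u`. -/
def IsBest (w : Sym2 V → Weight) (u : V) (K : Set V) (t : V) : Prop :=
  t ∈ K ∧ ∀ t' ∈ K, w s(u, t) ≤ w s(u, t')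

/-! ### The sets determined by an edge `xy` (in a connected graph) -/

variable (x y : V)

/-- The distance level `N_i(xy)`. -/
def level (i : ℕ) : Set V := {z | min (G.dist z x) (G.dist z y) = i}

/-- The edges in `N₂`. -/
def M2 : Set (Sym2 V) := edgesIn G (level G x y 2)

/-- The isolated vertices in `N₂`. -/
def S2 : Set V := isolatedIn G (level G x y 2)

/-- The edges in `N₄`. -/
def M4 : Set (Sym2 V) := edgesIn G (level G x y 4)

/-- The isolated vertices in `N₄`. -/
def S4 : Set V := isolatedIn G (level G x y 4)

def Tone : Set V := {t ∈ level G x y 3 | (G.neighborSet t ∩ S2 G x y).ncard = 1}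

def Ttwo : Set V := {t ∈ level G x y 3 | 2 ≤ (G.neighborSet t ∩ S2 G x y).ncard}

/-- The vertices of `N₃` that see an endpoint of an edge of `M₂` or `M₄`, or are in `T_two`. -/
def S3 : Set V :=
  {t ∈ level G x y 3 | ∃ e ∈ M2 G x y ∪ M4 G x y, ∃ v ∈ e, G.Adj t v} ∪ Ttwo G x y

/-- `T*_one`. -/
def TStar : Set V := Tone G x y \ S3 G x y

/-- The set `T_i` belonging to the vertex `u = u_i` of `S₂`. -/
def T (u : V) : Set V := TStar G x y ∩ G.neighborSet u

/-- The vertex set of the star `Y_i` (the non-isolated vertices of `G[T_i]`) for `u = u_i`;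
`Y_i` exists if this set is nonempty. -/
def Y (u : V) : Set V := T G x y u \ isolatedIn G (T G x y u)

/-- Some vertex of `A` sees some vertex of `B`. -/
def Sees (A B : Set V) : Prop := ∃ a ∈ A, ∃ b ∈ B, G.Adj a b

/-- `T_i` and `T_j` are paired, for `u = u_i`, `v = u_j`. -/
def Paired (u v : V) : Prop :=
  u ∈ S2 G x y ∧ v ∈ S2 G x y ∧ u ≠ v ∧ Sees G (T G x y u) (T G x y v)

/-- `T_i` is isolated, for `u = u_i`. -/
def IsolatedT (u : V) : Prop := u ∈ S2 G x y ∧ ∀ v, ¬ Paired G x y u v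

/-- The vertex `t` of `T_i` is green: it sees a vertex of `S₃ ∪ S₄`, or it is the center of a
`P₃` in the star `Y_i` or, if `T_i` and `T_j` are paired, in a star with center in `T_i` and the
other vertices in `T_j`. -/
def Green (u t : V) : Prop :=
  t ∈ T G x y u ∧
    ((∃ s ∈ S3 G x y ∪ S4 G x y, G.Adj t s) ∨
      HasTwoNeighborsIn G (T G x y u) t ∨
      ∃ v, Paired G x y u v ∧ HasTwoNeighborsIn G (T G x y v) t)

/-! ### Procedure Check -/

/-- The tests of step (b). -/
structure TestB : Prop where
  level_one : G.IsIndepSet (level G x y 1)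
  level_two : IsEdgesAndVertices G (level G x y 2)
  level_five : level G x y 5 = ∅
  level_four : IsEdgesAndVertices G (level G x y 4)
  bipartite : (G.induce (level G x y 3 ∪ S4 G x y)).IsBipartite
  stable : G.IsIndepSet (S3 G x y ∪ S4 G x y)
  nonempty : ∀ u ∈ S2 G x y, (T G x y u).Nonempty
  star : ∀ u ∈ S2 G x y, IsVerticesAndStar G (T G x y u)
  star_sees : ∀ u ∈ S2 G x y, ∀ v ∈ S2 G x y, u ≠ v → ¬ Sees G (Y G x y u) (T G x y v)

/-- The test of step (c): every `T_i` sees at most one other `T_j`. -/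
def TestC : Prop :=
  ∀ u v v', Paired G x y u v → Paired G x y u v' → v = v'

/-- The test of step (d): for paired `T_i`, `T_j`, the components of `G[T_i ∪ T_j]` with an edge
are at most two among `Y_i`, `Y_j`, one star `Y'_i` with center in `T_i` and other vertices in
`T_j`, one star `Y'_j` with center in `T_j` and other vertices in `T_i`; not both of `Y_i`, `Y_j`
exist. A single edge between `T_i` and `T_j` may play the role of either `Y'_i` or `Y'_j`. -/
def TestD : Prop :=
  ∀ u v, Paired G x y u v →
    (nontrivialComponents G (T G x y u ∪ T G x y v)).ncard ≤ 2 ∧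
    (Y G x y u = ∅ ∨ Y G x y v = ∅) ∧
    (∀ K ∈ nontrivialComponents G (T G x y u ∪ T G x y v),
      K = Y G x y u ∨ K = Y G x y v ∨
        IsCrossStar G (T G x y u) (T G x y v) K ∨ IsCrossStar G (T G x y v) (T G x y u) K) ∧
    (∀ K ∈ nontrivialComponents G (T G x y u ∪ T G x y v),
      ∀ K' ∈ nontrivialComponents G (T G x y u ∪ T G x y v), K ≠ K' →
        K ≠ Y G x y u → K ≠ Y G x y v → K' ≠ Y G x y u → K' ≠ Y G x y v →
          (IsCrossStar G (T G x y u) (T G x y v) K ∧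
              IsCrossStar G (T G x y v) (T G x y u) K') ∨
            (IsCrossStar G (T G x y v) (T G x y u) K ∧
              IsCrossStar G (T G x y u) (T G x y v) K'))

/-- The tests of step (f) on the green vertices (which are determined in step (e)). -/
def TestF : Prop :=
  ∀ u ∈ S2 G x y,
    (∀ t t', Green G x y u t → Green G x y u t' → t = t') ∧
    ∀ t, Green G x y u t → G.IsIndepSet (T G x y u \ G.neighborSet t)

/-- All tests of the steps (b), (c), (d), (f). If `S₂ = ∅`, then (c), (d), (f) hold vacuously. -/
def Tests : Prop := TestB G x y ∧ TestC G x y ∧ TestD G x y ∧ TestF G x y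

variable (w : Sym2 V → Weight)

/-- Step (g): for an isolated `T_i`, `u = u_i`, the procedure may choose `t` (and add `u_i t`
to `M`). -/
inductive StepG (u : V) : V → Prop
  | green (t : V) : Green G x y u t → StepG u t
  | star (t : V) : (∀ t', ¬ Green G x y u t') → (Y G x y u).Nonempty →
      IsBest w u (Y G x y u) t → StepG u t
  | edgeless (t : V) : (∀ t', ¬ Green G x y u t') → Y G x y u = ∅ →
      IsBest w u (T G x y u) t → StepG u t

/-- The condition of step (h.1), for the green vertices `a` of `T_i` and `b` of `T_j`. -/
def CondH1 (u v a b : V) : Prop :=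
  ¬ G.Adj a b ∧
    G.IsIndepSet ((T G x y u ∪ T G x y v) \ (G.neighborSet a ∪ G.neighborSet b))

/-- The condition of step (h.2), for the green vertex `a` of `T_i`. -/
def CondH2 (u v a : V) : Prop :=
  (T G x y v \ G.neighborSet a).Nonempty ∧
    (nontrivialComponents G ((T G x y u ∪ T G x y v) \ G.neighborSet a)).Subsingleton

/-- Step (h.2), the choice of a vertex `b` of `T_j` if `a` is the green vertex of `T_i` and `T_j`
has no green vertex: the vertex in `T_j` of the star `Y'_j` that is left in
`G[(T_i ∪ T_j) \ N(a)]`, if there is one; otherwise a best vertex of `Y_j`, if `Y_j` exists;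
otherwise a best vertex of `T_j \ N(a)`. -/
inductive ChoiceH2 (u v a : V) : V → Prop
  | cross (b c : V) : b ∈ T G x y v \ G.neighborSet a → c ∈ T G x y u \ G.neighborSet a →
      G.Adj b c → ChoiceH2 u v a b
  | star (b : V) : ¬ Sees G (T G x y v \ G.neighborSet a) (T G x y u \ G.neighborSet a) →
      (Y G x y v).Nonempty → IsBest w v (Y G x y v) b → ChoiceH2 u v a b
  | rest (b : V) : ¬ Sees G (T G x y v \ G.neighborSet a) (T G x y u \ G.neighborSet a) →
      Y G x y v = ∅ → IsBest w v (T G x y v \ G.neighborSet a) b → ChoiceH2 u v a b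

/-- Step (h.3), the choices if neither `T_i` nor `T_j` has a green vertex; `p`, `q` is an edge
with `p` in `T_i` and `q` in `T_j`. The result is a pair of vertices of `T_i` and `T_j`, or `none`
for an unsuccessful stop. -/
inductive ChoiceH3 (u v p q : V) : Option (V × V) → Prop
  | inner_left (p' q' z : V) : p' ∈ T G x y u → q' ∈ T G x y u → G.Adj p' q' →
      IsBest w u {p', q'} z → ChoiceH3 u v p q (some (z, q))
  | inner_right (p' q' z : V) : p' ∈ T G x y v → q' ∈ T G x y v → G.Adj p' q' →
      IsBest w v {p', q'} z → ChoiceH3 u v p q (some (p, z))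
  | cross_left (p' q' : V) : p' ∈ T G x y u → q' ∈ T G x y v → G.Adj p' q' →
      (p', q') ≠ (p, q) →
      w s(u, p') + w s(v, q) ≤ w s(u, p) + w s(v, q') → ChoiceH3 u v p q (some (p', q))
  | cross_right (p' q' : V) : p' ∈ T G x y u → q' ∈ T G x y v → G.Adj p' q' →
      (p', q') ≠ (p, q) →
      w s(u, p) + w s(v, q') ≤ w s(u, p') + w s(v, q) → ChoiceH3 u v p q (some (p, q'))
  | failed : edgesIn G (T G x y u ∪ T G x y v) = {s(p, q)} →
      T G x y u = {p} → T G x y v = {q} → ChoiceH3 u v p q none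
  | only_left (z : V) : edgesIn G (T G x y u ∪ T G x y v) = {s(p, q)} →
      IsBest w u (T G x y u \ {p}) z → T G x y v = {q} → ChoiceH3 u v p q (some (z, q))
  | only_right (z : V) : edgesIn G (T G x y u ∪ T G x y v) = {s(p, q)} →
      T G x y u = {p} → IsBest w v (T G x y v \ {q}) z → ChoiceH3 u v p q (some (p, z))
  | both_left (z z' : V) : edgesIn G (T G x y u ∪ T G x y v) = {s(p, q)} →
      IsBest w u (T G x y u \ {p}) z → IsBest w v (T G x y v \ {q}) z' →
      w s(u, z) + w s(v, q) ≤ w s(u, p) + w s(v, z') → ChoiceH3 u v p q (some (z, q))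
  | both_right (z z' : V) : edgesIn G (T G x y u ∪ T G x y v) = {s(p, q)} →
      IsBest w u (T G x y u \ {p}) z → IsBest w v (T G x y v \ {q}) z' →
      w s(u, p) + w s(v, z') ≤ w s(u, z) + w s(v, q) → ChoiceH3 u v p q (some (p, z'))

/-- Step (h) for paired `T_i`, `T_j`, `u = u_i`, `v = u_j`: with result `some (a, b)` the procedure
adds `u_i a` and `u_j b` to `M`, with result `none` it stops unsuccessfully. -/
inductive StepH (u v : V) : Option (V × V) → Prop
  | h1 (a b : V) : Green G x y u a → Green G x y v b → CondH1 G x y u v a b →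
      StepH u v (some (a, b))
  | h1_failed (a b : V) : Green G x y u a → Green G x y v b → ¬ CondH1 G x y u v a b →
      StepH u v none
  | h2_left (a b : V) : Green G x y u a → (∀ t, ¬ Green G x y v t) → CondH2 G x y u v a →
      ChoiceH2 G x y w u v a b → StepH u v (some (a, b))
  | h2_left_failed (a : V) : Green G x y u a → (∀ t, ¬ Green G x y v t) →
      ¬ CondH2 G x y u v a → StepH u v none
  | h2_right (a b : V) : (∀ t, ¬ Green G x y u t) → Green G x y v b → CondH2 G x y v u b →
      ChoiceH2 G x y w v u b a → StepH u v (some (a, b))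
  | h2_right_failed (b : V) : (∀ t, ¬ Green G x y u t) → Green G x y v b →
      ¬ CondH2 G x y v u b → StepH u v none
  | h3 (p q : V) (r : Option (V × V)) : (∀ t, ¬ Green G x y u t) → (∀ t, ¬ Green G x y v t) →
      p ∈ T G x y u → q ∈ T G x y v → G.Adj p q → ChoiceH3 G x y w u v p q r → StepH u v r

/-- The possible results of Procedure Check(`xy`); there may be several, as the choice among
best vertices and alternatives of equal weight is free. The result `some M` is a successful stop
returning `M`, the result `none` an unsuccessful stop. The function `τ` gives the vertices chosen
in the steps (g) and (h). -/
inductive Check : Option (Finset (Sym2 V)) → Prop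
  | success (M : Finset (Sym2 V)) (τ : V → V) : Tests G x y →
      (∀ u, IsolatedT G x y u → StepG G x y w u (τ u)) →
      (∀ u v, Paired G x y u v → StepH G x y w u v (some (τ u, τ v))) →
      (M : Set (Sym2 V)) =
        {s(x, y)} ∪ M2 G x y ∪ M4 G x y ∪ {e | ∃ u ∈ S2 G x y, e = s(u, τ u)} →
      Check (some M)
  | test_failed : ¬ Tests G x y → Check none
  | pair_failed (u v : V) : Tests G x y → Paired G x y u v → StepH G x y w u v none →
      Check none

/-- A result is correct: a returned edge set is a minimum weight d.i.m. containing `xy`, and an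
unsuccessful stop means that there is no d.i.m. containing `xy` or `G` is not `P₇`-free. -/
def CorrectResult : Option (Finset (Sym2 V)) → Prop
  | some M => IsMinDIMContaining G w x y M
  | none => (¬ ∃ M : Set (Sym2 V), IsDIM G M ∧ s(x, y) ∈ M) ∨ ¬ P7Free G

end Graph

/-! ### A random access machine with step count

The machine has registers and arrays for natural numbers, and registers and arrays for weights.
The only arithmetic on natural numbers is the successor (so that in `t` steps all numbers
grow by at most `t`), the only operations on weights are addition and comparison. -/

structure State where
  /-- number registers -/
  reg : ℕ → ℕ
  /-- number arrays: `arr a i` is the entry `i` of array `a` -/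
  arr : ℕ → ℕ → ℕ
  /-- weight registers -/
  wreg : ℕ → Weight
  /-- weight arrays -/
  warr : ℕ → ℕ → Weight

inductive Test
  | lt (i j : ℕ)
  | eq (i j : ℕ)
  | wle (i j : ℕ)

def Test.Holds (s : State) : Test → Prop
  | .lt i j => s.reg i < s.reg j
  | .eq i j => s.reg i = s.reg j
  | .wle i j => s.wreg i ≤ s.wreg j

/-- Instructions that take one step. The array is fixed by the instruction, its index is taken
from a register. -/
inductive Instr
  /-- `reg i := c` -/
  | const (i c : ℕ)
  /-- `reg i := reg j` -/
  | copy (i j : ℕ)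
  /-- `reg i := reg i + 1` -/
  | succ (i : ℕ)
  /-- `reg i := arr a (reg j)` -/
  | load (i a j : ℕ)
  /-- `arr a (reg j) := reg i` -/
  | store (a j i : ℕ)
  /-- `wreg i := wreg j` -/
  | wcopy (i j : ℕ)
  /-- `wreg i := wreg j + wreg k` -/
  | wadd (i j k : ℕ)
  /-- `wreg i := warr a (reg j)` -/
  | wload (i a j : ℕ)
  /-- `warr a (reg j) := wreg i` -/
  | wstore (a j i : ℕ)

noncomputable def Instr.run (s : State) : Instr → State
  | .const i c => { s with reg := Function.update s.reg i c }
  | .copy i j => { s with reg := Function.update s.reg i (s.reg j) }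
  | .succ i => { s with reg := Function.update s.reg i (s.reg i + 1) }
  | .load i a j => { s with reg := Function.update s.reg i (s.arr a (s.reg j)) }
  | .store a j i =>
      { s with arr := Function.update s.arr a (Function.update (s.arr a) (s.reg j) (s.reg i)) }
  | .wcopy i j => { s with wreg := Function.update s.wreg i (s.wreg j) }
  | .wadd i j k => { s with wreg := Function.update s.wreg i (s.wreg j + s.wreg k) }
  | .wload i a j => { s with wreg := Function.update s.wreg i (s.warr a (s.reg j)) }
  | .wstore a j i =>
      { s with
        warr := Function.update s.warr a (Function.update (s.warr a) (s.reg j) (s.wreg i)) }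

inductive Program
  | instr (c : Instr)
  | seq (p q : Program)
  | branch (b : Test) (p q : Program)
  | loop (b : Test) (p : Program)

/-- `Exec p s s' t`: program `p` started in state `s` halts in state `s'` after exactly `t` steps.
Each instruction and each evaluation of a test is one step. -/
inductive Exec : Program → State → State → ℕ → Prop
  | instr (c : Instr) (s : State) : Exec (.instr c) s (c.run s) 1
  | seq {p q : Program} {s s' s'' : State} {t t' : ℕ} :
      Exec p s s' t → Exec q s' s'' t' → Exec (.seq p q) s s'' (t + t')
  | branch_true {b : Test} {p q : Program} {s s' : State} {t : ℕ} :
      b.Holds s → Exec p s s' t → Exec (.branch b p q) s s' (t + 1)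
  | branch_false {b : Test} {p q : Program} {s s' : State} {t : ℕ} :
      ¬ b.Holds s → Exec q s s' t → Exec (.branch b p q) s s' (t + 1)
  | loop_true {b : Test} {p : Program} {s s' s'' : State} {t t' : ℕ} :
      b.Holds s → Exec p s s' t → Exec (.loop b p) s' s'' t' →
        Exec (.loop b p) s s'' (t + t' + 1)
  | loop_false {b : Test} {p : Program} {s : State} :
      ¬ b.Holds s → Exec (.loop b p) s s 1

/-- The initial state `s` encodes the input `G`, `w`, `x`, `y`. Registers 0, 1, 2 hold `n`, `x`,
`y`. The adjacency lists (in any order) are stored consecutively in array 1, the list of `v` being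
the block from position `arr 0 v` to position `arr 0 (v + 1) - 1`; weight array 0 holds the
weights of the corresponding edges. All other cells are 0. -/
structure Encodes {n : ℕ} (G : SimpleGraph (Fin n)) (w : Sym2 (Fin n) → Weight) (x y : Fin n)
    (s : State) : Prop where
  size : s.reg 0 = n
  fst : s.reg 1 = x
  snd : s.reg 2 = y
  first_block : s.arr 0 0 = 0
  block_le : ∀ v : Fin n, s.arr 0 v ≤ s.arr 0 (v + 1)
  block : ∀ v : Fin n, Set.BijOn (s.arr 1) (Set.Ico (s.arr 0 v) (s.arr 0 (v + 1)))
    ((fun u : Fin n => (u : ℕ)) '' G.neighborSet v)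
  weight : ∀ v u : Fin n, ∀ i ∈ Set.Ico (s.arr 0 v) (s.arr 0 (v + 1)),
    s.arr 1 i = u → s.warr 0 i = w s(v, u)
  reg_zero : ∀ i, 3 ≤ i → s.reg i = 0
  blocks_zero : ∀ i, n < i → s.arr 0 i = 0
  lists_zero : ∀ i, s.arr 0 n ≤ i → s.arr 1 i = 0
  arr_zero : ∀ a, 2 ≤ a → ∀ i, s.arr a i = 0
  wreg_zero : ∀ i, s.wreg i = 0
  weights_zero : ∀ i, s.arr 0 n ≤ i → s.warr 0 i = 0
  warr_zero : ∀ a, 1 ≤ a → ∀ i, s.warr a i = 0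

/-- The output that a final state represents: register 0 holds 0 for an unsuccessful stop and 1
for a successful stop; in the latter case register 1 holds the number of edges of `M`, and the
edges of `M` are listed, without repetition, through their endpoints in arrays 2 and 3. -/
def Outputs {n : ℕ} (s : State) : Option (Finset (Sym2 (Fin n))) → Prop
  | none => s.reg 0 = 0
  | some M => s.reg 0 = 1 ∧ s.reg 1 = M.card ∧
      ∀ e, e ∈ M ↔ ∃ i < s.reg 1, ∃ a b : Fin n, s.arr 2 i = a ∧ s.arr 3 i = b ∧ e = s(a, b)

end DimCheck

/-! A d.i.m. is the same as a set `B` of black vertices (its endpoints) such that no two white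
vertices are adjacent and every black vertex has exactly one black neighbor (`DimColor`). If it
contains `xy`, nearly all colors are forced: N₀ and N₂ are black, N₁ is white, and a black vertex of
N₃ is matched into N₂. If moreover N₅ is empty and N₄ induces disjoint edges and vertices, then S₃
and S₄ are white and the ends of edges inside N₄ are black. What remains free is the partner `τ u`
in `T u` of every `u` in S₂ (`IsColor.exists_selection`, with converse `isColor_black`).

All tests are necessary for such a coloring, except the four in `PathTests`. These follow when the
graph is `P₇`-free: an induced path on four vertices that has only its last vertex in N₂ and the
others farther away continues through N₁ and the `P₃` around `xy` to an induced `P₇`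
(`no_path_to_level_two`), and a set paired with two others gives a `P₇` directly.

Edges at `T u` whose other end is not forced to be black lead to `T u`, to a paired `T v`, or to the
white set S₃ ∪ S₄. Hence the choices interact only inside an isolated set or a pair, where the
requirement is `Valid`. The tests leave so few edges there that the valid choices can be listed, and
steps (g) and (h) select exactly the optimal ones (`stepG_iff`, `stepH_correct`, `stepH_of_opt`).
The weight is a constant plus a sum over S₂, so local optimality is global optimality
(`check_some_correct`).

For the running time the program does not imitate the case distinctions. It checks only `PathTests`,
and it finds the valid choices by counting: `t` is a candidate if the number of edges at `t` equals
the number of edges still to be covered (`ChoiceData.candidate_iff`). For a pair it fixes one edge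
between the two sets; every valid choice contains exactly one end of it, so two alternatives are
compared. The resulting coloring is then verified. Success proves the remaining tests by their
necessity; failure means that a test fails or that there is no d.i.m. containing `xy`. In either
case the output is a possible result of the procedure. In the arrays the value 0 means "none", so
levels, indices of sets and vertices are stored increased by one. -/

set_option linter.unusedSectionVars false
set_option linter.unusedSimpArgs false

namespace DimCheck

/-! ### Distance levels and the sets `S2`, `S4`, `S3`, `T` in terms of adjacency -/

section Levels

variable {V : Type*} {G : SimpleGraph V} {x y : V}

/-- The distance of `z` from `{x, y}`. -/
noncomputable def lv (G : SimpleGraph V) (x y z : V) : ℕ := min (G.dist z x) (G.dist z y)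

theorem mem_level {i : ℕ} {z : V} : z ∈ level G x y i ↔ lv G x y z = i := Iff.rfl

theorem lv_adj_le (hc : G.Connected) {a b : V} (h : G.Adj a b) : lv G x y a ≤ lv G x y b + 1 := by
  have h1 := hc.dist_triangle (u := a) (v := b) (w := x)
  have h2 := hc.dist_triangle (u := a) (v := b) (w := y)
  have h3 : G.dist a b = 1 := SimpleGraph.dist_eq_one_iff_adj.2 h
  unfold lv
  omega

theorem lv_zero_iff (hc : G.Connected) {z : V} : lv G x y z = 0 ↔ z = x ∨ z = y := by
  unfold lv
  rw [Nat.min_eq_zero_iff, hc.dist_eq_zero_iff, hc.dist_eq_zero_iff]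

theorem exists_adj_dist (hc : G.Connected) {z x : V} {d : ℕ} (h : G.dist z x = d + 1) :
    ∃ a, G.Adj z a ∧ G.dist a x = d := by
  obtain ⟨p, hp⟩ := hc.exists_walk_length_eq_dist z x
  cases p with
  | nil =>
    rw [SimpleGraph.dist_self] at h
    omega
  | @cons _ a _ hadj q =>
    refine ⟨a, hadj, ?_⟩
    have h1 := SimpleGraph.dist_le q
    rw [SimpleGraph.Walk.length_cons] at hp
    have h2 := hc.dist_triangle (u := z) (v := a) (w := x)
    have h3 := SimpleGraph.dist_eq_one_iff_adj.2 hadj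
    omega

theorem exists_adj_lv (hc : G.Connected) {z : V} {d : ℕ} (h : lv G x y z = d + 1) :
    ∃ a, G.Adj z a ∧ lv G x y a = d := by
  have key : ∀ a, G.Adj z a → lv G x y a ≤ d → lv G x y a = d := fun a ha h' => by
    have := lv_adj_le (x := x) (y := y) hc ha
    omega
  unfold lv at h
  rcases min_choice (G.dist z x) (G.dist z y) with h' | h'
  · obtain ⟨a, ha, hd⟩ := exists_adj_dist hc (h'.symm.trans h)
    exact ⟨a, ha, key a ha (hd ▸ min_le_left _ _)⟩
  · obtain ⟨a, ha, hd⟩ := exists_adj_dist hc (h'.symm.trans h)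
    exact ⟨a, ha, key a ha (hd ▸ min_le_right _ _)⟩

theorem exists_lv_eq (hc : G.Connected) {d : ℕ} {z : V} (h : d ≤ lv G x y z) :
    ∃ a, lv G x y a = d := by
  obtain ⟨k, hk⟩ := Nat.exists_eq_add_of_le h
  induction k generalizing z with
  | zero => exact ⟨z, hk⟩
  | succ k ih =>
    obtain ⟨a, -, ha⟩ := exists_adj_lv hc (d := d + k) (by omega)
    exact ih (by omega) ha

/-- Descending towards `{x, y}` lowers the level by one at a time, so no level can be skipped. -/
theorem lv_le_four (hc : G.Connected) (h5 : level G x y 5 = ∅) (z : V) : lv G x y z ≤ 4 := by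
  by_contra h
  obtain ⟨a, ha⟩ := exists_lv_eq (x := x) (y := y) (d := 5) (z := z) hc (by omega)
  exact (h5 ▸ (mem_level.2 ha) : a ∈ (∅ : Set V))

theorem lv_adj_cases (hc : G.Connected) {a b : V} (h : G.Adj a b) :
    lv G x y b = lv G x y a ∨ lv G x y b = lv G x y a + 1 ∨ lv G x y a = lv G x y b + 1 := by
  have h1 := lv_adj_le (x := x) (y := y) hc h
  have h2 := lv_adj_le (x := x) (y := y) hc h.symm
  omega

/-- `v` has a neighbor in its own level. -/
def Dbl (G : SimpleGraph V) (x y v : V) : Prop := ∃ a, G.Adj v a ∧ lv G x y a = lv G x y v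

theorem mem_isolatedIn_level {i : ℕ} {v : V} :
    v ∈ isolatedIn G (level G x y i) ↔ lv G x y v = i ∧ ¬ Dbl G x y v := by
  constructor
  · rintro ⟨h, h'⟩
    exact ⟨h, fun ⟨a, ha, hl⟩ => h' a (mem_level.2 (hl.trans h)) ha⟩
  · rintro ⟨h, h'⟩
    exact ⟨h, fun a ha hl => h' ⟨a, hl, (mem_level.1 ha).trans h.symm⟩⟩

theorem mem_S2 {v : V} : v ∈ S2 G x y ↔ lv G x y v = 2 ∧ ¬ Dbl G x y v := mem_isolatedIn_level

theorem mem_S4 {v : V} : v ∈ S4 G x y ↔ lv G x y v = 4 ∧ ¬ Dbl G x y v := mem_isolatedIn_level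

theorem exists_mem_edgesIn_level {i : ℕ} {v : V} :
    (∃ e ∈ edgesIn G (level G x y i), v ∈ e) ↔ lv G x y v = i ∧ Dbl G x y v := by
  constructor
  · rintro ⟨e, ⟨he, hl⟩, hv⟩
    obtain ⟨a, rfl⟩ := Sym2.mem_iff_exists.1 hv
    refine ⟨hl v hv, a, he, ?_⟩
    exact (mem_level.1 (hl a (Sym2.mem_mk_right _ _))).trans (mem_level.1 (hl v hv)).symm
  · rintro ⟨h, a, ha, hl⟩
    refine ⟨s(v, a), ⟨ha, fun z hz => ?_⟩, Sym2.mem_mk_left _ _⟩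
    rcases Sym2.mem_iff.1 hz with rfl | rfl
    · exact h
    · exact hl.trans h

/-- Being in `Ttwo` becomes having two different neighbors. Finiteness matters, since `ncard` of an
infinite set is 0. -/
theorem mem_S3 [Finite V] {t : V} : t ∈ S3 G x y ↔ lv G x y t = 3 ∧
    ((∃ v, G.Adj t v ∧ (lv G x y v = 2 ∨ lv G x y v = 4) ∧ Dbl G x y v) ∨
      ∃ u ∈ S2 G x y, ∃ v ∈ S2 G x y, u ≠ v ∧ G.Adj t u ∧ G.Adj t v) := by
  have h2 : t ∈ Ttwo G x y ↔ lv G x y t = 3 ∧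
      ∃ u ∈ S2 G x y, ∃ v ∈ S2 G x y, u ≠ v ∧ G.Adj t u ∧ G.Adj t v := by
    refine and_congr Iff.rfl ?_
    rw [← Nat.lt_iff_add_one_le, Set.one_lt_ncard (Set.toFinite _)]
    constructor
    · rintro ⟨a, ⟨ha, ha'⟩, b, ⟨hb, hb'⟩, hab⟩
      exact ⟨a, ha', b, hb', hab, ha, hb⟩
    · rintro ⟨a, ha', b, hb', hab, ha, hb⟩
      exact ⟨a, ⟨ha, ha'⟩, b, ⟨hb, hb'⟩, hab⟩
  constructor
  · rintro (⟨h, e, he, v, hv, hadj⟩ | h)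
    · refine ⟨h, Or.inl ⟨v, hadj, ?_⟩⟩
      rcases he with he | he
      · have := exists_mem_edgesIn_level.1 ⟨e, he, hv⟩
        exact ⟨Or.inl this.1, this.2⟩
      · have := exists_mem_edgesIn_level.1 ⟨e, he, hv⟩
        exact ⟨Or.inr this.1, this.2⟩
    · exact ⟨(h2.1 h).1, Or.inr (h2.1 h).2⟩
  · rintro ⟨h, ⟨v, hadj, hl, hd⟩ | h'⟩
    · rcases hl with hl | hl
      · obtain ⟨e, he, hv⟩ := exists_mem_edgesIn_level.2 ⟨hl, hd⟩
        exact Or.inl ⟨h, e, Or.inl he, v, hv, hadj⟩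
      · obtain ⟨e, he, hv⟩ := exists_mem_edgesIn_level.2 ⟨hl, hd⟩
        exact Or.inl ⟨h, e, Or.inr he, v, hv, hadj⟩
    · exact Or.inr (h2.2 ⟨h, h'⟩)

/-- The form used later: apart from `u`, a vertex of `T u` sees no vertex of N₂ at all, and in N₄ it
sees only isolated vertices. -/
theorem mem_T [Finite V] {u t : V} (hu : u ∈ S2 G x y) : t ∈ T G x y u ↔
    lv G x y t = 3 ∧ G.Adj t u ∧ (∀ v ∈ S2 G x y, G.Adj t v → v = u) ∧
      ∀ v, (lv G x y v = 2 ∨ lv G x y v = 4) → Dbl G x y v → ¬ G.Adj t v := by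
  constructor
  · rintro ⟨⟨h1, h2⟩, h3⟩
    have hl : lv G x y t = 3 := h1.1
    refine ⟨hl, SimpleGraph.Adj.symm h3, fun v hv hadj => ?_, fun v hv hd hadj => ?_⟩
    · by_contra hne
      exact h2 (mem_S3.2 ⟨hl, Or.inr ⟨v, hv, u, hu, hne, hadj, SimpleGraph.Adj.symm h3⟩⟩)
    · exact h2 (mem_S3.2 ⟨hl, Or.inl ⟨v, hadj, hv, hd⟩⟩)
  · rintro ⟨hl, ha, h1, h2⟩
    refine ⟨⟨⟨hl, ?_⟩, fun h => ?_⟩, SimpleGraph.Adj.symm ha⟩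
    · rw [Set.ncard_eq_one]
      refine ⟨u, Set.ext fun v => ⟨fun h => h1 v h.2 h.1, ?_⟩⟩
      rintro rfl
      exact ⟨ha, hu⟩
    · rcases (mem_S3.1 h).2 with ⟨v, hadj, hv, hd⟩ | ⟨a, ha', b, hb', hab, ha, hb⟩
      · exact h2 v hv hd hadj
      · exact hab ((h1 a ha' ha).trans (h1 b hb' hb).symm)

theorem T_lv {u t : V} (h : t ∈ T G x y u) : lv G x y t = 3 := h.1.1.1

theorem T_adj {u t : V} (h : t ∈ T G x y u) : G.Adj u t := h.2

theorem T_not_mem_S3 {u t : V} (h : t ∈ T G x y u) : t ∉ S3 G x y := h.1.2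

theorem T_not_mem_S {u t : V} (h : t ∈ T G x y u) : t ∉ S3 G x y ∪ S4 G x y := by
  rintro (h' | h')
  · exact T_not_mem_S3 h h'
  · have := T_lv h
    have := (mem_S4.1 h').1
    omega

theorem T_unique [Finite V] {u v t : V} (hu : u ∈ S2 G x y) (hv : v ∈ S2 G x y)
    (h : t ∈ T G x y u) (h' : t ∈ T G x y v) : u = v :=
  ((mem_T hv).1 h').2.2.1 u hu (SimpleGraph.Adj.symm h.2)

/-- A vertex of level three is in `S₃` or in some `T_u`. -/
theorem level_three_cases [Finite V] (hc : G.Connected) {t : V} (h : lv G x y t = 3) :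
    t ∈ S3 G x y ∨ ∃ u ∈ S2 G x y, t ∈ T G x y u := by
  by_contra hn
  push Not at hn
  obtain ⟨u, hadj, hu⟩ := exists_adj_lv hc h
  have hn1 := hn.1
  rw [mem_S3] at hn1
  have hd : ¬ Dbl G x y u := fun hd => hn1 ⟨h, Or.inl ⟨u, hadj, Or.inl hu, hd⟩⟩
  have hS : u ∈ S2 G x y := mem_S2.2 ⟨hu, hd⟩
  refine hn.2 u hS ((mem_T hS).2 ⟨h, hadj, fun v hv hv' => ?_, fun v hv hd hadj => ?_⟩)
  · by_contra hne
    exact hn1 ⟨h, Or.inr ⟨v, hv, u, hS, hne, hv', hadj⟩⟩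
  · exact hn1 ⟨h, Or.inl ⟨v, hadj, hv, hd⟩⟩

end Levels

/-! ### Induced paths with seven vertices -/

section Paths

variable {V : Type*} {G : SimpleGraph V}

theorem not_P7Free_of_path (f : Fin 7 → V)
    (hf : ∀ i j : Fin 7, i < j → (G.Adj (f i) (f j) ↔ i.val + 1 = j.val)) : ¬ P7Free G := by
  have hadj : ∀ i j : Fin 7, G.Adj (f i) (f j) ↔ (SimpleGraph.pathGraph 7).Adj i j := by
    intro i j
    rw [SimpleGraph.pathGraph_adj]
    rcases lt_trichotomy i j with h | rfl | h
    · rw [hf i j h]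
      have : i.val < j.val := h
      omega
    · simp
    · rw [G.adj_comm, hf j i h]
      have : j.val < i.val := h
      omega
  -- Injectivity is free: equal images have equal neighborhoods, and different vertices of the path
  -- on seven vertices have different neighborhoods.
  have hsep : ∀ i j : Fin 7, (∀ k : Fin 7, (k.val + 1 = i.val ∨ i.val + 1 = k.val) ↔
      (k.val + 1 = j.val ∨ j.val + 1 = k.val)) → i = j := by decide
  have hinj : Function.Injective f := by
    intro i j hij
    refine hsep i j fun k => ?_
    have h1 := hadj k i
    have h2 := hadj k j
    rw [SimpleGraph.pathGraph_adj] at h1 h2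
    rw [hij] at h1
    exact h1.symm.trans h2
  exact fun h => h ⟨⟨⟨f, hinj⟩, fun {i j} => hadj i j⟩⟩

theorem not_P7Free_of_seven {a b c d e f g : V} (hab : G.Adj a b) (hbc : G.Adj b c)
    (hcd : G.Adj c d) (hde : G.Adj d e) (hef : G.Adj e f) (hfg : G.Adj f g)
    (hac : ¬ G.Adj a c) (had : ¬ G.Adj a d) (hae : ¬ G.Adj a e) (haf : ¬ G.Adj a f)
    (hag : ¬ G.Adj a g) (hbd : ¬ G.Adj b d) (hbe : ¬ G.Adj b e) (hbf : ¬ G.Adj b f)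
    (hbg : ¬ G.Adj b g) (hce : ¬ G.Adj c e) (hcf : ¬ G.Adj c f) (hcg : ¬ G.Adj c g)
    (hdf : ¬ G.Adj d f) (hdg : ¬ G.Adj d g) (heg : ¬ G.Adj e g) : ¬ P7Free G := by
  apply not_P7Free_of_path ![a, b, c, d, e, f, g]
  intro i j hij
  fin_cases i <;> fin_cases j <;> first
    | (exfalso; revert hij; decide)
    | simp [*]

variable {x y : V}

/-- The third vertex of the `P₃` sees exactly one of `x` and `y`. It supplies the end of a long path
when a vertex of N₁ sees both `x` and `y`. -/
theorem EdgeInP3.exists_third (h : EdgeInP3 G x y) :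
    ∃ r, r ≠ x ∧ r ≠ y ∧ ((G.Adj r x ∧ ¬ G.Adj r y) ∨ (G.Adj r y ∧ ¬ G.Adj r x)) := by
  obtain ⟨hxy, f, ⟨i, rfl⟩, ⟨j, rfl⟩⟩ := h
  rw [f.map_adj_iff] at hxy
  have key : ∀ i j : Fin 3, (i.val + 1 = j.val ∨ j.val + 1 = i.val) → ∃ k : Fin 3, k ≠ i ∧ k ≠ j ∧
    (((k.val + 1 = i.val ∨ i.val + 1 = k.val) ∧ ¬ (k.val + 1 = j.val ∨ j.val + 1 = k.val)) ∨
     ((k.val + 1 = j.val ∨ j.val + 1 = k.val) ∧ ¬ (k.val + 1 = i.val ∨ i.val + 1 = k.val))) := by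
    decide
  obtain ⟨k, h1, h2, h3⟩ := key i j (SimpleGraph.pathGraph_adj.1 hxy)
  refine ⟨f k, fun h => h1 (f.injective h), fun h => h2 (f.injective h), ?_⟩
  simpa only [f.map_adj_iff, SimpleGraph.pathGraph_adj] using h3

theorem not_adj_of_lv (hc : G.Connected) {a b : V} (h : lv G x y a + 2 ≤ lv G x y b) :
    ¬ G.Adj a b := fun hadj => by
  have := lv_adj_le (x := x) (y := y) hc hadj.symm
  omega

/-- In a `P₇`-free graph with `N₁` stable there is no induced path with four vertices
having exactly its last vertex in `N₂` and the others farther away. -/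
theorem no_path_to_level_two (hc : G.Connected) (hP : EdgeInP3 G x y) (h7 : P7Free G)
    (h1 : G.IsIndepSet (level G x y 1)) {a b c v : V} (ha : 3 ≤ lv G x y a)
    (hb : 3 ≤ lv G x y b) (hcl : 3 ≤ lv G x y c) (hv : lv G x y v = 2)
    (hab : G.Adj a b) (hbc : G.Adj b c) (hcv : G.Adj c v) (hac : ¬ G.Adj a c)
    (hav : ¬ G.Adj a v) (hbv : ¬ G.Adj b v) : False := by
  have hlx : lv G x y x = 0 := (lv_zero_iff hc).2 (Or.inl rfl)
  have hly : lv G x y y = 0 := (lv_zero_iff hc).2 (Or.inr rfl)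
  have far : ∀ z, lv G x y z ≤ 1 → ¬ G.Adj a z ∧ ¬ G.Adj b z ∧ ¬ G.Adj c z := fun z hz =>
    ⟨fun h => not_adj_of_lv (x := x) (y := y) hc (by omega) h.symm, fun h => not_adj_of_lv (x := x) (y := y) hc (by omega) h.symm,
      fun h => not_adj_of_lv (x := x) (y := y) hc (by omega) h.symm⟩
  -- Since `a`, `b`, `c` have level at least three, they see nothing in N₀ ∪ N₁. So any induced path
  -- `v`, `e`, `f`, `g` with `e`, `f`, `g` in these levels completes a `P₇`.
  have key : ∀ e f g, G.Adj v e → G.Adj e f → G.Adj f g → ¬ G.Adj v f → ¬ G.Adj v g →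
      ¬ G.Adj e g → lv G x y e ≤ 1 → lv G x y f ≤ 1 → lv G x y g ≤ 1 → False := by
    intro e f g hve hef hfg hvf hvg heg he hf hg
    exact not_P7Free_of_seven hab hbc hcv hve hef hfg hac hav (far e he).1 (far f hf).1 (far g hg).1
      hbv (far e he).2.1 (far f hf).2.1 (far g hg).2.1 (far e he).2.2 (far f hf).2.2
      (far g hg).2.2 hvf hvg heg h7
  have far2 : ∀ z, lv G x y z = 0 → ¬ G.Adj v z := fun z hz h =>
    not_adj_of_lv (x := x) (y := y) hc (by omega) h.symm
  obtain ⟨n, hvn, hn⟩ := exists_adj_lv hc (d := 1) hv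
  obtain ⟨m, hnm, hm⟩ := exists_adj_lv hc (d := 0) hn
  have hxy := hP.1
  obtain ⟨r, hrx, hry, hr⟩ := hP.exists_third
  have aux : ∀ p q, lv G x y p = 0 → lv G x y q = 0 → G.Adj p q → G.Adj n p → r ≠ p → r ≠ q →
      G.Adj r p → ¬ G.Adj r q → False := by
    intro p q hp hq hpq hnp hrp hrq hrpa hrqa
    have hr0 : lv G x y r ≠ 0 := fun h => ((lv_zero_iff hc).1 h).elim hrx hry
    have hr1 : lv G x y r = 1 := by
      have := lv_adj_le (x := x) (y := y) hc hrpa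
      omega
    by_cases hnq : G.Adj n q
    · have hnr : ¬ G.Adj n r := h1 hn hr1 (by rintro rfl; exact hrqa hnq)
      by_cases hvr : G.Adj v r
      · exact key r p q hvr hrpa hpq (far2 p hp) (far2 q hq) hrqa hr1.le (by omega) (by omega)
      · exact key n p r hvn hnp hrpa.symm (far2 p hp) hvr hnr hn.le (by omega) hr1.le
    · exact key n p q hvn hnp hpq (far2 p hp) (far2 q hq) hnq hn.le (by omega) (by omega)
  by_cases hnx : G.Adj n x
  · by_cases hny : G.Adj n y
    · rcases hr with ⟨h, h'⟩ | ⟨h, h'⟩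
      · exact aux x y hlx hly hxy hnx hrx hry h h'
      · exact aux y x hly hlx hxy.symm hny hry hrx h h'
    · exact key n x y hvn hnx hxy (far2 x hlx) (far2 y hly) hny hn.le (by omega) (by omega)
  · have hny : G.Adj n y := by
      rcases (lv_zero_iff hc).1 hm with rfl | rfl
      · exact absurd hnm hnx
      · exact hnm
    exact key n y x hvn hny hxy.symm (far2 y hly) (far2 x hlx) hnx hn.le (by omega) (by omega)

end Paths

/-! ### Dominating induced matchings as colorings, and the forced colors -/

section Colorings

variable {V : Type*} {G : SimpleGraph V} {x y : V}

/-- `B` is the set of endpoints of a d.i.m. -/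
structure DimColor (G : SimpleGraph V) (B : Set V) : Prop where
  cover : ∀ a b, G.Adj a b → a ∈ B ∨ b ∈ B
  exists_adj : ∀ a ∈ B, ∃ b ∈ B, G.Adj a b
  unique : ∀ a ∈ B, ∀ b ∈ B, ∀ c ∈ B, G.Adj a b → G.Adj a c → b = c

theorem mem_edgesIn {U : Set V} {a b : V} :
    s(a, b) ∈ edgesIn G U ↔ G.Adj a b ∧ a ∈ U ∧ b ∈ U := by
  simp [edgesIn]

theorem DimColor.isDIM {B : Set V} (hB : DimColor G B) : IsDIM G (edgesIn G B) := by
  refine ⟨⟨fun e he => he.1, ?_⟩, fun e he => he.1, ?_⟩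
  · intro e he e' he' hne u hu v hv
    obtain ⟨a, rfl⟩ := Sym2.mem_iff_exists.1 hu
    obtain ⟨b, rfl⟩ := Sym2.mem_iff_exists.1 hv
    rw [mem_edgesIn] at he he'
    refine ⟨?_, fun huv => hne ?_⟩
    · rintro rfl
      exact hne (by rw [hB.unique u he.2.1 a he.2.2 b he'.2.2 he.1 he'.1])
    · rw [hB.unique u he.2.1 a he.2.2 v he'.2.1 he.1 huv,
        hB.unique v he'.2.1 b he'.2.2 u he.2.1 he'.1 huv.symm, Sym2.eq_swap]
  · intro e
    induction e using Sym2.ind with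
    | _ a b =>
      intro he _
      rcases hB.cover a b he with h | h
      · obtain ⟨c, hc, hac⟩ := hB.exists_adj a h
        exact ⟨s(a, c), mem_edgesIn.2 ⟨hac, h, hc⟩, a, by simp, by simp⟩
      · obtain ⟨c, hc, hac⟩ := hB.exists_adj b h
        exact ⟨s(b, c), mem_edgesIn.2 ⟨hac, h, hc⟩, b, by simp, by simp⟩

/-- Because `M` is induced, an edge between two endpoints of `M` must itself belong to `M`. So `M`
can be recovered from its endpoints. -/
theorem IsDIM.dimColor {M : Set (Sym2 V)} (hM : IsDIM G M) :
    DimColor G {v | ∃ e ∈ M, v ∈ e} ∧ M = edgesIn G {v | ∃ e ∈ M, v ∈ e} := by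
  obtain ⟨⟨hsub, hind⟩, -, hdom⟩ := hM
  have hmate : ∀ a b, G.Adj a b → (∃ e ∈ M, a ∈ e) → (∃ e ∈ M, b ∈ e) → s(a, b) ∈ M := by
    rintro a b hab ⟨e, he, ha⟩ ⟨e', he', hb⟩
    by_cases h : e = e'
    · subst h
      rwa [((Sym2.mem_and_mem_iff hab.ne).1 ⟨ha, hb⟩)] at he
    · exact absurd hab (hind e he e' he' h a ha b hb).2
  refine ⟨⟨fun a b hab => ?_, ?_, ?_⟩, ?_⟩
  · by_cases h : s(a, b) ∈ M
    · exact Or.inl ⟨_, h, by simp⟩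
    · obtain ⟨e', he', v, hv, hv'⟩ := hdom _ hab h
      rcases Sym2.mem_iff.1 hv with rfl | rfl
      · exact Or.inl ⟨e', he', hv'⟩
      · exact Or.inr ⟨e', he', hv'⟩
  · rintro a ⟨e, he, ha⟩
    obtain ⟨b, rfl⟩ := Sym2.mem_iff_exists.1 ha
    exact ⟨b, ⟨_, he, by simp⟩, hsub he⟩
  · intro a ha b hb c hc hab hac
    have h1 := hmate a b hab ha hb
    have h2 := hmate a c hac ha hc
    by_contra hne
    refine (hind _ h1 _ h2 ?_ a (by simp) a (by simp)).1 rfl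
    simpa [Sym2.eq_iff] using ⟨hne, fun h => absurd h hac.ne⟩
  · ext e
    induction e using Sym2.ind with
    | _ a b =>
      rw [mem_edgesIn]
      exact ⟨fun h => ⟨hsub h, ⟨_, h, by simp⟩, ⟨_, h, by simp⟩⟩, fun h => hmate a b h.1 h.2.1 h.2.2⟩

/-- `B` is the set of endpoints of a d.i.m. that contains the edge `xy` of the connected
graph `G`. -/
structure IsColor (G : SimpleGraph V) (x y : V) (B : Set V) : Prop extends DimColor G B where
  conn : G.Connected
  adj : G.Adj x y
  fst : x ∈ B
  snd : y ∈ B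

/-- The tests that do not follow from the existence of a d.i.m. containing `xy`. -/
structure PathTests (G : SimpleGraph V) (x y : V) : Prop where
  level_five : level G x y 5 = ∅
  level_four : IsEdgesAndVertices G (level G x y 4)
  star_sees : ∀ u ∈ S2 G x y, ∀ v ∈ S2 G x y, u ≠ v → ¬ Sees G (Y G x y u) (T G x y v)
  pairs : TestC G x y

theorem Tests.pathTests (h : Tests G x y) : PathTests G x y :=
  ⟨h.1.level_five, h.1.level_four, h.1.star_sees, h.2.1⟩

theorem mem_Y {u a : V} : a ∈ Y G x y u ↔ a ∈ T G x y u ∧ ∃ b ∈ T G x y u, G.Adj a b := by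
  simp [Y, isolatedIn]

namespace IsColor

variable {B : Set V} (hB : IsColor G x y B)

include hB

theorem white_of_adj {a b c : V} (ha : a ∈ B) (hb : b ∈ B) (hab : G.Adj a b) (hac : G.Adj a c)
    (hne : c ≠ b) : c ∉ B := fun hc => hne (hB.unique a ha c hc b hb hac hab)

theorem level_zero {z : V} (h : lv G x y z = 0) : z ∈ B := by
  rcases (lv_zero_iff hB.conn).1 h with rfl | rfl
  · exact hB.fst
  · exact hB.snd

theorem level_one {z : V} (h : lv G x y z = 1) : z ∉ B := by
  obtain ⟨a, hza, ha⟩ := exists_adj_lv hB.conn (d := 0) h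
  have hx : lv G x y x = 0 := (lv_zero_iff hB.conn).2 (Or.inl rfl)
  have hy : lv G x y y = 0 := (lv_zero_iff hB.conn).2 (Or.inr rfl)
  rcases (lv_zero_iff hB.conn).1 ha with rfl | rfl
  · exact hB.white_of_adj hB.fst hB.snd hB.adj hza.symm (by rintro rfl; omega)
  · exact hB.white_of_adj hB.snd hB.fst hB.adj.symm hza.symm (by rintro rfl; omega)

theorem level_two {z : V} (h : lv G x y z = 2) : z ∈ B := by
  obtain ⟨a, hza, ha⟩ := exists_adj_lv hB.conn (d := 1) h
  exact (hB.cover z a hza).resolve_right (hB.level_one ha)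

/-- A black vertex of N₃ has a neighbor in N₂, which is black and therefore its only black neighbor.
-/
theorem level_three {a b : V} (h : lv G x y a = 3) (ha : a ∈ B) (hb : b ∈ B)
    (hab : G.Adj a b) : lv G x y b = 2 := by
  obtain ⟨c, hac, hc⟩ := exists_adj_lv hB.conn (d := 2) h
  rwa [hB.unique a ha b hb c (hB.level_two hc) hab hac]

/-- Nothing lies above N₄, and a black vertex of N₃ is already matched downwards. -/
theorem level_four (h5 : level G x y 5 = ∅) {a b : V} (h : lv G x y a = 4) (ha : a ∈ B)
    (hb : b ∈ B) (hab : G.Adj a b) : lv G x y b = 4 := by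
  have h4 := lv_le_four hB.conn h5 b
  rcases lv_adj_cases (x := x) (y := y) hB.conn hab with h' | h' | h'
  · omega
  · omega
  · have := hB.level_three (by omega) hb ha hab.symm
    omega

/-- An edge inside N₄ has a black end, which is matched inside N₄; as G[N₄] has maximum degree one,
its partner is the other end. -/
theorem mem_level_four (h5 : level G x y 5 = ∅) (h4 : IsEdgesAndVertices G (level G x y 4))
    {z : V} (h : lv G x y z = 4) : z ∈ B ↔ Dbl G x y z := by
  constructor
  · intro hz
    obtain ⟨b, hb, hzb⟩ := hB.exists_adj z hz
    exact ⟨b, hzb, (hB.level_four h5 h hz hb hzb).trans h.symm⟩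
  · rintro ⟨a, hza, ha⟩
    refine (hB.cover z a hza).elim id fun haB => ?_
    obtain ⟨b, hb, hab⟩ := hB.exists_adj a haB
    have hb4 := hB.level_four h5 (ha.trans h) haB hb hab
    rwa [h4 a (ha.trans h) z h b hb4 hza.symm hab]

theorem S4_white (h5 : level G x y 5 = ∅) {z : V} (h : z ∈ S4 G x y) : z ∉ B := by
  rw [mem_S4] at h
  intro hz
  obtain ⟨b, hb, hzb⟩ := hB.exists_adj z hz
  exact h.2 ⟨b, hzb, (hB.level_four h5 h.1 hz hb hzb).trans h.1.symm⟩

/-- The vertex `v` is matched with its neighbor in its own level, so no other neighbor of `v` is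
black. -/
theorem white_of_dbl (h5 : level G x y 5 = ∅) (h4 : IsEdgesAndVertices G (level G x y 4))
    {t v : V} (ht : lv G x y t = 3) (hv : lv G x y v = 2 ∨ lv G x y v = 4) (hd : Dbl G x y v)
    (htv : G.Adj t v) : t ∉ B := by
  obtain ⟨a, hva, ha⟩ := hd
  refine hB.white_of_adj (a := v) (b := a) ?_ ?_ hva htv.symm (by rintro rfl; omega)
  · rcases hv with hv | hv
    · exact hB.level_two hv
    · exact (hB.mem_level_four h5 h4 hv).2 ⟨a, hva, ha⟩
  · rcases hv with hv | hv
    · exact hB.level_two (ha.trans hv)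
    · exact (hB.mem_level_four h5 h4 (ha.trans hv)).2 ⟨v, hva.symm, ha.symm⟩

theorem S3_white [Finite V] (h5 : level G x y 5 = ∅)
    (h4 : IsEdgesAndVertices G (level G x y 4)) {t : V} (h : t ∈ S3 G x y) : t ∉ B := by
  obtain ⟨ht, ⟨v, hadj, hv, hd⟩ | ⟨u, hu, v, hv, hne, htu, htv⟩⟩ := mem_S3.1 h
  · exact hB.white_of_dbl h5 h4 ht hv hd hadj
  · exact fun htB => hne (hB.unique t htB u (hB.level_two (mem_S2.1 hu).1) v
      (hB.level_two (mem_S2.1 hv).1) htu htv)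

theorem S_white [Finite V] (h5 : level G x y 5 = ∅)
    (h4 : IsEdgesAndVertices G (level G x y 4)) {t : V} (h : t ∈ S3 G x y ∪ S4 G x y) :
    t ∉ B :=
  h.elim (hB.S3_white h5 h4) (hB.S4_white h5)

/-- The partner of a vertex `u` of `S₂` is in `T_u`. -/
theorem exists_partner [Finite V] (h5 : level G x y 5 = ∅)
    (h4 : IsEdgesAndVertices G (level G x y 4)) {u : V} (hu : u ∈ S2 G x y) :
    ∃ t ∈ T G x y u, t ∈ B := by
  obtain ⟨hu2, hd⟩ := mem_S2.1 hu
  obtain ⟨t, ht, hut⟩ := hB.exists_adj u (hB.level_two hu2)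
  have h3 : lv G x y t = 3 := by
    rcases lv_adj_cases (x := x) (y := y) hB.conn hut with h | h | h
    · exact absurd ⟨t, hut, h⟩ hd
    · omega
    · exact absurd ht (hB.level_one (by omega))
  exact ⟨t, ⟨⟨((level_three_cases hB.conn h3).resolve_left fun h => hB.S3_white h5 h4 h ht).elim
    fun _ h => h.2.1.1, fun h => hB.S3_white h5 h4 h ht⟩, hut⟩, ht⟩

theorem partner_unique {u t t' : V} (hu : u ∈ S2 G x y) (h : t ∈ T G x y u) (ht : t ∈ B)
    (h' : t' ∈ T G x y u) (ht' : t' ∈ B) : t = t' :=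
  hB.unique u (hB.level_two (mem_S2.1 hu).1) t ht t' ht' h.2 h'.2

theorem black_not_adj {a b : V} (ha3 : lv G x y a = 3) (hb3 : lv G x y b = 3) (ha : a ∈ B)
    (hb : b ∈ B) : ¬ G.Adj a b := fun h => by
  have := hB.level_three ha3 ha hb h
  omega

theorem isIndepSet_level_one : G.IsIndepSet (level G x y 1) := fun a ha b hb _ hab =>
  (hB.cover a b hab).elim (hB.level_one ha) (hB.level_one hb)

/-- Each violated test yields an induced path forbidden by `no_path_to_level_two`, or a `P₇`. The
coloring is used only to exclude chords: two adjacent vertices of N₃ are never both black and never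
both white. -/
theorem pathTests_of_P7Free [Finite V] (hP : EdgeInP3 G x y) (h7 : P7Free G) :
    PathTests G x y := by
  have hc := hB.conn
  have h1 := hB.isIndepSet_level_one
  have h5 : level G x y 5 = ∅ := by
    by_contra h
    obtain ⟨a, ha⟩ := Set.nonempty_iff_ne_empty.2 h
    obtain ⟨b, hab, hb⟩ := exists_adj_lv hc (d := 4) ha
    obtain ⟨c, hbc, hcl⟩ := exists_adj_lv hc (d := 3) hb
    obtain ⟨v, hcv, hv⟩ := exists_adj_lv hc (d := 2) hcl
    rw [mem_level] at ha
    exact no_path_to_level_two hc hP h7 h1 (by omega) (by omega) (by omega) hv hab hbc hcv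
      (fun h => not_adj_of_lv (x := x) (y := y) hc (by omega) h.symm)
      (fun h => not_adj_of_lv (x := x) (y := y) hc (by omega) h.symm)
      (fun h => not_adj_of_lv (x := x) (y := y) hc (by omega) h.symm)
  -- A white `z` would have black neighbors `t` in N₃ and `b` in N₄. Since `t` is matched into N₂,
  -- it does not see `b`, and `b`, `z`, `t`, `v` is a forbidden path.
  have h4b : ∀ z a, lv G x y z = 4 → lv G x y a = 4 → G.Adj z a → z ∈ B := by
    intro z b hz hb hzb
    by_contra hzB
    obtain ⟨t, hzt, ht⟩ := exists_adj_lv hc (d := 3) hz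
    obtain ⟨v, htv, hv⟩ := exists_adj_lv hc (d := 2) ht
    have htB := (hB.cover z t hzt).resolve_left hzB
    have hbB := (hB.cover z b hzb).resolve_left hzB
    refine no_path_to_level_two hc hP h7 h1 (by omega) (by omega) (by omega) hv hzb.symm hzt htv
      (fun h => ?_) (fun h => not_adj_of_lv (x := x) (y := y) hc (by omega) h.symm)
      (fun h => not_adj_of_lv (x := x) (y := y) hc (by omega) h.symm)
    have := hB.level_three ht htB hbB h.symm
    omega
  have h4 : IsEdgesAndVertices G (level G x y 4) := fun v hv a ha b hb hva hvb =>
    hB.unique v (h4b v a hv ha hva) a (h4b a v ha hv hva.symm) b (h4b b v hb hv hvb.symm) hva hvb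
  have nadj : ∀ {u v t}, u ∈ S2 G x y → v ∈ S2 G x y → u ≠ v → t ∈ T G x y u → ¬ G.Adj t v :=
    fun hu hv hne ht h => hne (((mem_T hu).1 ht).2.2.1 _ hv h).symm
  -- The forbidden path is `a`, `b`, `c`, `v`: vertices of other sets `T` do not see `v`.
  have hpath : ∀ {u v u' a b c}, u ∈ S2 G x y → v ∈ S2 G x y → u' ∈ S2 G x y → u ≠ v → u' ≠ v →
      a ∈ T G x y u → b ∈ T G x y u' → c ∈ T G x y v →
      G.Adj a b → G.Adj b c → ¬ G.Adj a c → False := by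
    intro u v u' a b c hu hv hu' hne hne' ha hb hcT hab hbc hac
    exact no_path_to_level_two hc hP h7 h1 (T_lv ha).ge (T_lv hb).ge (T_lv hcT).ge
      (mem_S2.1 hv).1 hab hbc hcT.2.symm hac (nadj hu hv hne ha) (nadj hu' hv hne' hb)
  have hblack : ∀ {u v a b}, a ∈ T G x y u → b ∈ T G x y v → a ∈ B → b ∈ B → ¬ G.Adj a b :=
    fun ha hb h h' => hB.black_not_adj (T_lv ha) (T_lv hb) h h'
  have hstar : ∀ u ∈ S2 G x y, ∀ v ∈ S2 G x y, u ≠ v → ¬ Sees G (Y G x y u) (T G x y v) := by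
    rintro u hu v hv hne ⟨a, ha, b, hb, hab⟩
    obtain ⟨ha, a', ha', haa'⟩ := mem_Y.1 ha
    -- The path is `a'`, `a`, `b`, `v`. A chord would close a triangle in N₃, two of whose vertices
    -- would be black and adjacent.
    refine hpath hu hv hu hne hne ha' ha hb haa'.symm hab fun h => ?_
    by_cases haB : a ∈ B
    · have h1 : a' ∉ B := fun h => hblack ha ha' haB h haa'
      have h2 : b ∉ B := fun h => hblack ha hb haB h hab
      exact (hB.cover a' b h).elim h1 h2
    · exact hblack ha' hb ((hB.cover a a' haa').resolve_left haB)
        ((hB.cover a b hab).resolve_left haB) h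
  refine ⟨h5, h4, hstar, ?_⟩
  rintro u v v' ⟨hu, hv, huv, a, ha, b, hb, hab⟩ ⟨-, hv', huv', a', ha', b', hb', hab'⟩
  by_contra hne
  -- A vertex seeing two other sets is the middle of a path `b`, `a`, `b'`, `v'`; so the edges to `T
  -- v` and to `T v'` start at different vertices of `T u`.
  have hfork : ∀ {u v v' a b b'}, u ∈ S2 G x y → v ∈ S2 G x y → v' ∈ S2 G x y → u ≠ v' →
      v ≠ v' → a ∈ T G x y u → b ∈ T G x y v → b' ∈ T G x y v' → G.Adj a b → ¬ G.Adj a b' := by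
    intro u v v' a b b' hu hv hv' huv' hne ha hb hb' hab hab'
    refine hpath hv hv' hu hne huv' hb ha hb' hab.symm hab' fun h => ?_
    by_cases haB : a ∈ B
    · exact (hB.cover b b' h).elim (fun h => hblack ha hb haB h hab)
        (fun h => hblack ha hb' haB h hab')
    · exact hblack hb hb' ((hB.cover a b hab).resolve_left haB)
        ((hB.cover a b' hab').resolve_left haB) h
  have nab' : ¬ G.Adj a b' := hfork hu hv hv' huv' hne ha hb hb' hab
  have na'b : ¬ G.Adj a' b := hfork hu hv' hv huv (Ne.symm hne) ha' hb' hb hab'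
  have nbb' : ¬ G.Adj b b' := hfork hv hu hv' hne huv' hb ha hb' hab.symm
  have naa' : ¬ G.Adj a a' := fun h =>
    hstar u hu v hv huv ⟨a, mem_Y.2 ⟨ha, a', ha', h⟩, b, hb, hab⟩
  have hl2 : ∀ {u v}, u ∈ S2 G x y → v ∈ S2 G x y → ¬ G.Adj u v := fun hu hv h =>
    (mem_S2.1 hu).2 ⟨_, h, (mem_S2.1 hv).1.trans (mem_S2.1 hu).1.symm⟩
  -- The path is `v`, `b`, `a`, `u`, `a'`, `b'`, `v'`.
  exact not_P7Free_of_seven hb.2 hab.symm ha.2.symm ha'.2 hab' hb'.2.symm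
    (fun h => nadj hu hv huv ha h.symm) (hl2 hv hu) (fun h => nadj hu hv huv ha' h.symm)
    (fun h => nadj hv' hv (Ne.symm hne) hb' h.symm) (hl2 hv hv')
    (nadj hv hu huv.symm hb) (fun h => na'b h.symm) nbb' (nadj hv hv' hne hb)
    naa' nab' (nadj hu hv' huv' ha) (fun h => nadj hv' hu huv'.symm hb' h.symm) (hl2 hu hv')
    (nadj hu hv' huv' ha') h7

end IsColor

end Colorings

/-! ### Components with at least one edge -/

section Components

variable {V : Type*} {G : SimpleGraph V} {U K K' W : Set V} {a b : V}

theorem nontrivialComponents_subset (hK : K ∈ nontrivialComponents G U) : K ⊆ U := by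
  obtain ⟨-, C, rfl⟩ := hK
  rintro _ ⟨z, -, rfl⟩
  exact z.2

theorem nontrivialComponents_closed (hK : K ∈ nontrivialComponents G U) (ha : a ∈ K)
    (hb : b ∈ U) (hab : G.Adj a b) : b ∈ K := by
  obtain ⟨-, C, rfl⟩ := hK
  obtain ⟨z, hz, rfl⟩ := ha
  refine ⟨⟨b, hb⟩, ?_, rfl⟩
  rw [SimpleGraph.ConnectedComponent.mem_supp_iff] at hz ⊢
  rw [← hz]
  exact SimpleGraph.ConnectedComponent.sound (SimpleGraph.Adj.reachable (SimpleGraph.Adj.symm hab))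

theorem nontrivialComponents_unique (hK : K ∈ nontrivialComponents G U)
    (hK' : K' ∈ nontrivialComponents G U) (ha : a ∈ K) (ha' : a ∈ K') : K = K' := by
  obtain ⟨-, C, rfl⟩ := hK
  obtain ⟨-, C', rfl⟩ := hK'
  obtain ⟨z, hz, rfl⟩ := ha
  obtain ⟨z', hz', h⟩ := ha'
  obtain rfl := Subtype.ext h
  rw [SimpleGraph.ConnectedComponent.mem_supp_iff] at hz hz'
  rw [← hz, ← hz']

/-- This bounds a component from above by any set that it meets and that is closed under adjacency
in `U`; walks are needed only here. -/
theorem nontrivialComponents_minimal (hK : K ∈ nontrivialComponents G U) (ha : a ∈ K)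
    (haW : a ∈ W) (hW : ∀ c ∈ W, ∀ d ∈ U, G.Adj c d → d ∈ W) : K ⊆ W := by
  obtain ⟨-, C, rfl⟩ := hK
  obtain ⟨z, hz, rfl⟩ := ha
  rintro _ ⟨z', hz', rfl⟩
  rw [SimpleGraph.ConnectedComponent.mem_supp_iff] at hz hz'
  obtain ⟨p⟩ := SimpleGraph.ConnectedComponent.exact (hz.trans hz'.symm)
  clear hz hz'
  induction p with
  | nil => exact haW
  | cons h p ih => exact ih (hW _ haW _ (Subtype.prop _) h)

theorem exists_mem_nontrivialComponents (ha : a ∈ U) (hb : b ∈ U) (hab : G.Adj a b) :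
    ∃ K ∈ nontrivialComponents G U, a ∈ K ∧ b ∈ K := by
  have h : a ∈ Subtype.val '' ((G.induce U).connectedComponentMk ⟨a, ha⟩).supp := ⟨⟨a, ha⟩, rfl, rfl⟩
  have h' : b ∈ Subtype.val '' ((G.induce U).connectedComponentMk ⟨a, ha⟩).supp :=
    ⟨⟨b, hb⟩, SimpleGraph.ConnectedComponent.sound
      (SimpleGraph.Adj.reachable (SimpleGraph.Adj.symm hab)), rfl⟩
  exact ⟨_, ⟨⟨a, h, b, h', hab.ne⟩, _, rfl⟩, h, h'⟩

theorem exists_adj_of_mem_nontrivialComponents (hK : K ∈ nontrivialComponents G U) (ha : a ∈ K) :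
    ∃ b ∈ K, G.Adj a b := by
  by_contra hn
  push Not at hn
  have hsub : K ⊆ {a} := nontrivialComponents_minimal hK ha rfl fun c hc d hd hcd => by
    rw [Set.mem_singleton_iff] at hc
    subst hc
    exact absurd hcd (hn d (nontrivialComponents_closed hK ha hd hcd))
  exact hK.1.not_subset_singleton hsub

end Components

/-! ### Necessity of the tests -/

section TestsOfColor

variable {V : Type*} {G : SimpleGraph V} {x y : V}

theorem Sees.symm {A B : Set V} (h : Sees G A B) : Sees G B A := by
  obtain ⟨a, ha, b, hb, hab⟩ := h
  exact ⟨b, hb, a, ha, hab.symm⟩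

theorem Paired.symm {u v : V} (h : Paired G x y u v) : Paired G x y v u :=
  ⟨h.2.1, h.1, h.2.2.1.symm, h.2.2.2.symm⟩

namespace IsColor

variable {B : Set V} (hB : IsColor G x y B) (hp : PathTests G x y)

include hB hp

/-- A white green vertex would force a vertex of S₃ ∪ S₄ to be black, or two vertices of one set `T
v`, which contains only one black vertex. -/
theorem green_black [Finite V] {u t : V} (hu : u ∈ S2 G x y) (h : Green G x y u t) : t ∈ B := by
  have htwo : ∀ v ∈ S2 G x y, HasTwoNeighborsIn G (T G x y v) t → t ∈ B := by
    rintro v hv ⟨a, ha, b, hb, hne, hta, htb⟩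
    by_contra ht
    exact hne (hB.partner_unique hv ha ((hB.cover t a hta).resolve_left ht) hb
      ((hB.cover t b htb).resolve_left ht))
  obtain ⟨ht, ⟨s, hs, hts⟩ | h | ⟨v, hv, h⟩⟩ := h
  · exact (hB.cover t s hts).resolve_right (hB.S_white hp.level_five hp.level_four hs)
  · exact htwo u hu h
  · exact htwo v hv.2.1 h

theorem testB [Finite V] : TestB G x y where
  level_one := hB.isIndepSet_level_one
  level_two := fun v hv a ha b hb hva hvb =>
    hB.unique v (hB.level_two hv) a (hB.level_two ha) b (hB.level_two hb) hva hvb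
  level_five := hp.level_five
  level_four := hp.level_four
  -- The colors themselves form the bipartition: black vertices of N₃ are matched into N₂ and hence
  -- pairwise nonadjacent, and S₄ is white.
  bipartite := by
    classical
    have hbb : ∀ a ∈ level G x y 3 ∪ S4 G x y, ∀ b ∈ level G x y 3 ∪ S4 G x y, a ∈ B → b ∈ B →
        ¬ G.Adj a b := by
      intro a ha b hb haB hbB
      have ha3 := ha.resolve_right fun h => hB.S4_white hp.level_five h haB
      have hb3 := hb.resolve_right fun h => hB.S4_white hp.level_five h hbB
      exact hB.black_not_adj ha3 hb3 haB hbB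
    refine ⟨SimpleGraph.Coloring.mk (fun z => if (z : V) ∈ B then (0 : Fin 2) else 1) ?_⟩
    rintro ⟨a, ha⟩ ⟨b, hb⟩ hab
    have hab' : G.Adj a b := hab
    have h1 := hB.cover a b hab'
    have h2 := hbb a ha b hb
    by_cases haB : a ∈ B <;> by_cases hbB : b ∈ B <;> simp_all
  stable := fun a ha b hb _ hab => (hB.cover a b hab).elim
    (hB.S_white hp.level_five hp.level_four ha) (hB.S_white hp.level_five hp.level_four hb)
  nonempty := fun u hu => by
    obtain ⟨t, ht, -⟩ := hB.exists_partner hp.level_five hp.level_four hu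
    exact ⟨t, ht⟩
  star := fun u hu => by
    obtain ⟨t, ht, htB⟩ := hB.exists_partner hp.level_five hp.level_four hu
    -- The center is the black vertex of `T u`, which must be an end of every edge.
    refine Or.inr ⟨t, ht, fun a ha b hb hab => ?_⟩
    exact (hB.cover a b hab).imp (fun h => hB.partner_unique hu ha h ht htB)
      (fun h => hB.partner_unique hu hb h ht htB)
  star_sees := hp.star_sees

theorem testF [Finite V] : TestF G x y := by
  refine fun u hu => ⟨fun t t' h h' => ?_, fun t h a ha b hb _ hab => ?_⟩
  · exact hB.partner_unique hu h.1 (hB.green_black hp hu h) h'.1 (hB.green_black hp hu h')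
  · have ht := hB.green_black hp hu h
    rcases hB.cover a b hab with h' | h'
    · obtain rfl := hB.partner_unique hu ha.1 h' h.1 ht
      exact hb.2 hab
    · obtain rfl := hB.partner_unique hu hb.1 h' h.1 ht
      exact ha.2 hab.symm

/-- A component of `G[T_u ∪ T_v]` that contains the black vertex `a` of `T_u`. -/
theorem component_eq [Finite V] {u v a b : V} (hu : u ∈ S2 G x y) (hv : v ∈ S2 G x y) (hne : u ≠ v)
    (ha : a ∈ T G x y u) (haB : a ∈ B) (hb : b ∈ T G x y v) (hbB : b ∈ B) {K : Set V}
    (hK : K ∈ nontrivialComponents G (T G x y u ∪ T G x y v)) (haK : a ∈ K) :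
    K = Y G x y u ∨ IsCrossStar G (T G x y u) (T G x y v) K := by
  have huB : ∀ z ∈ T G x y u, z ∈ B → z = a := fun z hz h => hB.partner_unique hu hz h ha haB
  have hvB : ∀ z ∈ T G x y v, z ∈ B → z = b := fun z hz h => hB.partner_unique hv hz h hb hbB
  have hnab : ¬ G.Adj a b := hB.black_not_adj (T_lv ha) (T_lv hb) haB hbB
  have hwhite : ∀ c, G.Adj a c → lv G x y c = 3 → c ∉ B := fun c hac hc hcB =>
    hB.black_not_adj (T_lv ha) hc haB hcB hac
  -- The component is `a` with its neighbors. Such a neighbor `c` is white, so a further neighbor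
  -- `d` of it is black, that is, `a` or `b`. If `d` is `b`, then `c` lies in `Y u` or `Y v` and
  -- sees the other set, contrary to `star_sees`.
  have hKeq : K = insert a (G.neighborSet a ∩ (T G x y u ∪ T G x y v)) := by
    apply Set.Subset.antisymm
    · refine nontrivialComponents_minimal hK haK (Set.mem_insert _ _) ?_
      rintro c (rfl | ⟨hac, hcU⟩) d hd hcd
      · exact Or.inr ⟨hcd, hd⟩
      · left
        have hac' : G.Adj a c := hac
        have hc3 : lv G x y c = 3 := hcU.elim T_lv T_lv
        have hcB := hwhite c hac hc3
        have hdB := (hB.cover c d hcd).resolve_left hcB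
        rcases hd with hd | hd
        · exact huB d hd hdB
        · exfalso
          obtain rfl := hvB d hd hdB
          rcases hcU with hcu | hcv
          · exact hp.star_sees u hu v hv hne
              ⟨c, mem_Y.2 ⟨hcu, a, ha, hac'.symm⟩, d, hd, hcd⟩
          · exact hp.star_sees v hv u hu hne.symm
              ⟨c, mem_Y.2 ⟨hcv, d, hd, hcd⟩, a, ha, hac'.symm⟩
    · rintro c (rfl | ⟨hac, hcU⟩)
      · exact haK
      · exact nontrivialComponents_closed hK haK hcU hac
  obtain ⟨d, hdK, had⟩ := exists_adj_of_mem_nontrivialComponents hK haK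
  have hdU := nontrivialComponents_subset hK hdK
  by_cases haY : a ∈ Y G x y u
  · left
    rw [hKeq]
    ext c
    constructor
    · rintro (rfl | ⟨hac, hcU⟩)
      · exact haY
      · rcases hcU with hcU | hcU
        · exact mem_Y.2 ⟨hcU, a, ha, SimpleGraph.Adj.symm hac⟩
        · exact absurd ⟨a, haY, c, hcU, hac⟩ (hp.star_sees u hu v hv hne)
    · intro hc
      obtain ⟨hc, c', hc', hcc'⟩ := mem_Y.1 hc
      rcases hB.cover c c' hcc' with h | h
      · exact Or.inl (huB c hc h)
      · obtain rfl := huB c' hc' h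
        exact Or.inr ⟨hcc'.symm, Or.inl hc⟩
  · right
    have hsub : ∀ c, G.Adj a c → c ∈ T G x y u ∪ T G x y v → c ∈ T G x y v := fun c hac hc =>
      hc.resolve_left fun h => haY (mem_Y.2 ⟨ha, c, h, hac⟩)
    refine ⟨a, ha, G.neighborSet a ∩ (T G x y u ∪ T G x y v), fun c hc => hsub c hc.1 hc.2,
      ⟨d, had, hdU⟩, ?_, fun c hc => hc.1, hKeq⟩
    intro c hc d hd _ hcd
    exact (hB.cover c d hcd).elim (hwhite c hc.1 (T_lv (hsub c hc.1 hc.2)))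
      (hwhite d hd.1 (T_lv (hsub d hd.1 hd.2)))

/-- Every edge has a black end, so every component with an edge contains one of the two black
vertices `a` and `b`. `component_eq` describes the component of each. -/
theorem testD [Finite V] : TestD G x y := by
  rintro u v ⟨hu, hv, hne, p, hpu, q, hqv, hpq⟩
  obtain ⟨a, ha, haB⟩ := hB.exists_partner hp.level_five hp.level_four hu
  obtain ⟨b, hb, hbB⟩ := hB.exists_partner hp.level_five hp.level_four hv
  have huB : ∀ z ∈ T G x y u, z ∈ B → z = a := fun z hz h => hB.partner_unique hu hz h ha haB
  have hvB : ∀ z ∈ T G x y v, z ∈ B → z = b := fun z hz h => hB.partner_unique hv hz h hb hbB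
  have hmem : ∀ K ∈ nontrivialComponents G (T G x y u ∪ T G x y v), a ∈ K ∨ b ∈ K := by
    intro K hK
    obtain ⟨c, hc⟩ := hK.1.nonempty
    obtain ⟨d, hd, hcd⟩ := exists_adj_of_mem_nontrivialComponents hK hc
    have key : ∀ z ∈ K, z ∈ B → a ∈ K ∨ b ∈ K := by
      intro z hz hzB
      rcases nontrivialComponents_subset hK hz with h | h
      · exact Or.inl (huB z h hzB ▸ hz)
      · exact Or.inr (hvB z h hzB ▸ hz)
    exact (hB.cover c d hcd).elim (key c hc) (key d hd)
  have hacomp : ∀ K ∈ nontrivialComponents G (T G x y u ∪ T G x y v), a ∈ K →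
      K = Y G x y u ∨ IsCrossStar G (T G x y u) (T G x y v) K :=
    fun K hK h => hB.component_eq hp hu hv hne ha haB hb hbB hK h
  have hbcomp : ∀ K ∈ nontrivialComponents G (T G x y u ∪ T G x y v), b ∈ K →
      K = Y G x y v ∨ IsCrossStar G (T G x y v) (T G x y u) K :=
    fun K hK h => hB.component_eq hp hv hu hne.symm hb hbB ha haB (Set.union_comm _ _ ▸ hK) h
  refine ⟨?_, ?_, ?_, ?_⟩
  · have hsub : nontrivialComponents G (T G x y u ∪ T G x y v) ⊆
        {K ∈ nontrivialComponents G (T G x y u ∪ T G x y v) | a ∈ K} ∪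
        {K ∈ nontrivialComponents G (T G x y u ∪ T G x y v) | b ∈ K} :=
      fun K hK => (hmem K hK).imp (fun h => ⟨hK, h⟩) (fun h => ⟨hK, h⟩)
    have h1 : ∀ z, {K ∈ nontrivialComponents G (T G x y u ∪ T G x y v) | z ∈ K}.ncard ≤ 1 :=
      fun z => (Set.ncard_le_one_iff (Set.toFinite _)).2 fun h h' => nontrivialComponents_unique h.1 h'.1 h.2 h'.2
    calc _ ≤ _ := Set.ncard_le_ncard hsub
      _ ≤ _ := Set.ncard_union_le _ _
      _ ≤ 1 + 1 := Nat.add_le_add (h1 a) (h1 b)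
  -- If both stars exist, they contain `a` and `b` respectively. The edge `pq` then starts at one of
  -- these and joins a star to the other set.
  · by_contra h
    rw [not_or] at h
    obtain ⟨c, hc⟩ := Set.nonempty_iff_ne_empty.2 h.1
    obtain ⟨d, hd⟩ := Set.nonempty_iff_ne_empty.2 h.2
    obtain ⟨hcT, c', hc', hcc'⟩ := mem_Y.1 hc
    obtain ⟨hdT, d', hd', hdd'⟩ := mem_Y.1 hd
    have haY : a ∈ Y G x y u := by
      rcases hB.cover c c' hcc' with h | h
      · exact huB c hcT h ▸ hc
      · exact huB c' hc' h ▸ mem_Y.2 ⟨hc', c, hcT, hcc'.symm⟩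
    have hbY : b ∈ Y G x y v := by
      rcases hB.cover d d' hdd' with h | h
      · exact hvB d hdT h ▸ hd
      · exact hvB d' hd' h ▸ mem_Y.2 ⟨hd', d, hdT, hdd'.symm⟩
    rcases hB.cover p q hpq with h | h
    · obtain rfl := huB p hpu h
      exact hp.star_sees u hu v hv hne ⟨p, haY, q, hqv, hpq⟩
    · obtain rfl := hvB q hqv h
      exact hp.star_sees v hv u hu hne.symm ⟨q, hbY, p, hpu, hpq.symm⟩
  · intro K hK
    rcases hmem K hK with h | h
    · rcases hacomp K hK h with h | h
      · exact Or.inl h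
      · exact Or.inr (Or.inr (Or.inl h))
    · rcases hbcomp K hK h with h | h
      · exact Or.inr (Or.inl h)
      · exact Or.inr (Or.inr (Or.inr h))
  · intro K hK K' hK' hKK' h1 h2 h3 h4
    rcases hmem K hK with h | h <;> rcases hmem K' hK' with h' | h'
    · exact absurd (nontrivialComponents_unique hK hK' h h') hKK'
    · exact Or.inl ⟨(hacomp K hK h).resolve_left h1, (hbcomp K' hK' h').resolve_left h4⟩
    · exact Or.inr ⟨(hbcomp K hK h).resolve_left h2, (hacomp K' hK' h').resolve_left h3⟩
    · exact absurd (nontrivialComponents_unique hK hK' h h') hKK'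

theorem tests [Finite V] : Tests G x y :=
  ⟨hB.testB hp, hp.pairs, hB.testD hp, hB.testF hp⟩

end IsColor

end TestsOfColor

/-! ### Valid choices in an isolated set and in two paired sets -/

section Valid

variable {V : Type*} {G : SimpleGraph V} {x y : V}

/-- The choice of `a` in `T_u` and `b` in `T_v` is compatible with all edges at `T_u ∪ T_v`
(for `u = v`, `a = b` this concerns a single isolated `T_u`). -/
structure Valid (G : SimpleGraph V) (x y u v a b : V) : Prop where
  left : a ∈ T G x y u
  right : b ∈ T G x y v
  not_adj : ¬ G.Adj a b
  cover : ∀ c ∈ T G x y u ∪ T G x y v, ∀ d ∈ level G x y 3 ∪ S4 G x y, G.Adj c d →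
    c = a ∨ c = b ∨ d = a ∨ d = b

theorem Valid.symm {u v a b : V} (h : Valid G x y u v a b) : Valid G x y v u b a :=
  ⟨h.right, h.left, fun h' => h.not_adj h'.symm, fun c hc d hd hcd => by
    have := h.cover c hc.symm d hd hcd
    tauto⟩

theorem T_subset_level {u c : V} (h : c ∈ T G x y u) : c ∈ level G x y 3 ∪ S4 G x y :=
  Or.inl (T_lv h)

theorem S_subset_level {c : V} (h : c ∈ S3 G x y ∪ S4 G x y) : c ∈ level G x y 3 ∪ S4 G x y :=
  h.imp (fun h => h.elim (fun h => h.1) (fun h => h.1)) id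

variable [Finite V]

theorem level_cases (hc : G.Connected) {d : V} (hd : d ∈ level G x y 3 ∪ S4 G x y) :
    d ∈ S3 G x y ∪ S4 G x y ∨ ∃ v ∈ S2 G x y, d ∈ T G x y v := by
  rcases hd with hd | hd
  · exact (level_three_cases hc hd).imp Or.inl id
  · exact Or.inl (Or.inr hd)

/-- This is the reason why the choices decouple: an edge to a further set `T v` makes it a partner
by definition. -/
theorem nbr_cases (hc : G.Connected) {u c d : V} (hu : u ∈ S2 G x y) (hcu : c ∈ T G x y u)
    (hd : d ∈ level G x y 3 ∪ S4 G x y) (hcd : G.Adj c d) :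
    d ∈ S3 G x y ∪ S4 G x y ∨ d ∈ T G x y u ∨ ∃ v, Paired G x y u v ∧ d ∈ T G x y v := by
  refine (level_cases hc hd).imp id fun ⟨v, hv, hdv⟩ => ?_
  by_cases h : u = v
  · exact Or.inl (h ▸ hdv)
  · exact Or.inr ⟨v, ⟨hu, hv, h, c, hcu, d, hdv, hcd⟩, hdv⟩

theorem green_of_sees {u c d : V} (hcu : c ∈ T G x y u) (hd : d ∈ S3 G x y ∪ S4 G x y)
    (hcd : G.Adj c d) : Green G x y u c := ⟨hcu, Or.inl ⟨d, hd, hcd⟩⟩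

theorem exists_isBest (w : Sym2 V → Weight) (u : V) {K : Set V} (hK : K.Nonempty) :
    ∃ t, IsBest w u K t := by
  obtain ⟨t, ht, h⟩ := Set.exists_min_image K (fun t => w s(u, t)) (Set.toFinite _) hK
  exact ⟨t, ht, h⟩

/-! ### Isolated `T_u` -/

section Isolated

variable (hc : G.Connected) (hT : Tests G x y) {u : V} (hi : IsolatedT G x y u)

include hi

/-- An edge from `c` to S₃ ∪ S₄ can be covered only by `c`, and of two different neighbors of `c` at
most one is `t`. -/
theorem valid_isolated_green {c t : V} (hv : Valid G x y u u t t) (hg : Green G x y u c) :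
    c = t := by
  obtain ⟨hcu, ⟨s, hs, hcs⟩ | ⟨d, hd, d', hd', hne, hcd, hcd'⟩ | ⟨v, hp, -⟩⟩ := hg
  · have h1 : s ≠ t := fun h => T_not_mem_S hv.left (h ▸ hs)
    have := hv.cover c (Or.inl hcu) s (S_subset_level hs) hcs
    tauto
  · have h1 := hv.cover c (Or.inl hcu) d (T_subset_level hd) hcd
    have h2 := hv.cover c (Or.inl hcu) d' (T_subset_level hd') hcd'
    by_contra h
    have h3 : d = t := by tauto
    have h4 : d' = t := by tauto
    exact hne (h3.trans h4.symm)
  · exact absurd hp (hi.2 v)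

include hc

theorem valid_isolated_mk {t : V} (ht : t ∈ T G x y u)
    (hg : ∀ c, Green G x y u c → c = t)
    (hcov : ∀ c ∈ T G x y u, ∀ d ∈ T G x y u, G.Adj c d → c = t ∨ d = t) :
    Valid G x y u u t t := by
  refine ⟨ht, ht, G.irrefl, fun c hcu d hd hcd => ?_⟩
  rw [Set.union_self] at hcu
  rcases nbr_cases hc hi.1 hcu hd hcd with h | h | ⟨v, h, -⟩
  · exact Or.inl (hg c (green_of_sees hcu h hcd))
  · have := hcov c hcu d h hcd
    tauto
  · exact absurd h (hi.2 v)

include hT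

/-- Suppose that the edge `cd` avoids the green vertex `t`. If `t` saw `c`, then `c` would have the
two neighbors `t` and `d` and be a second green vertex; the same holds for `d`. So the edge lies
outside `N(t)`, which `TestF` forbids. -/
theorem valid_isolated_iff_green {c t : V} (hg : Green G x y u c) :
    Valid G x y u u t t ↔ t = c := by
  refine ⟨fun h => (valid_isolated_green hi h hg).symm, ?_⟩
  rintro rfl
  refine valid_isolated_mk hc hi hg.1 (fun c h => (hT.2.2.2 u hi.1).1 c t h hg) ?_
  intro c hcu d hdu hcd
  have hstar := (hT.2.2.2 u hi.1).2 t hg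
  by_contra hne
  rw [not_or] at hne
  have htwo : ∀ c ∈ T G x y u, ∀ d ∈ T G x y u, G.Adj c d → c ≠ t → d ≠ t → ¬ G.Adj t c := by
    intro c hcu d hdu hcd h1 h2 h3
    refine h1 ((hT.2.2.2 u hi.1).1 c t ⟨hcu, Or.inr (Or.inl ⟨t, hg.1, d, hdu, ?_, h3.symm, hcd⟩)⟩ hg)
    exact h2.symm
  exact hstar ⟨hcu, htwo c hcu d hdu hcd hne.1 hne.2⟩
    ⟨hdu, htwo d hdu c hcu hcd.symm hne.2 hne.1⟩ hcd.ne hcd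

/-- A center with two leaves would be green. So the star is a single edge, and either end covers it.
-/
theorem valid_isolated_iff_star {t : V} (hg : ∀ c, ¬ Green G x y u c)
    (hY : (Y G x y u).Nonempty) : Valid G x y u u t t ↔ t ∈ Y G x y u := by
  have huniq : ∀ c ∈ T G x y u, ∀ d ∈ T G x y u, ∀ e ∈ T G x y u, G.Adj c d → G.Adj c e → d = e := by
    intro c hcu d hd e he hcd hce
    by_contra hne
    exact hg c ⟨hcu, Or.inr (Or.inl ⟨d, hd, e, he, hne, hcd, hce⟩)⟩
  constructor
  · intro h
    obtain ⟨c, hcY⟩ := hY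
    obtain ⟨hcu, d, hd, hcd⟩ := mem_Y.1 hcY
    rcases h.cover c (Or.inl hcu) d (T_subset_level hd) hcd with h | h | h | h
    · exact h ▸ hcY
    · exact h ▸ hcY
    · exact h ▸ mem_Y.2 ⟨hd, c, hcu, hcd.symm⟩
    · exact h ▸ mem_Y.2 ⟨hd, c, hcu, hcd.symm⟩
  · intro h
    obtain ⟨htu, t', ht', htt'⟩ := mem_Y.1 h
    refine valid_isolated_mk hc hi htu (fun c h => absurd h (hg c)) ?_
    intro c hcu d hdu hcd
    rcases hT.1.star u hi.1 with hind | ⟨z, -, hz⟩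
    · exact absurd hcd (hind hcu hdu hcd.ne)
    · by_contra hne
      rw [not_or] at hne
      have h1 := hz c hcu d hdu hcd
      have h2 := hz t htu t' ht' htt'
      rcases h2 with rfl | rfl
      · rcases h1 with h1 | h1
        · exact hne.1 h1
        · exact hne.2 h1
      · rcases h1 with rfl | rfl
        · exact hne.2 (huniq c hcu d hdu t htu hcd htt'.symm)
        · exact hne.1 (huniq d hdu c hcu t htu hcd.symm htt'.symm)

theorem valid_isolated_iff_edgeless {t : V} (hg : ∀ c, ¬ Green G x y u c)
    (hY : Y G x y u = ∅) : Valid G x y u u t t ↔ t ∈ T G x y u := by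
  refine ⟨fun h => h.left, fun h => ?_⟩
  refine valid_isolated_mk hc hi h (fun c h => absurd h (hg c)) fun c hcu d hdu hcd => ?_
  exact absurd (mem_Y.2 ⟨hcu, d, hdu, hcd⟩) (hY ▸ Set.notMem_empty c)

variable {w : Sym2 V → Weight}

/-- One direction gives correctness of every run. The other shows that an optimal vertex found in a
different way, as by the program, is a possible choice of the procedure. -/
theorem stepG_iff {t : V} : StepG G x y w u t ↔ Valid G x y u u t t ∧
    ∀ t', Valid G x y u u t' t' → w s(u, t) ≤ w s(u, t') := by
  by_cases hg : ∃ c, Green G x y u c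
  · obtain ⟨c, hg⟩ := hg
    simp only [valid_isolated_iff_green hc hT hi hg]
    constructor
    · rintro (h | ⟨h, -⟩ | ⟨h, -⟩)
      · obtain rfl := (hT.2.2.2 u hi.1).1 _ _ h hg
        exact ⟨rfl, by rintro t' rfl; rfl⟩
      · exact absurd hg (h c)
      · exact absurd hg (h c)
    · rintro ⟨rfl, -⟩
      exact .green _ hg
  · push Not at hg
    rcases (Y G x y u).eq_empty_or_nonempty with hY | hY
    · simp only [valid_isolated_iff_edgeless hc hT hi hg hY]
      constructor
      · rintro (h | ⟨h, h', -⟩ | ⟨h, h', h''⟩)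
        · exact absurd h (hg _)
        · exact absurd hY h'.ne_empty
        · exact h''
      · exact fun h => .edgeless _ hg hY h
    · simp only [valid_isolated_iff_star hc hT hi hg hY]
      constructor
      · rintro (h | ⟨h, h', h''⟩ | ⟨h, h', -⟩)
        · exact absurd h (hg _)
        · exact h''
        · exact absurd h' hY.ne_empty
      · exact fun h => .star _ hg hY h

theorem exists_stepG : ∃ t, StepG G x y w u t := by
  by_cases hg : ∃ c, Green G x y u c
  · obtain ⟨c, hg⟩ := hg
    exact ⟨c, .green _ hg⟩
  · push Not at hg
    rcases (Y G x y u).eq_empty_or_nonempty with hY | hY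
    · obtain ⟨t, ht⟩ := exists_isBest w u (hT.1.nonempty u hi.1)
      exact ⟨t, .edgeless _ hg hY ht⟩
    · obtain ⟨t, ht⟩ := exists_isBest w u hY
      exact ⟨t, .star _ hg hY ht⟩

end Isolated

/-! ### Paired `T_u`, `T_v` -/

section Pairs

variable {u v : V}

theorem disjoint_T (hp : Paired G x y u v) {c d : V} (hcu : c ∈ T G x y u) (hd : d ∈ T G x y v) :
    c ≠ d := by
  rintro rfl
  exact hp.2.2.1 (T_unique hp.1 hp.2.1 hcu hd)

/-- Two neighbors in different sets would make `c` a vertex of `Y u` that sees `T v`, which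
`star_sees` excludes. -/
theorem green_of_two (hT : Tests G x y) (hp : Paired G x y u v) {c d e : V}
    (hcu : c ∈ T G x y u) (hd : d ∈ T G x y u ∪ T G x y v) (he : e ∈ T G x y u ∪ T G x y v)
    (hcd : G.Adj c d) (hce : G.Adj c e) (hne : d ≠ e) : Green G x y u c := by
  have hs := hT.1.star_sees u hp.1 v hp.2.1 hp.2.2.1
  rcases hd with hd | hd <;> rcases he with he | he
  · exact ⟨hcu, Or.inr (Or.inl ⟨d, hd, e, he, hne, hcd, hce⟩)⟩
  · exact absurd ⟨c, mem_Y.2 ⟨hcu, d, hd, hcd⟩, e, he, hce⟩ hs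
  · exact absurd ⟨c, mem_Y.2 ⟨hcu, e, he, hce⟩, d, hd, hcd⟩ hs
  · exact ⟨hcu, Or.inr (Or.inr ⟨v, hp, d, hd, e, he, hne, hcd, hce⟩)⟩

theorem Valid.cover_T {a b c d : V} (h : Valid G x y u v a b) (hc : c ∈ T G x y u ∪ T G x y v)
    (hd : d ∈ T G x y u ∪ T G x y v) (hcd : G.Adj c d) : c = a ∨ c = b ∨ d = a ∨ d = b :=
  h.cover c hc d (hd.elim T_subset_level T_subset_level) hcd

theorem valid_green_left (hT : TestC G x y) (hp : Paired G x y u v) {a b c : V}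
    (h : Valid G x y u v a b) (hg : Green G x y u c) : c = a := by
  have hab := disjoint_T hp h.left h.right
  obtain ⟨hcu, ⟨s, hs, hcs⟩ | ⟨d, hd, d', hd', hne, hcd, hcd'⟩ |
    ⟨v', hp', d, hd, d', hd', hne, hcd, hcd'⟩⟩ := hg
  · have h1 : s ≠ a := fun h' => T_not_mem_S h.left (h' ▸ hs)
    have h2 : s ≠ b := fun h' => T_not_mem_S h.right (h' ▸ hs)
    have h3 := disjoint_T hp hcu h.right
    have := h.cover c (Or.inl hcu) s (S_subset_level hs) hcs
    tauto
  · have h1 := h.cover_T (Or.inl hcu) (Or.inl hd) hcd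
    have h2 := h.cover_T (Or.inl hcu) (Or.inl hd') hcd'
    have h3 := disjoint_T hp hcu h.right
    have h4 := disjoint_T hp hd h.right
    have h5 := disjoint_T hp hd' h.right
    by_contra h
    have h3 : d = a := by tauto
    have h4 : d' = a := by tauto
    exact hne (h3.trans h4.symm)
  · obtain rfl := hT u v v' hp hp'
    have h1 := h.cover_T (Or.inl hcu) (Or.inr hd) hcd
    have h2 := h.cover_T (Or.inl hcu) (Or.inr hd') hcd'
    have h3 := disjoint_T hp hcu h.right
    have h4 := disjoint_T hp h.left hd
    have h5 := disjoint_T hp h.left hd'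
    by_contra h
    have h3 : d = b := by tauto
    have h4 : d' = b := by tauto
    exact hne (h3.trans h4.symm)

variable (hc : G.Connected) (hT : Tests G x y) (hp : Paired G x y u v)

include hc hT hp

theorem valid_mk {a b : V} (ha : a ∈ T G x y u) (hb : b ∈ T G x y v) (hab : ¬ G.Adj a b)
    (hga : ∀ c, Green G x y u c → c = a) (hgb : ∀ c, Green G x y v c → c = b)
    (hcov : ∀ c ∈ T G x y u ∪ T G x y v, ∀ d ∈ T G x y u ∪ T G x y v, G.Adj c d →
      c = a ∨ c = b ∨ d = a ∨ d = b) : Valid G x y u v a b := by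
  refine ⟨ha, hb, hab, fun c hcU d hd hcd => ?_⟩
  rcases hcU with hcU | hcU
  · rcases nbr_cases hc hp.1 hcU hd hcd with h | h | ⟨v', h, hd'⟩
    · exact Or.inl (hga c (green_of_sees hcU h hcd))
    · exact hcov c (Or.inl hcU) d (Or.inl h) hcd
    · obtain rfl := hT.2.1 u v v' hp h
      exact hcov c (Or.inl hcU) d (Or.inr hd') hcd
  · rcases nbr_cases hc hp.2.1 hcU hd hcd with h | h | ⟨v', h, hd'⟩
    · exact Or.inr (Or.inl (hgb c (green_of_sees hcU h hcd)))
    · exact hcov c (Or.inr hcU) d (Or.inr h) hcd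
    · obtain rfl := hT.2.1 v u v' hp.symm h
      exact hcov c (Or.inr hcU) d (Or.inl hd') hcd

/-- An end of an uncovered edge that saw `a` or `b` would have two neighbors in the pair and be
another green vertex. So an uncovered edge lies outside both neighborhoods, which `CondH1` excludes.
-/
theorem valid_iff_h1 {a b a' b' : V} (ha : Green G x y u a) (hb : Green G x y v b) :
    Valid G x y u v a' b' ↔ a' = a ∧ b' = b ∧ CondH1 G x y u v a b := by
  constructor
  · intro h
    obtain rfl := valid_green_left hT.2.1 hp h ha
    obtain rfl := valid_green_left hT.2.1 hp.symm h.symm hb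
    refine ⟨rfl, rfl, h.not_adj, fun c hcU d hdU _ hcd => ?_⟩
    rcases h.cover_T hcU.1 hdU.1 hcd with rfl | rfl | rfl | rfl
    · exact hdU.2 (Or.inl hcd)
    · exact hdU.2 (Or.inr hcd)
    · exact hcU.2 (Or.inl hcd.symm)
    · exact hcU.2 (Or.inr hcd.symm)
  · rintro ⟨rfl, rfl, hab, hind⟩
    refine valid_mk hc hT hp ha.1 hb.1 hab (fun c h => (hT.2.2.2 u hp.1).1 _ _ h ha)
      (fun c h => (hT.2.2.2 v hp.2.1).1 _ _ h hb) fun c hcU d hdU hcd => ?_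
    by_contra hne
    push Not at hne
    have key : ∀ c ∈ T G x y u ∪ T G x y v, ∀ d ∈ T G x y u ∪ T G x y v, G.Adj c d →
        c ≠ a' → c ≠ b' → d ≠ a' → d ≠ b' → ∀ z, z = a' ∨ z = b' → ¬ G.Adj z c := by
      intro c hcU d hdU hcd h1 h2 h3 h4 z hz hzc
      have hzU : z ∈ T G x y u ∪ T G x y v :=
        hz.elim (fun h => Or.inl (h ▸ ha.1)) (fun h => Or.inr (h ▸ hb.1))
      have hzd : z ≠ d := by
        rcases hz with rfl | rfl
        · exact h3.symm
        · exact h4.symm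
      rcases hcU with hcU | hcU
      · exact h1 ((hT.2.2.2 u hp.1).1 _ _ (green_of_two hT hp hcU hzU hdU hzc.symm hcd hzd) ha)
      · exact h2 ((hT.2.2.2 v hp.2.1).1 _ _
          (green_of_two hT hp.symm hcU hzU.symm hdU.symm hzc.symm hcd hzd) hb)
    have k1 := key c hcU d hdU hcd hne.1 hne.2.1 hne.2.2.1 hne.2.2.2
    have k2 := key d hdU c hcU hcd.symm hne.2.2.1 hne.2.2.2 hne.1 hne.2.1
    exact hind ⟨hcU, fun h => h.elim (k1 a' (Or.inl rfl)) (k1 b' (Or.inr rfl))⟩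
      ⟨hdU, fun h => h.elim (k2 a' (Or.inl rfl)) (k2 b' (Or.inr rfl))⟩ hcd.ne hcd

/-- An edge that survives the removal of `N(a)` does not contain `a`, so it is covered by `b'`.
Hence all remaining components with an edge share `b'`. -/
theorem condH2_of_valid {a a' b' : V} (ha : Green G x y u a) (h : Valid G x y u v a' b') :
    CondH2 G x y u v a := by
  obtain rfl := valid_green_left hT.2.1 hp h ha
  refine ⟨⟨b', h.right, h.not_adj⟩, fun K hK K' hK' => ?_⟩
  have key : ∀ K ∈ nontrivialComponents G ((T G x y u ∪ T G x y v) \ G.neighborSet a), b' ∈ K := by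
    intro K hK
    obtain ⟨c, hcK⟩ := hK.1.nonempty
    obtain ⟨d, hdK, hcd⟩ := exists_adj_of_mem_nontrivialComponents hK hcK
    have hcU := nontrivialComponents_subset hK hcK
    have hdU := nontrivialComponents_subset hK hdK
    rcases h.cover_T hcU.1 hdU.1 hcd with rfl | rfl | rfl | rfl
    · exact absurd hcd hdU.2
    · exact hcK
    · exact absurd hcd.symm hcU.2
    · exact hdK
  exact nontrivialComponents_unique hK hK' (key K hK) (key K' hK')

variable {a : V} (ha : Green G x y u a) (hgv : ∀ t, ¬ Green G x y v t)

include ha hgv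

theorem valid_mk_h2 {b : V} (hb : b ∈ T G x y v \ G.neighborSet a)
    (hcov : ∀ c ∈ (T G x y u ∪ T G x y v) \ G.neighborSet a,
      ∀ d ∈ (T G x y u ∪ T G x y v) \ G.neighborSet a, G.Adj c d → c = b ∨ d = b) :
    Valid G x y u v a b := by
  refine valid_mk hc hT hp ha.1 hb.1 hb.2 (fun c h => (hT.2.2.2 u hp.1).1 _ _ h ha)
    (fun c h => absurd h (hgv c)) fun c hcU d hdU hcd => ?_
  by_contra hne
  push Not at hne
  have key : ∀ c ∈ T G x y u ∪ T G x y v, ∀ d ∈ T G x y u ∪ T G x y v, G.Adj c d →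
      c ≠ a → d ≠ a → ¬ G.Adj a c := by
    intro c hcU d hdU hcd h1 h2 h3
    rcases hcU with hcU | hcU
    · exact h1 ((hT.2.2.2 u hp.1).1 _ _
        (green_of_two hT hp hcU (Or.inl ha.1) hdU h3.symm hcd h2.symm) ha)
    · exact hgv c (green_of_two hT hp.symm hcU (Or.inr ha.1) hdU.symm h3.symm hcd h2.symm)
  have := hcov c ⟨hcU, key c hcU d hdU hcd hne.1 hne.2.2.1⟩ d
    ⟨hdU, key d hdU c hcU hcd.symm hne.2.2.1 hne.1⟩ hcd
  tauto

/-- No remaining end of `bc` has a second neighbor, since it would be green, and `c` is not `a`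
because `b` avoids `N(a)`. So the one remaining component is the edge `bc`, covered by `b`. -/
theorem valid_of_edge_h2 (hcond : CondH2 G x y u v a) {b c : V}
    (hb : b ∈ T G x y v \ G.neighborSet a)
    (hcU : c ∈ (T G x y u ∪ T G x y v) \ G.neighborSet a) (hbc : G.Adj b c) :
    Valid G x y u v a b := by
  refine valid_mk_h2 hc hT hp ha hgv hb fun d hd e he hde => ?_
  have hbU : b ∈ (T G x y u ∪ T G x y v) \ G.neighborSet a := ⟨Or.inr hb.1, hb.2⟩
  obtain ⟨K, hK, hbK, hcK⟩ := exists_mem_nontrivialComponents hbU hcU hbc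
  obtain ⟨K', hK', hdK, heK⟩ := exists_mem_nontrivialComponents hd he hde
  obtain rfl := hcond.2 hK hK'
  have hsub : K ⊆ {b, c} := by
    refine nontrivialComponents_minimal hK hbK (Or.inl rfl) ?_
    rintro f (rfl | rfl) g hg hfg
    · right
      by_contra hne
      exact hgv f (green_of_two hT hp.symm hb.1 hg.1.symm hcU.1.symm hfg hbc hne)
    · left
      by_contra hne
      rcases hcU.1 with h | h
      · obtain rfl := (hT.2.2.2 u hp.1).1 _ _ (green_of_two hT hp h hg.1 hbU.1 hfg hbc.symm hne) ha
        exact hb.2 hbc.symm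
      · exact hgv f (green_of_two hT hp.symm h hg.1.symm hbU.1.symm hfg hbc.symm hne)
  have h1 := hsub hdK
  have h2 := hsub heK
  rcases h1 with h1 | rfl
  · exact Or.inl h1
  · rcases h2 with h2 | rfl
    · exact Or.inr h2
    · exact absurd hde G.irrefl

theorem valid_iff_h2_cross (hcond : CondH2 G x y u v a) {b c a' b' : V}
    (hb : b ∈ T G x y v \ G.neighborSet a)
    (hcu : c ∈ T G x y u \ G.neighborSet a) (hbc : G.Adj b c) :
    Valid G x y u v a' b' ↔ a' = a ∧ b' = b := by
  constructor
  · intro h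
    obtain rfl := valid_green_left hT.2.1 hp h ha
    refine ⟨rfl, ?_⟩
    rcases h.cover_T (Or.inr hb.1) (Or.inl hcu.1) hbc with h' | h' | h' | h'
    · exact absurd h'.symm (disjoint_T hp ha.1 hb.1)
    · exact h'.symm
    · exact absurd (h' ▸ hbc.symm) hb.2
    · exact absurd h' (disjoint_T hp hcu.1 h.right)
  · rintro ⟨rfl, rfl⟩
    exact valid_of_edge_h2 hc hT hp ha hgv hcond hb ⟨Or.inl hcu.1, hcu.2⟩ hbc

theorem valid_iff_h2_star (hcond : CondH2 G x y u v a) {a' b' : V}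
    (hY : (Y G x y v).Nonempty) : Valid G x y u v a' b' ↔ a' = a ∧ b' ∈ Y G x y v := by
  constructor
  · intro h
    obtain rfl := valid_green_left hT.2.1 hp h ha
    refine ⟨rfl, ?_⟩
    obtain ⟨c, hcY⟩ := hY
    obtain ⟨hcv, d, hd, hcd⟩ := mem_Y.1 hcY
    rcases h.cover_T (Or.inr hcv) (Or.inr hd) hcd with h' | h' | h' | h'
    · exact absurd h'.symm (disjoint_T hp ha.1 hcv)
    · exact h' ▸ hcY
    · exact absurd h'.symm (disjoint_T hp ha.1 hd)
    · exact h' ▸ mem_Y.2 ⟨hd, c, hcv, hcd.symm⟩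
  · rintro ⟨rfl, h⟩
    obtain ⟨hb, c, hcv, hbc⟩ := mem_Y.1 h
    -- The star `Y v` sees nothing in `T u`, so removing `N(a')` leaves it intact.
    have hn : ∀ z ∈ Y G x y v, ¬ G.Adj a' z := fun z hz hadj =>
      hT.1.star_sees v hp.2.1 u hp.1 hp.2.2.1.symm ⟨z, hz, a', ha.1, hadj.symm⟩
    exact valid_of_edge_h2 hc hT hp ha hgv hcond ⟨hb, hn _ h⟩
      ⟨Or.inr hcv, hn c (mem_Y.2 ⟨hcv, _, hb, hbc.symm⟩)⟩ hbc

theorem valid_iff_h2_rest (hs : ¬ Sees G (T G x y v \ G.neighborSet a) (T G x y u \ G.neighborSet a))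
    {a' b' : V} (hY : Y G x y v = ∅) :
    Valid G x y u v a' b' ↔ a' = a ∧ b' ∈ T G x y v \ G.neighborSet a := by
  constructor
  · intro h
    obtain rfl := valid_green_left hT.2.1 hp h ha
    exact ⟨rfl, h.right, h.not_adj⟩
  · rintro ⟨rfl, h⟩
    refine valid_mk_h2 hc hT hp ha hgv h fun c hcU d hdU hcd => ?_
    exfalso
    rcases hcU with ⟨hcU | hcU, hcN⟩ <;> rcases hdU with ⟨hdU | hdU, hdN⟩
    · exact (hT.2.2.2 u hp.1).2 a' ha ⟨hcU, hcN⟩ ⟨hdU, hdN⟩ hcd.ne hcd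
    · exact hs ⟨d, ⟨hdU, hdN⟩, c, ⟨hcU, hcN⟩, hcd.symm⟩
    · exact hs ⟨c, ⟨hcU, hcN⟩, d, ⟨hdU, hdN⟩, hcd⟩
    · exact (hY ▸ mem_Y.2 ⟨hcU, d, hdU, hcd⟩ : c ∈ (∅ : Set V))

end Pairs

end Valid

/-! ### Paired sets without green vertices -/

section PairsWithoutGreen

variable {V : Type*} {G : SimpleGraph V} {x y : V} [Finite V] {u v : V}

/-- Without green vertices the graph induced by the two sets has maximum degree one. -/
theorem eq_of_adj_of_no_green (hT : Tests G x y) (hp : Paired G x y u v)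
    (hgu : ∀ t, ¬ Green G x y u t) (hgv : ∀ t, ¬ Green G x y v t) {c d e : V}
    (hc : c ∈ T G x y u ∪ T G x y v) (hd : d ∈ T G x y u ∪ T G x y v)
    (he : e ∈ T G x y u ∪ T G x y v) (hcd : G.Adj c d) (hce : G.Adj c e) : d = e := by
  by_contra hne
  rcases hc with hc | hc
  · exact hgu c (green_of_two hT hp hc hd he hcd hce hne)
  · exact hgv c (green_of_two hT hp.symm hc hd.symm he.symm hcd hce hne)

/-- Components with an edge are now single edges, and `TestD` allows at most two of them: `pq` and
`cd` are all the edges. -/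
theorem edge_cases_of_no_green (hT : Tests G x y) (hp : Paired G x y u v)
    (hgu : ∀ t, ¬ Green G x y u t) (hgv : ∀ t, ¬ Green G x y v t) {p q c d e f : V}
    (hpU : p ∈ T G x y u ∪ T G x y v) (hq : q ∈ T G x y u ∪ T G x y v) (hpq : G.Adj p q)
    (hc : c ∈ T G x y u ∪ T G x y v) (hd : d ∈ T G x y u ∪ T G x y v) (hcd : G.Adj c d)
    (he : e ∈ T G x y u ∪ T G x y v) (hf : f ∈ T G x y u ∪ T G x y v) (hef : G.Adj e f)
    (hcp : c ≠ p) (hcq : c ≠ q) :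
    (e = p ∧ f = q) ∨ (e = q ∧ f = p) ∨ (e = c ∧ f = d) ∨ (e = d ∧ f = c) := by
  have uniq := fun {c d e} => eq_of_adj_of_no_green (c := c) (d := d) (e := e) hT hp hgu hgv
  obtain ⟨K₁, hK₁, hp1, hq1⟩ := exists_mem_nontrivialComponents hpU hq hpq
  obtain ⟨K₂, hK₂, hc2, hd2⟩ := exists_mem_nontrivialComponents hc hd hcd
  obtain ⟨K₃, hK₃, he3, hf3⟩ := exists_mem_nontrivialComponents he hf hef
  have hsub : ∀ {a b K}, a ∈ T G x y u ∪ T G x y v → b ∈ T G x y u ∪ T G x y v → G.Adj a b →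
      K ∈ nontrivialComponents G (T G x y u ∪ T G x y v) → a ∈ K → K ⊆ {a, b} := by
    intro a b K ha hb hab hK haK
    refine nontrivialComponents_minimal hK haK (Or.inl rfl) ?_
    rintro c (rfl | rfl) d hd hcd
    · exact Or.inr (uniq ha hd hb hcd hab)
    · exact Or.inl (uniq hb hd ha hcd hab.symm)
  have h12 : K₁ ≠ K₂ := fun h => by
    rcases hsub hpU hq hpq hK₁ hp1 (h ▸ hc2) with h | h
    · exact hcp h
    · exact hcq h
  have hcard := (hT.2.2.1 u v hp).1
  have h3 : K₃ = K₁ ∨ K₃ = K₂ := by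
    by_contra hne
    rw [not_or] at hne
    have : 2 < (nontrivialComponents G (T G x y u ∪ T G x y v)).ncard :=
      (Set.two_lt_ncard_iff (Set.toFinite _)).2
        ⟨K₁, K₂, K₃, hK₁, hK₂, hK₃, h12, Ne.symm hne.1, Ne.symm hne.2⟩
    omega
  rcases h3 with rfl | rfl
  · rcases hsub hpU hq hpq hK₁ hp1 he3 with rfl | rfl
    · exact Or.inl ⟨rfl, uniq he hf hq hef hpq⟩
    · exact Or.inr (Or.inl ⟨rfl, uniq he hf hpU hef hpq.symm⟩)
  · rcases hsub hc hd hcd hK₂ hc2 he3 with rfl | rfl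
    · exact Or.inr (Or.inr (Or.inl ⟨rfl, uniq he hf hd hef hcd⟩))
    · exact Or.inr (Or.inr (Or.inr ⟨rfl, uniq he hf hc hef hcd.symm⟩))

/-- Covering `pq` needs one of its ends, and the two chosen vertices are not adjacent. So a valid
choice contains exactly one end of any edge between the sets; the program relies on this in every
case, with or without green vertices. -/
theorem Valid.cross {p q a b : V} (hp : Paired G x y u v) (h : Valid G x y u v a b)
    (hpu : p ∈ T G x y u) (hqv : q ∈ T G x y v) (hpq : G.Adj p q) :
    (a = p ∧ b ≠ q) ∨ (b = q ∧ a ≠ p) := by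
  have h1 := h.cover_T (Or.inl hpu) (Or.inr hqv) hpq
  have h2 := disjoint_T hp hpu h.right
  have h3 := disjoint_T hp h.left hqv
  have h4 : ¬ (a = p ∧ b = q) := by
    rintro ⟨rfl, rfl⟩
    exact h.not_adj hpq
  by_cases ha : a = p <;> by_cases hb : b = q <;> simp_all
  tauto

variable (hc : G.Connected) (hT : Tests G x y) (hp : Paired G x y u v)
  (hgu : ∀ t, ¬ Green G x y u t) (hgv : ∀ t, ¬ Green G x y v t) {p q : V}
  (hpu : p ∈ T G x y u) (hqv : q ∈ T G x y v) (hpq : G.Adj p q)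

include hc hT hp hgu hgv hpu hqv hpq

/-- The edge `p'q'` inside `T u` can be covered only by `a`. It avoids `p` by `star_sees`, so `pq`
must be covered by `b`. -/
theorem valid_iff_inner {p' q' a b : V} (hp' : p' ∈ T G x y u) (hq' : q' ∈ T G x y u)
    (hpq' : G.Adj p' q') : Valid G x y u v a b ↔ b = q ∧ (a = p' ∨ a = q') := by
  have hY : ∀ z, z = p' ∨ z = q' → z ∈ Y G x y u := by
    rintro z (rfl | rfl)
    · exact mem_Y.2 ⟨hp', q', hq', hpq'⟩
    · exact mem_Y.2 ⟨hq', p', hp', hpq'.symm⟩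
  have hnadj : ∀ z, z = p' ∨ z = q' → ∀ t ∈ T G x y v, ¬ G.Adj z t := fun z hz t ht h =>
    hT.1.star_sees u hp.1 v hp.2.1 hp.2.2.1 ⟨z, hY z hz, t, ht, h⟩
  have hne : ∀ z, z = p' ∨ z = q' → z ≠ p := by
    rintro z hz rfl
    exact hnadj z hz q hqv hpq
  constructor
  · intro h
    have ha : a = p' ∨ a = q' := by
      have := h.cover_T (Or.inl hp') (Or.inl hq') hpq'
      have h1 := disjoint_T hp hp' h.right
      have h2 := disjoint_T hp hq' h.right
      tauto
    rcases h.cross hp hpu hqv hpq with h' | h'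
    · exact absurd h'.1 (hne a ha)
    · exact ⟨h'.1, ha⟩
  · rintro ⟨rfl, ha⟩
    have hau : a ∈ T G x y u := (mem_Y.1 (hY a ha)).1
    refine valid_mk hc hT hp hau hqv (hnadj a ha b hqv) (fun c h => absurd h (hgu c))
      (fun c h => absurd h (hgv c)) fun e he f hf hef => ?_
    have := edge_cases_of_no_green hT hp hgu hgv (Or.inl hpu) (Or.inr hqv) hpq (Or.inl hp')
      (Or.inl hq') hpq' he hf hef (hne p' (Or.inl rfl)) (disjoint_T hp hp' hqv)
    rcases ha with rfl | rfl <;> tauto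

/-- The two edges are disjoint and each needs exactly one chosen end, with one chosen vertex on each
side. -/
theorem valid_iff_cross {p' q' a b : V} (hp' : p' ∈ T G x y u) (hq' : q' ∈ T G x y v)
    (hpq' : G.Adj p' q') (hne : (p', q') ≠ (p, q)) :
    Valid G x y u v a b ↔ (a = p' ∧ b = q) ∨ (a = p ∧ b = q') := by
  have uniq := fun {c d e} => eq_of_adj_of_no_green (c := c) (d := d) (e := e) hT hp hgu hgv
  have hpp : p' ≠ p := by
    rintro rfl
    exact hne (by rw [uniq (Or.inl hpu) (Or.inr hq') (Or.inr hqv) hpq' hpq])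
  have hqq : q' ≠ q := by
    rintro rfl
    exact hne (by rw [uniq (Or.inr hqv) (Or.inl hp') (Or.inl hpu) hpq'.symm hpq.symm])
  constructor
  · intro h
    have h1 := h.cross hp hpu hqv hpq
    have h2 := h.cross hp hp' hq' hpq'
    rcases h1 with ⟨rfl, h1⟩ | ⟨rfl, h1⟩
    · exact Or.inr ⟨rfl, (h2.resolve_left fun h => hpp h.1.symm).1⟩
    · exact Or.inl ⟨(h2.resolve_right fun h => hqq h.1.symm).1, rfl⟩
  · intro h
    have hedge := fun {e f} he hf hef => edge_cases_of_no_green (e := e) (f := f) hT hp hgu hgv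
      (Or.inl hpu) (Or.inr hqv) hpq (Or.inl hp') (Or.inr hq') hpq' he hf hef hpp (disjoint_T hp hp' hqv)
    rcases h with ⟨rfl, rfl⟩ | ⟨rfl, rfl⟩
    · refine valid_mk hc hT hp hp' hqv (fun h => ?_) (fun c h => absurd h (hgu c))
        (fun c h => absurd h (hgv c)) fun e he f hf hef => ?_
      · exact hqq (uniq (Or.inl hp') (Or.inr hq') (Or.inr hqv) hpq' h)
      · have := hedge he hf hef
        tauto
    · refine valid_mk hc hT hp hpu hq' (fun h => ?_) (fun c h => absurd h (hgu c))
        (fun c h => absurd h (hgv c)) fun e he f hf hef => ?_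
      · exact hqq (uniq (Or.inl hpu) (Or.inr hq') (Or.inr hqv) h hpq)
      · have := hedge he hf hef
        tauto

theorem valid_iff_only {a b : V} (he : edgesIn G (T G x y u ∪ T G x y v) = {s(p, q)}) :
    Valid G x y u v a b ↔
      (b = q ∧ a ∈ T G x y u \ {p}) ∨ (a = p ∧ b ∈ T G x y v \ {q}) := by
  have hedge : ∀ e ∈ T G x y u ∪ T G x y v, ∀ f ∈ T G x y u ∪ T G x y v, G.Adj e f →
      (e = p ∧ f = q) ∨ (e = q ∧ f = p) := by
    intro e he' f hf hef
    have : s(e, f) ∈ edgesIn G (T G x y u ∪ T G x y v) := mem_edgesIn.2 ⟨hef, he', hf⟩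
    rw [he, Set.mem_singleton_iff, Sym2.eq_iff] at this
    exact this
  have hqp := disjoint_T hp hpu hqv
  constructor
  · intro h
    rcases h.cross hp hpu hqv hpq with h' | h'
    · exact Or.inr ⟨h'.1, h.right, h'.2⟩
    · exact Or.inl ⟨h'.1, h.left, h'.2⟩
  · rintro (⟨rfl, h, hne⟩ | ⟨rfl, h, hne⟩)
    · refine valid_mk hc hT hp h hqv (fun h' => ?_) (fun c h => absurd h (hgu c))
        (fun c h => absurd h (hgv c)) fun e he f hf hef => ?_
      · rcases hedge a (Or.inl h) b (Or.inr hqv) h' with h | h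
        · exact hne h.1
        · exact hqp h.2.symm
      · have := hedge e he f hf hef
        tauto
    · refine valid_mk hc hT hp hpu h (fun h' => ?_) (fun c h => absurd h (hgu c))
        (fun c h => absurd h (hgv c)) fun e he f hf hef => ?_
      · rcases hedge a (Or.inl hpu) b (Or.inr h) h' with h | h
        · exact hne h.2
        · exact hqp h.1
      · have := hedge e he f hf hef
        tauto

end PairsWithoutGreen

/-! ### Step (h) selects exactly the optimal valid pairs -/

section StepH

variable {V : Type*} {G : SimpleGraph V} {x y : V} {w : Sym2 V → Weight} {u v : V}

/-- The valid pair `(a, b)` has minimum weight, and each of `a`, `b` is best for the other one. -/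
structure Opt (G : SimpleGraph V) (x y : V) (w : Sym2 V → Weight) (u v a b : V) : Prop where
  valid : Valid G x y u v a b
  sum_le : ∀ a' b', Valid G x y u v a' b' → w s(u, a) + w s(v, b) ≤ w s(u, a') + w s(v, b')
  left_le : ∀ a', Valid G x y u v a' b → w s(u, a) ≤ w s(u, a')
  right_le : ∀ b', Valid G x y u v a b' → w s(v, b) ≤ w s(v, b')

theorem Opt.symm {a b : V} (h : Opt G x y w u v a b) : Opt G x y w v u b a :=
  ⟨h.valid.symm, fun a' b' h' => by
    rw [add_comm, add_comm (w s(v, a'))]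
    exact h.sum_le b' a' h'.symm, fun b' h' => h.right_le b' h'.symm,
    fun a' h' => h.left_le a' h'.symm⟩

/-- Here `right_le` cannot be replaced by `sum_le`: the weight of the edge to `a` may be `∞` and
then does not cancel. -/
theorem opt_of_iff_right {a b : V} {K : Set V}
    (h : ∀ a' b', Valid G x y u v a' b' ↔ a' = a ∧ b' ∈ K) :
    Opt G x y w u v a b ↔ IsBest w v K b := by
  constructor
  · intro hopt
    exact ⟨((h _ _).1 hopt.valid).2, fun b' hb' => hopt.right_le b' ((h _ _).2 ⟨rfl, hb'⟩)⟩
  · rintro ⟨hb, hle⟩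
    refine ⟨(h _ _).2 ⟨rfl, hb⟩, fun a' b' h' => ?_, fun a' h' => ?_, fun b' h' => ?_⟩
    · obtain ⟨rfl, hb'⟩ := (h _ _).1 h'
      exact add_le_add_right (hle b' hb') _
    · rw [((h _ _).1 h').1]
    · exact hle b' ((h _ _).1 h').2

theorem choiceH3_swap {p q : V} {r : Option (V × V)} (h : ChoiceH3 G x y w u v p q r) :
    ChoiceH3 G x y w v u q p (r.map Prod.swap) := by
  have hswap : s(p, q) = s(q, p) := Sym2.eq_swap
  have hne : ∀ {p' q' : V}, (p', q') ≠ (p, q) → (q', p') ≠ (q, p) := by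
    intro p' q' h h'
    rw [Prod.mk.injEq] at h'
    exact h (by rw [h'.1, h'.2])
  cases h with
  | inner_left p' q' z h1 h2 h3 h4 => exact .inner_right p' q' z h1 h2 h3 h4
  | inner_right p' q' z h1 h2 h3 h4 => exact .inner_left p' q' z h1 h2 h3 h4
  | cross_left p' q' h1 h2 h3 h4 h5 =>
    exact .cross_right q' p' h2 h1 h3.symm (hne h4) (by rwa [add_comm, add_comm (w s(v, q'))])
  | cross_right p' q' h1 h2 h3 h4 h5 =>
    exact .cross_left q' p' h2 h1 h3.symm (hne h4) (by rwa [add_comm, add_comm (w s(v, q))])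
  | failed h1 h2 h3 => exact .failed (by rwa [Set.union_comm, ← hswap]) h3 h2
  | only_left z h1 h2 h3 => exact .only_right z (by rwa [Set.union_comm, ← hswap]) h3 h2
  | only_right z h1 h2 h3 => exact .only_left z (by rwa [Set.union_comm, ← hswap]) h3 h2
  | both_left z z' h1 h2 h3 h4 =>
    exact .both_right z' z (by rwa [Set.union_comm, ← hswap]) h3 h2
      (by rwa [add_comm, add_comm (w s(v, z'))])
  | both_right z z' h1 h2 h3 h4 =>
    exact .both_left z' z (by rwa [Set.union_comm, ← hswap]) h3 h2
      (by rwa [add_comm, add_comm (w s(v, q))])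

/-- The step is symmetric in the two sets, so cases with a green vertex on one side only are treated
with this vertex on the left. -/
theorem stepH_swap {r : Option (V × V)} (h : StepH G x y w u v r) :
    StepH G x y w v u (r.map Prod.swap) := by
  have hcond : ∀ {u v a b}, CondH1 G x y v u b a → CondH1 G x y u v a b := by
    rintro u v a b ⟨h1, h2⟩
    refine ⟨fun h => h1 h.symm, ?_⟩
    rwa [Set.union_comm, Set.union_comm (G.neighborSet a)]
  cases h with
  | h1 a b ha hb h => exact .h1 b a hb ha (hcond h)
  | h1_failed a b ha hb h => exact .h1_failed b a hb ha fun h' => h (hcond h')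
  | h2_left a b ha hb h h' => exact .h2_right b a hb ha h h'
  | h2_left_failed a ha hb h => exact .h2_right_failed a hb ha h
  | h2_right a b ha hb h h' => exact .h2_left b a hb ha h h'
  | h2_right_failed b ha hb h => exact .h2_left_failed b hb ha h
  | h3 p q r ha hb hp hq hpq h => exact .h3 q p _ hb ha hq hp hpq.symm (choiceH3_swap h)

variable [Finite V] (hc : G.Connected) (hT : Tests G x y) (hp : Paired G x y u v)

include hp

theorem exists_edge_of_ne {p q : V} (hpu : p ∈ T G x y u) (hqv : q ∈ T G x y v) (hpq : G.Adj p q) :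
    (∃ p' ∈ T G x y u, ∃ q' ∈ T G x y u, G.Adj p' q') ∨
    (∃ p' ∈ T G x y v, ∃ q' ∈ T G x y v, G.Adj p' q') ∨
    (∃ p' ∈ T G x y u, ∃ q' ∈ T G x y v, G.Adj p' q' ∧ (p', q') ≠ (p, q)) ∨
    edgesIn G (T G x y u ∪ T G x y v) = {s(p, q)} := by
  by_contra hn
  rw [not_or, not_or, not_or] at hn
  obtain ⟨h1, h2, h3, h4⟩ := hn
  push Not at h1 h2 h3
  refine h4 (Set.Subset.antisymm ?_ ?_)
  · intro e
    induction e using Sym2.ind with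
    | _ a b =>
      rw [mem_edgesIn, Set.mem_singleton_iff]
      rintro ⟨hab, ha | ha, hb | hb⟩
      · exact absurd hab (h1 a ha b hb)
      · have := h3 a ha b hb hab
        rw [Prod.mk.injEq] at this
        rw [this.1, this.2]
      · have := h3 b hb a ha hab.symm
        rw [Prod.mk.injEq] at this
        rw [this.1, this.2, Sym2.eq_swap]
      · exact absurd hab (h2 a ha b hb)
  · rintro e rfl
    exact mem_edgesIn.2 ⟨hpq, Or.inl hpu, Or.inr hqv⟩

theorem exists_stepH : ∃ r, StepH G x y w u v r := by
  have hleft : ∀ {u v}, Paired G x y u v → (∃ a, Green G x y u a) → (∀ t, ¬ Green G x y v t) →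
      ∃ r, StepH G x y w u v r := by
    rintro u v hp ⟨a, ha⟩ hv
    by_cases hcond : CondH2 G x y u v a
    · by_cases hs : Sees G (T G x y v \ G.neighborSet a) (T G x y u \ G.neighborSet a)
      · obtain ⟨b, hb, c, hc, hbc⟩ := hs
        exact ⟨_, .h2_left a b ha hv hcond (.cross b c hb hc hbc)⟩
      · rcases (Y G x y v).eq_empty_or_nonempty with hY | hY
        · obtain ⟨b, hb⟩ := exists_isBest w v hcond.1
          exact ⟨_, .h2_left a b ha hv hcond (.rest b hs hY hb)⟩
        · obtain ⟨b, hb⟩ := exists_isBest w v hY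
          exact ⟨_, .h2_left a b ha hv hcond (.star b hs hY hb)⟩
    · exact ⟨_, .h2_left_failed a ha hv hcond⟩
  by_cases hu : ∃ a, Green G x y u a <;> by_cases hv : ∃ b, Green G x y v b
  · obtain ⟨a, ha⟩ := hu
    obtain ⟨b, hb⟩ := hv
    by_cases hcond : CondH1 G x y u v a b
    · exact ⟨_, .h1 a b ha hb hcond⟩
    · exact ⟨_, .h1_failed a b ha hb hcond⟩
  · exact hleft hp hu (not_exists.1 hv)
  · obtain ⟨r, hr⟩ := hleft hp.symm hv (not_exists.1 hu)
    exact ⟨_, stepH_swap hr⟩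
  · obtain ⟨p, hpu, q, hqv, hpq⟩ := hp.2.2.2
    have h3 : ∀ r, ChoiceH3 G x y w u v p q r → ∃ r, StepH G x y w u v r := fun r hr =>
      ⟨r, .h3 p q r (not_exists.1 hu) (not_exists.1 hv) hpu hqv hpq hr⟩
    rcases exists_edge_of_ne hp hpu hqv hpq with ⟨p', hp', q', hq', h⟩ | ⟨p', hp', q', hq', h⟩ |
      ⟨p', hp', q', hq', h, hne⟩ | he
    · obtain ⟨z, hz⟩ := exists_isBest w u (K := {p', q'}) ⟨p', Or.inl rfl⟩
      exact h3 _ (.inner_left p' q' z hp' hq' h hz)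
    · obtain ⟨z, hz⟩ := exists_isBest w v (K := {p', q'}) ⟨p', Or.inl rfl⟩
      exact h3 _ (.inner_right p' q' z hp' hq' h hz)
    · rcases le_total (w s(u, p') + w s(v, q)) (w s(u, p) + w s(v, q')) with hle | hle
      · exact h3 _ (.cross_left p' q' hp' hq' h hne hle)
      · exact h3 _ (.cross_right p' q' hp' hq' h hne hle)
    · have hsing : ∀ {K : Set V} {p : V}, p ∈ K → K \ {p} = ∅ → K = {p} := fun hp h =>
        Set.Subset.antisymm (Set.sdiff_eq_empty.1 h) (Set.singleton_subset_iff.2 hp)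
      rcases (T G x y u \ {p}).eq_empty_or_nonempty with h1 | h1 <;>
        rcases (T G x y v \ {q}).eq_empty_or_nonempty with h2 | h2
      · exact h3 _ (.failed he (hsing hpu h1) (hsing hqv h2))
      · obtain ⟨z, hz⟩ := exists_isBest w v h2
        exact h3 _ (.only_right z he (hsing hpu h1) hz)
      · obtain ⟨z, hz⟩ := exists_isBest w u h1
        exact h3 _ (.only_left z he hz (hsing hqv h2))
      · obtain ⟨z, hz⟩ := exists_isBest w u h1
        obtain ⟨z', hz'⟩ := exists_isBest w v h2
        rcases le_total (w s(u, z) + w s(v, q)) (w s(u, p) + w s(v, z')) with hle | hle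
        · exact h3 _ (.both_left z z' he hz hz' hle)
        · exact h3 _ (.both_right z z' he hz hz' hle)

include hc hT

/-- In each case the valid pairs are those with the green vertex `a` and any second vertex from one
explicit set, over which the procedure minimizes. For a remaining edge between the two sets this set
has one element, so it does not matter which such edge was taken. -/
theorem choiceH2_iff {a b : V} (ha : Green G x y u a) (hgv : ∀ t, ¬ Green G x y v t)
    (hcond : CondH2 G x y u v a) :
    ChoiceH2 G x y w u v a b ↔ Opt G x y w u v a b := by
  by_cases hs : Sees G (T G x y v \ G.neighborSet a) (T G x y u \ G.neighborSet a)
  · have hbest : ∀ b b' : V, IsBest w v {b'} b ↔ b = b' := fun b b' =>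
      ⟨fun h => h.1, by rintro rfl; exact ⟨rfl, by rintro t rfl; rfl⟩⟩
    have key : ∀ b' ∈ T G x y v \ G.neighborSet a, ∀ c ∈ T G x y u \ G.neighborSet a, G.Adj b' c →
        (Opt G x y w u v a b ↔ b = b') := fun b' hb' c hcu hbc => by
      rw [← hbest b b']
      exact opt_of_iff_right fun a' b'' =>
        valid_iff_h2_cross hc hT hp ha hgv hcond hb' hcu hbc
    constructor
    · rintro (⟨c, hb, hcu, hbc⟩ | ⟨h, -⟩ | ⟨h, -⟩)
      · exact (key b hb c hcu hbc).2 rfl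
      · exact absurd hs h
      · exact absurd hs h
    · intro h
      obtain ⟨b', hb', c, hcu, hbc⟩ := hs
      obtain rfl := (key b' hb' c hcu hbc).1 h
      exact .cross b c hb' hcu hbc
  · rcases (Y G x y v).eq_empty_or_nonempty with hY | hY
    · rw [opt_of_iff_right fun a' b' => valid_iff_h2_rest hc hT hp ha hgv hs hY]
      constructor
      · rintro (⟨c, hb, hcu, hbc⟩ | ⟨-, h, -⟩ | ⟨-, -, h⟩)
        · exact absurd ⟨b, hb, c, hcu, hbc⟩ hs
        · exact absurd hY h.ne_empty
        · exact h
      · exact fun h => .rest b hs hY h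
    · rw [opt_of_iff_right fun a' b' => valid_iff_h2_star hc hT hp ha hgv hcond hY]
      constructor
      · rintro (⟨c, hb, hcu, hbc⟩ | ⟨-, -, h⟩ | ⟨-, h, -⟩)
        · exact absurd ⟨b, hb, c, hcu, hbc⟩ hs
        · exact h
        · exact absurd h hY.ne_empty
      · exact fun h => .star b hs hY h

/-- The meaning of a choice made without green vertices. -/
def Correct (G : SimpleGraph V) (x y : V) (w : Sym2 V → Weight) (u v : V) :
    Option (V × V) → Prop
  | some (a, b) => Opt G x y w u v a b
  | none => ∀ a b, ¬ Valid G x y u v a b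

-- Without green vertices the valid pairs form two arms, `(a, q)` with `a` in `K` and `(p, b)` with
-- `b` in `K'`. A pair is optimal if it is best on its own arm and no pair of the other arm is
-- better. The arms are disjoint by `hp` and `hq`; all cases of step (h.3) are instances, with an
-- arm possibly empty.
omit hc hT hp in
theorem opt_left_iff {p q z : V} {K K' : Set V}
    (h : ∀ a b, Valid G x y u v a b ↔ (b = q ∧ a ∈ K) ∨ (a = p ∧ b ∈ K')) (hp : p ∉ K)
    (hq : q ∉ K') : Opt G x y w u v z q ↔
      IsBest w u K z ∧ ∀ b ∈ K', w s(u, z) + w s(v, q) ≤ w s(u, p) + w s(v, b) := by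
  constructor
  · intro hopt
    have hz : z ∈ K := ((h _ _).1 hopt.valid).elim And.right fun h => absurd h.2 hq
    exact ⟨⟨hz, fun a ha => hopt.left_le a ((h _ _).2 (Or.inl ⟨rfl, ha⟩))⟩,
      fun b hb => hopt.sum_le p b ((h _ _).2 (Or.inr ⟨rfl, hb⟩))⟩
  · rintro ⟨⟨hz, hle⟩, hsum⟩
    refine ⟨(h _ _).2 (Or.inl ⟨rfl, hz⟩), fun a b hab => ?_, fun a ha => ?_, fun b hb => ?_⟩
    · rcases (h _ _).1 hab with ⟨rfl, ha⟩ | ⟨rfl, hb⟩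
      · exact add_le_add_left (hle a ha) _
      · exact hsum b hb
    · exact hle a (((h _ _).1 ha).elim And.right fun h => absurd h.2 hq)
    · rcases (h _ _).1 hb with h | h
      · rw [h.1]
      · exact absurd (h.1 ▸ hz) hp

omit hc hT hp in
theorem opt_right_iff {p q z : V} {K K' : Set V}
    (h : ∀ a b, Valid G x y u v a b ↔ (b = q ∧ a ∈ K) ∨ (a = p ∧ b ∈ K')) (hp : p ∉ K)
    (hq : q ∉ K') : Opt G x y w u v p z ↔
      IsBest w v K' z ∧ ∀ a ∈ K, w s(u, p) + w s(v, z) ≤ w s(u, a) + w s(v, q) := by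
  have h' : ∀ a b, Valid G x y v u a b ↔ (b = p ∧ a ∈ K') ∨ (a = q ∧ b ∈ K) := fun a b =>
    (Iff.intro Valid.symm Valid.symm).trans ((h b a).trans or_comm)
  have := opt_left_iff (w := w) (z := z) h' hq hp
  rw [Iff.intro Opt.symm Opt.symm, this]
  simp only [add_comm]

variable (hgu : ∀ t, ¬ Green G x y u t) (hgv : ∀ t, ¬ Green G x y v t) {p q : V}
  (hpu : p ∈ T G x y u) (hqv : q ∈ T G x y v) (hpq : G.Adj p q)

include hgu hgv hpu hqv hpq

theorem valid_sets_inner_left {p' q' : V} (hp' : p' ∈ T G x y u) (hq' : q' ∈ T G x y u)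
    (hpq' : G.Adj p' q') :
    (∀ a b, Valid G x y u v a b ↔ (b = q ∧ a ∈ ({p', q'} : Set V)) ∨ (a = p ∧ b ∈ (∅ : Set V))) ∧
      p ∉ ({p', q'} : Set V) := by
  refine ⟨fun a b => ?_, ?_⟩
  · rw [valid_iff_inner hc hT hp hgu hgv hpu hqv hpq hp' hq' hpq']
    simp
  · have hs := hT.1.star_sees u hp.1 v hp.2.1 hp.2.2.1
    rintro (rfl | rfl)
    · exact hs ⟨p, mem_Y.2 ⟨hpu, q', hq', hpq'⟩, q, hqv, hpq⟩
    · exact hs ⟨p, mem_Y.2 ⟨hpu, p', hp', hpq'.symm⟩, q, hqv, hpq⟩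

theorem valid_sets_inner_right {p' q' : V} (hp' : p' ∈ T G x y v) (hq' : q' ∈ T G x y v)
    (hpq' : G.Adj p' q') :
    (∀ a b, Valid G x y u v a b ↔ (b = q ∧ a ∈ (∅ : Set V)) ∨ (a = p ∧ b ∈ ({p', q'} : Set V))) ∧
      q ∉ ({p', q'} : Set V) := by
  obtain ⟨h, h'⟩ := valid_sets_inner_left hc hT hp.symm hgv hgu hqv hpu hpq.symm hp' hq' hpq'
  exact ⟨fun a b => (Iff.intro Valid.symm Valid.symm).trans ((h b a).trans or_comm), h'⟩

theorem valid_sets_cross {p' q' : V} (hp' : p' ∈ T G x y u) (hq' : q' ∈ T G x y v)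
    (hpq' : G.Adj p' q') (hne : (p', q') ≠ (p, q)) :
    (∀ a b, Valid G x y u v a b ↔ (b = q ∧ a ∈ ({p'} : Set V)) ∨ (a = p ∧ b ∈ ({q'} : Set V))) ∧
      p ∉ ({p'} : Set V) ∧ q ∉ ({q'} : Set V) := by
  have uniq := fun {c d e} => eq_of_adj_of_no_green (c := c) (d := d) (e := e) hT hp hgu hgv
  refine ⟨fun a b => ?_, ?_, ?_⟩
  · rw [valid_iff_cross hc hT hp hgu hgv hpu hqv hpq hp' hq' hpq' hne]
    simp only [Set.mem_singleton_iff, and_comm]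
  · rintro rfl
    exact hne (by rw [uniq (Or.inl hpu) (Or.inr hq') (Or.inr hqv) hpq' hpq])
  · rintro rfl
    exact hne (by rw [uniq (Or.inr hqv) (Or.inl hp') (Or.inl hpu) hpq'.symm hpq.symm])

theorem choiceH3_correct {r : Option (V × V)} (h : ChoiceH3 G x y w u v p q r) :
    Correct G x y w u v r := by
  have only := fun he a b => valid_iff_only (a := a) (b := b) hc hT hp hgu hgv hpu hqv hpq he
  have hmem : ∀ (z : V) (K : Set V), z ∉ K \ {z} := fun z K h => h.2 rfl
  cases h with
  | inner_left p' q' z h1 h2 h3 h4 =>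
    obtain ⟨h, h'⟩ := valid_sets_inner_left hc hT hp hgu hgv hpu hqv hpq h1 h2 h3
    exact (opt_left_iff h h' (Set.notMem_empty _)).2 ⟨h4, by simp⟩
  | inner_right p' q' z h1 h2 h3 h4 =>
    obtain ⟨h, h'⟩ := valid_sets_inner_right hc hT hp hgu hgv hpu hqv hpq h1 h2 h3
    exact (opt_right_iff h (Set.notMem_empty _) h').2 ⟨h4, by simp⟩
  | cross_left p' q' h1 h2 h3 h4 h5 =>
    obtain ⟨h, h', h''⟩ := valid_sets_cross hc hT hp hgu hgv hpu hqv hpq h1 h2 h3 h4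
    exact (opt_left_iff h h' h'').2 ⟨⟨rfl, by rintro t rfl; rfl⟩, by rintro b rfl; exact h5⟩
  | cross_right p' q' h1 h2 h3 h4 h5 =>
    obtain ⟨h, h', h''⟩ := valid_sets_cross hc hT hp hgu hgv hpu hqv hpq h1 h2 h3 h4
    exact (opt_right_iff h h' h'').2 ⟨⟨rfl, by rintro t rfl; rfl⟩, by rintro b rfl; exact h5⟩
  | failed h1 h2 h3 =>
    intro a b h
    rw [only h1, h2, h3] at h
    simp at h
  | only_left z h1 h2 h3 =>
    exact (opt_left_iff (only h1) (hmem _ _) (hmem _ _)).2 ⟨h2, by simp [h3]⟩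
  | only_right z h1 h2 h3 =>
    exact (opt_right_iff (only h1) (hmem _ _) (hmem _ _)).2 ⟨h3, by simp [h2]⟩
  | both_left z z' h1 h2 h3 h4 =>
    exact (opt_left_iff (only h1) (hmem _ _) (hmem _ _)).2
      ⟨h2, fun b hb => h4.trans (add_le_add_right (h3.2 b hb) _)⟩
  | both_right z z' h1 h2 h3 h4 =>
    exact (opt_right_iff (only h1) (hmem _ _) (hmem _ _)).2
      ⟨h3, fun a ha => h4.trans (add_le_add_left (h2.2 a ha) _)⟩

/-- The list of valid pairs is correct for any edge `pq` between the sets. So an optimal pair can be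
reached whichever edge the procedure starts from. -/
theorem choiceH3_of_opt {a b : V} (hopt : Opt G x y w u v a b) :
    ChoiceH3 G x y w u v p q (some (a, b)) := by
  have hmem : ∀ (z : V) (K : Set V), z ∉ K \ {z} := fun z K h => h.2 rfl
  rcases exists_edge_of_ne hp hpu hqv hpq with ⟨p', h1, q', h2, h3⟩ | ⟨p', h1, q', h2, h3⟩ |
      ⟨p', h1, q', h2, h3, h4⟩ | he
  · obtain ⟨h, h'⟩ := valid_sets_inner_left hc hT hp hgu hgv hpu hqv hpq h1 h2 h3
    obtain ⟨rfl, -⟩ := ((h _ _).1 hopt.valid).resolve_right (by simp)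
    exact .inner_left p' q' a h1 h2 h3 ((opt_left_iff h h' (Set.notMem_empty _)).1 hopt).1
  · obtain ⟨h, h'⟩ := valid_sets_inner_right hc hT hp hgu hgv hpu hqv hpq h1 h2 h3
    obtain ⟨rfl, -⟩ := ((h _ _).1 hopt.valid).resolve_left (by simp)
    exact .inner_right p' q' b h1 h2 h3 ((opt_right_iff h (Set.notMem_empty _) h').1 hopt).1
  · obtain ⟨h, h', h''⟩ := valid_sets_cross hc hT hp hgu hgv hpu hqv hpq h1 h2 h3 h4
    rcases (h _ _).1 hopt.valid with ⟨rfl, rfl⟩ | ⟨rfl, rfl⟩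
    · exact .cross_left a q' h1 h2 h3 h4 (((opt_left_iff h h' h'').1 hopt).2 _ rfl)
    · exact .cross_right p' b h1 h2 h3 h4 (((opt_right_iff h h' h'').1 hopt).2 _ rfl)
  · have only := fun a b => valid_iff_only (a := a) (b := b) hc hT hp hgu hgv hpu hqv hpq he
    have hsing : ∀ {K : Set V} {p : V}, p ∈ K → K \ {p} = ∅ → K = {p} := fun hp h =>
      Set.Subset.antisymm (Set.sdiff_eq_empty.1 h) (Set.singleton_subset_iff.2 hp)
    rcases (only _ _).1 hopt.valid with ⟨rfl, -⟩ | ⟨rfl, -⟩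
    · have h1 := (opt_left_iff only (hmem _ _) (hmem _ _)).1 hopt
      rcases (T G x y v \ {b}).eq_empty_or_nonempty with h2 | h2
      · exact .only_left a he h1.1 (hsing hqv h2)
      · obtain ⟨z', hz'⟩ := exists_isBest w v h2
        exact .both_left a z' he h1.1 hz' (h1.2 z' hz'.1)
    · have h1 := (opt_right_iff only (hmem _ _) (hmem _ _)).1 hopt
      rcases (T G x y u \ {a}).eq_empty_or_nonempty with h2 | h2
      · exact .only_right b he (hsing hpu h2) h1.1
      · obtain ⟨z', hz'⟩ := exists_isBest w u h2
        exact .both_right z' b he hz' h1.1 (h1.2 z' hz'.1)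

omit hgu hgv hpu hqv hpq

theorem stepH_correct {r : Option (V × V)} (h : StepH G x y w u v r) : Correct G x y w u v r := by
  have hswap : ∀ r : Option (V × V), Correct G x y w v u r → Correct G x y w u v (r.map Prod.swap)
    | some (a, b), h => Opt.symm h
    | none, h => fun a b hab => h b a hab.symm
  cases h with
  | h1 a b ha hb h =>
    have key := fun {a' b'} => valid_iff_h1 (a' := a') (b' := b') hc hT hp ha hb
    exact (opt_of_iff_right (K := {b}) fun a' b' => key.trans (by simp [h])).2
      ⟨rfl, by rintro t rfl; rfl⟩
  | h1_failed a b ha hb h => exact fun a' b' h' => h ((valid_iff_h1 hc hT hp ha hb).1 h').2.2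
  | h2_left a b ha hb h h' => exact (choiceH2_iff hc hT hp ha hb h).1 h'
  | h2_left_failed a ha hb h => exact fun a' b' h' => h (condH2_of_valid hc hT hp ha h')
  | h2_right a b ha hb h h' =>
    exact hswap (some (b, a)) ((choiceH2_iff hc hT hp.symm hb ha h).1 h')
  | h2_right_failed b ha hb h => exact fun a' b' h' => h (condH2_of_valid hc hT hp.symm hb h'.symm)
  | h3 p q r hgu hgv hpu hqv hpq h => exact choiceH3_correct hc hT hp hgu hgv hpu hqv hpq h

/-- This converse of `stepH_correct` lets an optimal pair computed in another way count as a result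
of the step. -/
theorem stepH_of_opt {a b : V} (h : Opt G x y w u v a b) : StepH G x y w u v (some (a, b)) := by
  have hleft : ∀ {u v a b}, Paired G x y u v → Opt G x y w u v a b → (∃ a, Green G x y u a) →
      (∀ t, ¬ Green G x y v t) → StepH G x y w u v (some (a, b)) := by
    rintro u v a b hp h ⟨a', ha⟩ hv
    have hcond := condH2_of_valid hc hT hp ha h.valid
    obtain rfl := valid_green_left hT.2.1 hp h.valid ha
    exact .h2_left a' b ha hv hcond ((choiceH2_iff hc hT hp ha hv hcond).2 h)
  by_cases hu : ∃ a, Green G x y u a <;> by_cases hv : ∃ b, Green G x y v b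
  · obtain ⟨a', ha⟩ := hu
    obtain ⟨b', hb⟩ := hv
    obtain ⟨rfl, rfl, hcond⟩ := (valid_iff_h1 hc hT hp ha hb).1 h.valid
    exact .h1 _ _ ha hb hcond
  · exact hleft hp h hu (not_exists.1 hv)
  · exact stepH_swap (hleft hp.symm h.symm hv (not_exists.1 hu))
  · obtain ⟨p, hpu, q, hqv, hpq⟩ := hp.2.2.2
    exact .h3 p q _ (not_exists.1 hu) (not_exists.1 hv) hpu hqv hpq
      (choiceH3_of_opt hc hT hp (not_exists.1 hu) (not_exists.1 hv) hpu hqv hpq h)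

end StepH

/-! ### Colorings correspond to valid selections -/

section Selections

variable {V : Type*} {G : SimpleGraph V} {x y : V}

/-- The endpoints of the edges that the procedure returns if it chooses `τ u` for `u` in `S₂`. -/
def black (G : SimpleGraph V) (x y : V) (τ : V → V) : Set V :=
  {z | lv G x y z = 0 ∨ lv G x y z = 2 ∨ (lv G x y z = 4 ∧ Dbl G x y z) ∨
    ∃ u ∈ S2 G x y, z = τ u}

/-- The choices `τ u` are compatible with all edges. -/
structure ValidSelection (G : SimpleGraph V) (x y : V) (τ : V → V) : Prop where
  isolated : ∀ u, IsolatedT G x y u → Valid G x y u u (τ u) (τ u)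
  paired : ∀ u v, Paired G x y u v → Valid G x y u v (τ u) (τ v)

theorem isolated_or_paired {u : V} (hu : u ∈ S2 G x y) :
    IsolatedT G x y u ∨ ∃ v, Paired G x y u v := by
  by_cases h : ∃ v, Paired G x y u v
  · exact Or.inr h
  · exact Or.inl ⟨hu, not_exists.1 h⟩

theorem ValidSelection.mem_T {τ : V → V} (h : ValidSelection G x y τ) {u : V}
    (hu : u ∈ S2 G x y) : τ u ∈ T G x y u :=
  (isolated_or_paired hu).elim (fun hi => (h.isolated u hi).left)
    fun ⟨v, hp⟩ => (h.paired u v hp).left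

theorem ValidSelection.cover {τ : V → V} (h : ValidSelection G x y τ) {u c d : V}
    (hu : u ∈ S2 G x y) (hc : c ∈ T G x y u) (hd : d ∈ level G x y 3 ∪ S4 G x y)
    (hcd : G.Adj c d) : c ∈ black G x y τ ∨ d ∈ black G x y τ := by
  have hb : ∀ v ∈ S2 G x y, τ v ∈ black G x y τ := fun v hv => Or.inr (Or.inr (Or.inr ⟨v, hv, rfl⟩))
  rcases isolated_or_paired hu with hi | ⟨v, hp⟩
  · rcases (h.isolated u hi).cover c (Or.inl hc) d hd hcd with rfl | rfl | rfl | rfl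
    · exact Or.inl (hb u hu)
    · exact Or.inl (hb u hu)
    · exact Or.inr (hb u hu)
    · exact Or.inr (hb u hu)
  · rcases (h.paired u v hp).cover c (Or.inl hc) d hd hcd with rfl | rfl | rfl | rfl
    · exact Or.inl (hb u hu)
    · exact Or.inl (hb v hp.2.1)
    · exact Or.inr (hb u hu)
    · exact Or.inr (hb v hp.2.1)

variable [Finite V]

/-- Let `τ u` be the partner of `u`. Edges into S₃ ∪ S₄ force their other end to be black, and all
black vertices outside N₃ are determined by the levels. -/
theorem IsColor.exists_selection {B : Set V} (hB : IsColor G x y B) (hp : PathTests G x y) :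
    ∃ τ, ValidSelection G x y τ ∧ B = black G x y τ := by
  classical
  have hex := fun u (hu : u ∈ S2 G x y) => hB.exists_partner hp.level_five hp.level_four hu
  choose! τ hτ hτB using hex
  have huniq : ∀ u ∈ S2 G x y, ∀ z ∈ T G x y u, z ∈ B → z = τ u := fun u hu z hz h =>
    hB.partner_unique hu hz h (hτ u hu) (hτB u hu)
  have hblack : ∀ c d, G.Adj c d → d ∈ level G x y 3 ∪ S4 G x y → c ∉ B →
      d ∉ S3 G x y ∪ S4 G x y := fun c d hcd hd hc h =>
    hB.S_white hp.level_five hp.level_four h ((hB.cover c d hcd).resolve_left hc)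
  refine ⟨τ, ⟨fun u hi => ?_, fun u v hpr => ?_⟩, ?_⟩
  · refine ⟨hτ u hi.1, hτ u hi.1, G.irrefl, fun c hc d hd hcd => ?_⟩
    rw [Set.union_self] at hc
    by_cases hcB : c ∈ B
    · exact Or.inl (huniq u hi.1 c hc hcB)
    · have hdB := (hB.cover c d hcd).resolve_left hcB
      rcases nbr_cases hB.conn hi.1 hc hd hcd with h | h | ⟨v, h, -⟩
      · exact absurd h (hblack c d hcd hd hcB)
      · exact Or.inr (Or.inr (Or.inl (huniq u hi.1 d h hdB)))
      · exact absurd h (hi.2 v)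
  · refine ⟨hτ u hpr.1, hτ v hpr.2.1, hB.black_not_adj (T_lv (hτ u hpr.1)) (T_lv (hτ v hpr.2.1))
      (hτB u hpr.1) (hτB v hpr.2.1), fun c hc d hd hcd => ?_⟩
    have key : ∀ {u v}, Paired G x y u v → c ∈ T G x y u →
        c = τ u ∨ c = τ v ∨ d = τ u ∨ d = τ v := by
      intro u v hpr hc
      by_cases hcB : c ∈ B
      · exact Or.inl (huniq u hpr.1 c hc hcB)
      · have hdB := (hB.cover c d hcd).resolve_left hcB
        rcases nbr_cases hB.conn hpr.1 hc hd hcd with h | h | ⟨v', h, h'⟩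
        · exact absurd h (hblack c d hcd hd hcB)
        · exact Or.inr (Or.inr (Or.inl (huniq u hpr.1 d h hdB)))
        · obtain rfl := hp.pairs u v v' hpr h
          exact Or.inr (Or.inr (Or.inr (huniq v hpr.2.1 d h' hdB)))
    rcases hc with hc | hc
    · exact key hpr hc
    · have := key hpr.symm hc
      tauto
  · ext z
    constructor
    · intro hz
      have h4 := lv_le_four hB.conn hp.level_five z
      have h1 : lv G x y z ≠ 1 := fun h => hB.level_one h hz
      by_cases h3 : lv G x y z = 3
      · rcases level_three_cases hB.conn h3 with h | ⟨u, hu, h⟩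
        · exact absurd hz (hB.S3_white hp.level_five hp.level_four h)
        · exact Or.inr (Or.inr (Or.inr ⟨u, hu, huniq u hu z h hz⟩))
      · by_cases h4 : lv G x y z = 4
        · exact Or.inr (Or.inr (Or.inl ⟨h4, (hB.mem_level_four hp.level_five hp.level_four h4).1 hz⟩))
        · have : lv G x y z = 0 ∨ lv G x y z = 2 := by omega
          exact this.imp id Or.inl
    · rintro (h | h | ⟨h, h'⟩ | ⟨u, hu, rfl⟩)
      · exact hB.level_zero h
      · exact hB.level_two h
      · exact (hB.mem_level_four hp.level_five hp.level_four h).2 h'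
      · exact hτB u hu

variable (hc : G.Connected) {τ : V → V} (hτ : ValidSelection G x y τ)

include hc hτ

/-- A vertex `τ u` sees no black vertex but `u`: `T u` avoids the other vertices of N₂ and the ends
of edges in N₄, and validity keeps it apart from every other `τ v`. The remaining black vertices are
in levels 0, 2 and 4, between which there are no edges. -/
theorem black_adj_cases {a b : V} (ha : a ∈ black G x y τ) (hb : b ∈ black G x y τ)
    (hab : G.Adj a b) : (lv G x y a = lv G x y b ∧ lv G x y a ≠ 3) ∨
      (a ∈ S2 G x y ∧ b = τ a) ∨ (b ∈ S2 G x y ∧ a = τ b) := by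
  have hl := lv_adj_cases (x := x) (y := y) hc hab
  have key : ∀ z u, u ∈ S2 G x y → G.Adj (τ u) z → z ∈ black G x y τ → z = u := by
    intro z u hu hadj hz
    have hu3 := T_lv (hτ.mem_T hu)
    have hl := lv_adj_cases (x := x) (y := y) hc hadj
    obtain ⟨-, -, h1, h2⟩ := (DimCheck.mem_T hu).1 (hτ.mem_T hu)
    rcases hz with h | h | ⟨h, h'⟩ | ⟨v, hv, rfl⟩
    · omega
    · by_cases hd : Dbl G x y z
      · exact absurd hadj (h2 z (Or.inl h) hd)
      · exact h1 z (mem_S2.2 ⟨h, hd⟩) hadj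
    · exact absurd hadj (h2 z (Or.inr h) h')
    · exfalso
      have huv : u ≠ v := by
        rintro rfl
        exact G.irrefl hadj
      exact (hτ.paired u v ⟨hu, hv, huv, _, hτ.mem_T hu, _, hτ.mem_T hv, hadj⟩).not_adj hadj
  by_cases ha3 : ∃ u ∈ S2 G x y, a = τ u
  · obtain ⟨u, hu, rfl⟩ := ha3
    obtain rfl := key b u hu hab hb
    exact Or.inr (Or.inr ⟨hu, rfl⟩)
  · by_cases hb3 : ∃ u ∈ S2 G x y, b = τ u
    · obtain ⟨u, hu, rfl⟩ := hb3
      obtain rfl := key a u hu hab.symm ha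
      exact Or.inr (Or.inl ⟨hu, rfl⟩)
    · left
      have h1 : lv G x y a = 0 ∨ lv G x y a = 2 ∨ lv G x y a = 4 := by
        rcases ha with h | h | h | h
        · exact Or.inl h
        · exact Or.inr (Or.inl h)
        · exact Or.inr (Or.inr h.1)
        · exact absurd h ha3
      have h2 : lv G x y b = 0 ∨ lv G x y b = 2 ∨ lv G x y b = 4 := by
        rcases hb with h | h | h | h
        · exact Or.inl h
        · exact Or.inr (Or.inl h)
        · exact Or.inr (Or.inr h.1)
        · exact absurd h hb3
      omega

/-- White vertices lie in N₁, N₃ or S₄. N₁ and S₃ ∪ S₄ are stable by the tests, N₁ sees neither N₃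
nor S₄, and edges at a set `T u` are covered by validity. -/
theorem isColor_black (hadj : G.Adj x y) (hB : TestB G x y) : IsColor G x y (black G x y τ) := by
  have hle := lv_le_four hc hB.level_five
  have hx : lv G x y x = 0 := (lv_zero_iff hc).2 (Or.inl rfl)
  have hy : lv G x y y = 0 := (lv_zero_iff hc).2 (Or.inr rfl)
  refine ⟨⟨fun a b hab => ?_, fun a ha => ?_, fun a ha b hb c hcb hab hac => ?_⟩,
    hc, hadj, Or.inl hx, Or.inl hy⟩
  · by_contra hn
    rw [not_or] at hn
    have hlev : ∀ z, z ∉ black G x y τ → lv G x y z ≠ 1 → z ∈ level G x y 3 ∪ S4 G x y := by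
      intro z hz h1
      have h0 : lv G x y z ≠ 0 := fun h => hz (Or.inl h)
      have h2 : lv G x y z ≠ 2 := fun h => hz (Or.inr (Or.inl h))
      have := hle z
      by_cases h3 : lv G x y z = 3
      · exact Or.inl h3
      · have h4 : lv G x y z = 4 := by omega
        exact Or.inr (mem_S4.2 ⟨h4, fun h => hz (Or.inr (Or.inr (Or.inl ⟨h4, h⟩)))⟩)
    have hl := lv_adj_cases (x := x) (y := y) hc hab
    by_cases ha1 : lv G x y a = 1
    · have h0 : lv G x y b ≠ 0 := fun h => hn.2 (Or.inl h)
      have h2 : lv G x y b ≠ 2 := fun h => hn.2 (Or.inr (Or.inl h))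
      exact hB.level_one ha1 (show lv G x y b = 1 by omega) hab.ne hab
    · by_cases hb1 : lv G x y b = 1
      · have h0 : lv G x y a ≠ 0 := fun h => hn.1 (Or.inl h)
        have h2 : lv G x y a ≠ 2 := fun h => hn.1 (Or.inr (Or.inl h))
        omega
      · have ha := hlev a hn.1 ha1
        have hb := hlev b hn.2 hb1
        rcases level_cases hc ha with ha' | ⟨u, hu, ha'⟩
        · rcases level_cases hc hb with hb' | ⟨u, hu, hb'⟩
          · exact hB.stable ha' hb' hab.ne hab
          · exact (hτ.cover hu hb' ha hab.symm).elim hn.2 hn.1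
        · exact (hτ.cover hu ha' hb hab).elim hn.1 hn.2
  · rcases ha with h | h | ⟨h, h'⟩ | ⟨u, hu, rfl⟩
    · rcases (lv_zero_iff hc).1 h with rfl | rfl
      · exact ⟨y, Or.inl hy, hadj⟩
      · exact ⟨x, Or.inl hx, hadj.symm⟩
    · by_cases hd : Dbl G x y a
      · obtain ⟨b, hab, hb⟩ := hd
        exact ⟨b, Or.inr (Or.inl (hb.trans h)), hab⟩
      · have ha : a ∈ S2 G x y := mem_S2.2 ⟨h, hd⟩
        exact ⟨τ a, Or.inr (Or.inr (Or.inr ⟨a, ha, rfl⟩)), T_adj (hτ.mem_T ha)⟩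
    · obtain ⟨b, hab, hb⟩ := h'
      exact ⟨b, Or.inr (Or.inr (Or.inl ⟨hb.trans h, a, hab.symm, hb.symm⟩)), hab⟩
    · exact ⟨u, Or.inr (Or.inl (mem_S2.1 hu).1), SimpleGraph.Adj.symm (T_adj (hτ.mem_T hu))⟩
  · have hT3 := fun {u} (hu : u ∈ S2 G x y) => T_lv (hτ.mem_T hu)
    have hS := fun {u} (hu : u ∈ S2 G x y) => mem_S2.1 hu
    rcases black_adj_cases hc hτ ha hb hab with ⟨h1, h3⟩ | ⟨hu, rfl⟩ | ⟨hu, h1⟩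
    · rcases black_adj_cases hc hτ ha hcb hac with ⟨h2, -⟩ | ⟨hv, rfl⟩ | ⟨hv, h2⟩
      · rcases ha with h | h | ⟨h, h'⟩ | ⟨u, hu, rfl⟩
        · have hb0 := (lv_zero_iff hc).1 (h1.symm.trans h)
          have hc0 := (lv_zero_iff hc).1 (h2.symm.trans h)
          have k1 := hab.ne
          have k2 := hac.ne
          rcases (lv_zero_iff hc).1 h with rfl | rfl
          · exact (hb0.resolve_left k1.symm).trans (hc0.resolve_left k2.symm).symm
          · exact (hb0.resolve_right k1.symm).trans (hc0.resolve_right k2.symm).symm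
        · exact hB.level_two a h b (h1.symm.trans h) c (h2.symm.trans h) hab hac
        · exact hB.level_four a h b (h1.symm.trans h) c (h2.symm.trans h) hab hac
        · exact absurd (hT3 hu) h3
      · exact absurd ⟨b, hab, h1.symm⟩ (hS hv).2
      · rw [h2] at h3
        exact absurd (hT3 hv) h3
    · rcases black_adj_cases hc hτ ha hcb hac with ⟨h2, -⟩ | ⟨hv, rfl⟩ | ⟨hv, h2⟩
      · exact absurd ⟨c, hac, h2.symm⟩ (hS hu).2
      · rfl
      · have h3 := hT3 hv
        rw [← h2, (hS hu).1] at h3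
        omega
    · have h3 := hT3 hu
      rw [← h1] at h3
      rcases black_adj_cases hc hτ ha hcb hac with ⟨h2, h4⟩ | ⟨hv, rfl⟩ | ⟨hv, h2⟩
      · exact absurd h3 h4
      · have := (hS hv).1
        omega
      · have h5 := hτ.mem_T hu
        rw [← h1] at h5
        have h6 := hτ.mem_T hv
        rw [← h2] at h6
        exact T_unique hu hv h5 h6

theorem edgesIn_black (hadj : G.Adj x y) (hle : ∀ z, lv G x y z ≤ 4) :
    edgesIn G (black G x y τ) =
      {s(x, y)} ∪ M2 G x y ∪ M4 G x y ∪ {e | ∃ u ∈ S2 G x y, e = s(u, τ u)} := by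
  have hx : lv G x y x = 0 := (lv_zero_iff hc).2 (Or.inl rfl)
  have hy : lv G x y y = 0 := (lv_zero_iff hc).2 (Or.inr rfl)
  ext e
  induction e using Sym2.ind with
  | _ a b =>
    simp only [Set.mem_union, M2, M4, mem_edgesIn, Set.mem_singleton_iff, Set.mem_ofPred_eq]
    constructor
    · rintro ⟨hab, ha, hb⟩
      rcases black_adj_cases hc hτ ha hb hab with ⟨h1, h3⟩ | ⟨hu, rfl⟩ | ⟨hu, h1⟩
      · have h02 : lv G x y a = 0 ∨ lv G x y a = 2 ∨ lv G x y a = 4 := by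
          rcases ha with h | h | h | ⟨u, hu, rfl⟩
          · exact Or.inl h
          · exact Or.inr (Or.inl h)
          · exact Or.inr (Or.inr h.1)
          · exact absurd (T_lv (hτ.mem_T hu)) h3
        rcases h02 with h | h | h
        · left; left; left
          have h1 := (lv_zero_iff hc).1 (h1.symm.trans h)
          have h2 := hab.ne
          rcases (lv_zero_iff hc).1 h with rfl | rfl
          · rw [h1.resolve_left h2.symm]
          · rw [h1.resolve_right h2.symm, Sym2.eq_swap]
        · left; left; right
          exact ⟨hab, h, h1.symm.trans h⟩
        · left; right
          exact ⟨hab, h, h1.symm.trans h⟩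
      · exact Or.inr ⟨a, hu, rfl⟩
      · exact Or.inr ⟨b, hu, by rw [h1, Sym2.eq_swap]⟩
    · have hmk : ∀ c d, s(a, b) = s(c, d) → G.Adj c d → c ∈ black G x y τ → d ∈ black G x y τ →
          G.Adj a b ∧ a ∈ black G x y τ ∧ b ∈ black G x y τ := by
        intro c d h hcd hc hd
        rcases Sym2.eq_iff.1 h with ⟨rfl, rfl⟩ | ⟨rfl, rfl⟩
        · exact ⟨hcd, hc, hd⟩
        · exact ⟨hcd.symm, hd, hc⟩
      rintro (((h | ⟨hab, ha, hb⟩) | ⟨hab, ha, hb⟩) | ⟨u, hu, h⟩)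
      · exact hmk x y h hadj (Or.inl hx) (Or.inl hy)
      · exact ⟨hab, Or.inr (Or.inl ha), Or.inr (Or.inl hb)⟩
      · rw [mem_level] at ha hb
        exact ⟨hab, Or.inr (Or.inr (Or.inl ⟨ha, b, hab, hb.trans ha.symm⟩)),
          Or.inr (Or.inr (Or.inl ⟨hb, a, hab.symm, ha.trans hb.symm⟩))⟩
      · exact hmk u (τ u) h (T_adj (hτ.mem_T hu)) (Or.inr (Or.inl (mem_S2.1 hu).1))
          (Or.inr (Or.inr (Or.inr ⟨u, hu, rfl⟩)))

-- The weight splits into a part common to all d.i.m.'s containing `xy` and one summand for each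
-- vertex of S₂.
omit hc in
theorem totalWeight_black (w : Sym2 V → Weight) (S : Finset V) (hS : ∀ u, u ∈ S ↔ u ∈ S2 G x y)
    (F : Finset (Sym2 V)) (hF : (F : Set (Sym2 V)) = {s(x, y)} ∪ M2 G x y ∪ M4 G x y)
    (hc : G.Connected)
    (M : Finset (Sym2 V)) (hM : (M : Set (Sym2 V)) =
      {s(x, y)} ∪ M2 G x y ∪ M4 G x y ∪ {e | ∃ u ∈ S2 G x y, e = s(u, τ u)}) :
    totalWeight w M = ∑ e ∈ F, w e + ∑ u ∈ S, w s(u, τ u) := by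
  classical
  have hx : lv G x y x = 0 := (lv_zero_iff hc).2 (Or.inl rfl)
  have hy : lv G x y y = 0 := (lv_zero_iff hc).2 (Or.inr rfl)
  have hMF : M = F ∪ S.image fun u => s(u, τ u) := by
    rw [← Finset.coe_inj, hM, ← hF, Finset.coe_union]
    congr 1
    ext e
    simp [hS, eq_comm]
  -- The edges in `F` have no end in N₃, whereas `τ u` is in N₃.
  have hdisj : Disjoint F (S.image fun u => s(u, τ u)) := by
    rw [Finset.disjoint_left]
    intro e he he'
    obtain ⟨u, hu, rfl⟩ := Finset.mem_image.1 he'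
    have h3 := T_lv (hτ.mem_T ((hS u).1 hu))
    rw [← Finset.mem_coe, hF] at he
    rcases he with (he | he) | he
    · rcases Sym2.eq_iff.1 (Set.mem_singleton_iff.1 he) with ⟨-, h⟩ | ⟨-, h⟩ <;> rw [h] at h3 <;> omega
    · have := mem_level.1 (mem_edgesIn.1 he).2.2
      omega
    · have := mem_level.1 (mem_edgesIn.1 he).2.2
      omega
  have hinj : Set.InjOn (fun u => s(u, τ u)) S := by
    intro u hu v hv h
    rcases Sym2.eq_iff.1 h with h | h
    · exact h.1
    · have h1 := T_lv (hτ.mem_T ((hS v).1 hv))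
      have h2 := (mem_S2.1 ((hS u).1 hu)).1
      rw [← h.1] at h1
      omega
  rw [totalWeight, hMF, Finset.sum_union hdisj, Finset.sum_image hinj]

end Selections

/-- Halving is harmless even with `∞`: if `b` is finite, then `a + a` is finite and so is `a`. -/
theorem Weight.le_of_add_self_le {a b : Weight} (h : a + a ≤ b + b) : a ≤ b := by
  induction b using WithTop.recTopCoe with
  | top => exact le_top
  | coe b =>
    induction a using WithTop.recTopCoe with
    | top => exact absurd h (by rw [← WithTop.coe_add]; simp)
    | coe a =>
      norm_cast at h ⊢
      linarith

/-- Summing `f u + f (π u)` counts everything twice, so inequalities for pairs can be added up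
without choosing a representative of each pair. -/
theorem sum_le_sum_of_involution {ι : Type*} (S : Finset ι) (f g : ι → Weight) (π : ι → ι)
    (hπ : ∀ u ∈ S, π u ∈ S) (hππ : ∀ u ∈ S, π (π u) = u)
    (h : ∀ u ∈ S, f u + f (π u) ≤ g u + g (π u)) : ∑ u ∈ S, f u ≤ ∑ u ∈ S, g u := by
  have hsum : ∀ f : ι → Weight, ∑ u ∈ S, f (π u) = ∑ u ∈ S, f u := fun f =>
    Finset.sum_nbij' π π hπ hπ hππ hππ fun _ _ => rfl
  apply Weight.le_of_add_self_le
  have := Finset.sum_le_sum h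
  rwa [Finset.sum_add_distrib, Finset.sum_add_distrib, hsum, hsum] at this

/-! ### Correctness of the procedure -/

section Correctness

variable {V : Type*} [Finite V] {G : SimpleGraph V} {x y : V} {w : Sym2 V → Weight}
  (hc : G.Connected) (hadj : G.Adj x y)

include hc hadj

/-- The passed tests include `PathTests`, so every competing d.i.m. is given by a valid selection as
well; `P₇`-freeness plays no role here. -/
theorem check_some_correct {M : Finset (Sym2 V)} (h : Check G x y w (some M)) :
    IsMinDIMContaining G w x y M := by
  classical
  cases h with
  | success _ τ hT hiso hpair hM =>
    have hopt : ∀ u v, Paired G x y u v → Opt G x y w u v (τ u) (τ v) := fun u v hp =>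
      stepH_correct hc hT hp (hpair u v hp)
    have hiso' := fun u hi => (stepG_iff hc hT hi).1 (hiso u hi)
    have hτ : ValidSelection G x y τ := ⟨fun u hi => (hiso' u hi).1, fun u v hp => (hopt u v hp).valid⟩
    have hcol := isColor_black hc hτ hadj hT.1
    have hle := lv_le_four hc hT.1.level_five
    have hedges := edgesIn_black hc hτ hadj hle
    refine ⟨?_, ?_, fun M' hM' hxy => ?_⟩
    · rw [hM, ← hedges]
      exact hcol.isDIM
    · rw [← Finset.mem_coe, hM]
      exact Or.inl (Or.inl (Or.inl rfl))
    · obtain ⟨hB', hM'eq⟩ := hM'.dimColor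
      have hB'' : IsColor G x y {v | ∃ e ∈ (M' : Set (Sym2 V)), v ∈ e} :=
        ⟨hB', hc, hadj, ⟨_, hxy, by simp⟩, ⟨_, hxy, by simp⟩⟩
      obtain ⟨τ', hτ', hBeq⟩ := hB''.exists_selection hT.pathTests
      rw [hBeq, edgesIn_black hc hτ' hadj hle] at hM'eq
      set S := (Set.toFinite (S2 G x y)).toFinset with hS
      set F := (Set.toFinite ({s(x, y)} ∪ M2 G x y ∪ M4 G x y)).toFinset with hF
      have hSm : ∀ u, u ∈ S ↔ u ∈ S2 G x y := fun u => by simp [hS]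
      have hFm : (F : Set (Sym2 V)) = {s(x, y)} ∪ M2 G x y ∪ M4 G x y := by simp [hF]
      rw [totalWeight_black hτ w S hSm F hFm hc M hM,
        totalWeight_black hτ' w S hSm F hFm hc M' hM'eq]
      apply add_le_add_right
      -- The involution sends `u` to its partner, and to itself if `T u` is isolated.
      let π : V → V := fun u => if h : ∃ v, Paired G x y u v then h.choose else u
      have hπp : ∀ u v, Paired G x y u v → π u = v := fun u v h => by
        have hex : ∃ v, Paired G x y u v := ⟨v, h⟩
        simp only [π, dif_pos hex]
        exact hT.2.1 u _ _ hex.choose_spec h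
      have hπi : ∀ u, IsolatedT G x y u → π u = u := fun u h => by
        have hex : ¬ ∃ v, Paired G x y u v := not_exists.2 h.2
        simp only [π, dif_neg hex]
      refine sum_le_sum_of_involution S _ _ π (fun u hu => ?_) (fun u hu => ?_) fun u hu => ?_
      · rcases isolated_or_paired ((hSm u).1 hu) with hi | ⟨v, hp⟩
        · rwa [hπi u hi]
        · rw [hπp u v hp]
          exact (hSm v).2 hp.2.1
      · rcases isolated_or_paired ((hSm u).1 hu) with hi | ⟨v, hp⟩
        · rw [hπi u hi, hπi u hi]
        · rw [hπp u v hp, hπp v u hp.symm]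
      · rcases isolated_or_paired ((hSm u).1 hu) with hi | ⟨v, hp⟩
        · rw [hπi u hi]
          exact add_le_add ((hiso' u hi).2 _ (hτ'.isolated u hi))
            ((hiso' u hi).2 _ (hτ'.isolated u hi))
        · rw [hπp u v hp]
          exact (hopt u v hp).sum_le _ _ (hτ'.paired u v hp)

/-- A d.i.m. containing `xy` in a `P₇`-free graph passes all tests, and its selection is a valid
choice for every pair, so step (h) cannot fail. -/
theorem check_none_correct (hP : EdgeInP3 G x y) (h : Check G x y w none) :
    (¬ ∃ M : Set (Sym2 V), IsDIM G M ∧ s(x, y) ∈ M) ∨ ¬ P7Free G := by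
  by_contra hn
  rw [not_or, not_not, not_not] at hn
  obtain ⟨⟨M, hM, hxy⟩, h7⟩ := hn
  have hB : IsColor G x y {v | ∃ e ∈ M, v ∈ e} :=
    ⟨hM.dimColor.1, hc, hadj, ⟨_, hxy, by simp⟩, ⟨_, hxy, by simp⟩⟩
  have hp := hB.pathTests_of_P7Free hP h7
  obtain ⟨τ, hτ, -⟩ := hB.exists_selection hp
  cases h with
  | test_failed h => exact h (hB.tests hp)
  | pair_failed u v hT hpr h => exact stepH_correct hc hT hpr h _ _ (hτ.paired u v hpr)

omit hadj in
theorem exists_check : ∃ r, Check G x y w r := by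
  classical
  by_cases hT : Tests G x y
  swap
  · exact ⟨none, .test_failed hT⟩
  by_cases hf : ∃ u v, Paired G x y u v ∧ StepH G x y w u v none
  · obtain ⟨u, v, hp, h⟩ := hf
    exact ⟨none, .pair_failed u v hT hp h⟩
  push Not at hf
  have hex : ∀ u v, Paired G x y u v → ∃ r : V × V, StepH G x y w u v (some r) := by
    intro u v hp
    obtain ⟨r, hr⟩ := exists_stepH (w := w) hp
    cases r with
    | none => exact absurd hr (hf u v hp)
    | some r => exact ⟨r, hr⟩
  have hiso : ∀ u, IsolatedT G x y u → ∃ t, StepG G x y w u t := fun u hi => exists_stepG hc hT hi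
  have : Nonempty V := ⟨x⟩
  choose! r hr using hex
  choose! t ht using hiso
  obtain ⟨n, ⟨e⟩⟩ := Finite.exists_equiv_fin V
  let part : V → V := fun u => if h : ∃ v, Paired G x y u v then h.choose else u
  have hpart : ∀ u v, Paired G x y u v → part u = v := fun u v h => by
    have hex : ∃ v, Paired G x y u v := ⟨v, h⟩
    simp only [part, dif_pos hex]
    exact hT.2.1 u _ _ hex.choose_spec h
  -- Both vertices of a pair must come from the same run of step (h). The enumeration `e` of the
  -- vertices determines which order of the pair is used.
  let τ : V → V := fun u => if (∃ v, Paired G x y u v) then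
    (if e u < e (part u) then (r u (part u)).1 else (r (part u) u).2) else t u
  have hτ : ∀ u v, Paired G x y u v → StepH G x y w u v (some (τ u, τ v)) := by
    intro u v hp
    have hu : ∃ v, Paired G x y u v := ⟨v, hp⟩
    have hv : ∃ u, Paired G x y v u := ⟨u, hp.symm⟩
    simp only [τ, if_pos hu, if_pos hv, hpart u v hp, hpart v u hp.symm]
    rcases lt_or_gt_of_ne (fun h => hp.2.2.1 (e.injective h) : e u ≠ e v) with h | h
    · rw [if_pos h, if_neg h.asymm]
      exact hr u v hp
    · rw [if_pos h, if_neg h.asymm]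
      exact stepH_swap (hr v u hp.symm)
  refine ⟨some (Set.toFinite ({s(x, y)} ∪ M2 G x y ∪ M4 G x y ∪
    {e | ∃ u ∈ S2 G x y, e = s(u, τ u)})).toFinset, .success _ τ hT (fun u hi => ?_) hτ (by simp)⟩
  have : ¬ ∃ v, Paired G x y u v := not_exists.2 hi.2
  simp only [τ, if_neg this]
  exact ht u hi

/-- If `G` has no d.i.m. containing `xy`, the procedure may stop unsuccessfully. -/
theorem check_none_of_no_dim (h : ¬ ∃ B, IsColor G x y B) : Check G x y w none := by
  -- The procedure always has some result, and a successful one would itself be a d.i.m.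
  obtain ⟨r, hr⟩ := exists_check (x := x) (y := y) (w := w) hc
  cases r with
  | none => exact hr
  | some M =>
    obtain ⟨hM, hxy, -⟩ := check_some_correct hc hadj hr
    exact absurd ⟨_, hM.dimColor.1, hc, hadj, ⟨_, hxy, by simp⟩, ⟨_, hxy, by simp⟩⟩ h

/-- A selection of optimal vertices is a possible result of the procedure. -/
theorem check_some_of_selection (hT : Tests G x y) {τ : V → V}
    (hi : ∀ u, IsolatedT G x y u → Valid G x y u u (τ u) (τ u) ∧
      ∀ t, Valid G x y u u t t → w s(u, τ u) ≤ w s(u, t))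
    (hp : ∀ u v, Paired G x y u v → Opt G x y w u v (τ u) (τ v)) {M : Finset (Sym2 V)}
    (hM : (M : Set (Sym2 V)) = edgesIn G (black G x y τ)) : Check G x y w (some M) := by
  refine .success M τ hT (fun u h => (stepG_iff hc hT h).2 (hi u h))
    (fun u v h => stepH_of_opt hc hT h (hp u v h)) ?_
  rw [hM]
  exact edgesIn_black hc ⟨fun u h => (hi u h).1, fun u v h => (hp u v h).valid⟩ hadj
    (lv_le_four hc hT.1.level_five)

end Correctness

/-! ### Verification of programs -/

section Programs

/-- Weakest precondition of a program without loops. -/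
def wp : Program → (State → Prop) → State → Prop
  | .instr c, Q, s => Q (c.run s)
  | .seq p q, Q, s => wp p (wp q Q) s
  | .branch b p q, Q, s => (b.Holds s → wp p Q s) ∧ (¬ b.Holds s → wp q Q s)
  | .loop _ _, _, _ => False

/-- Upper bound for the number of steps of a program without loops. -/
def cost : Program → ℕ
  | .instr _ => 1
  | .seq p q => cost p + cost q
  | .branch _ p q => cost p + cost q + 1
  | .loop _ _ => 0

/-- Program `p` started in `s` halts after at most `c` steps in a state satisfying `Q`. -/
def Runs (p : Program) (s : State) (c : ℕ) (Q : State → Prop) : Prop :=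
  ∃ s' t, Exec p s s' t ∧ t ≤ c ∧ Q s'

theorem runs_of_wp {p : Program} {Q : State → Prop} {s : State} (h : wp p Q s) :
    Runs p s (cost p) Q := by
  induction p generalizing Q s with
  | instr c => exact ⟨_, _, .instr c s, le_rfl, h⟩
  | seq p q ihp ihq =>
    obtain ⟨s', t, hp, ht, h'⟩ := ihp h
    obtain ⟨s'', t', hq, ht', h''⟩ := ihq h'
    exact ⟨s'', _, .seq hp hq, Nat.add_le_add ht ht', h''⟩
  | branch b p q ihp ihq =>
    by_cases hb : b.Holds s
    · obtain ⟨s', t, hp, ht, h'⟩ := ihp (h.1 hb)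
      exact ⟨s', _, .branch_true hb hp, by simp only [cost]; omega, h'⟩
    · obtain ⟨s', t, hp, ht, h'⟩ := ihq (h.2 hb)
      exact ⟨s', _, .branch_false hb hp, by simp only [cost]; omega, h'⟩
  | loop b p => exact h.elim

theorem Runs.mono {p : Program} {s : State} {c c' : ℕ} {Q Q' : State → Prop} (h : Runs p s c Q)
    (hc : c ≤ c') (hQ : ∀ s', Q s' → Q' s') : Runs p s c' Q' := by
  obtain ⟨s', t, he, ht, h⟩ := h
  exact ⟨s', t, he, ht.trans hc, hQ s' h⟩

theorem Runs.seq {p q : Program} {s : State} {c c' : ℕ} {Q : State → Prop}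
    (h : Runs p s c fun s' => Runs q s' c' Q) : Runs (.seq p q) s (c + c') Q := by
  obtain ⟨s', t, he, ht, s'', t', he', ht', h⟩ := h
  exact ⟨s'', _, .seq he he', Nat.add_le_add ht ht', h⟩

theorem Runs.instr {c : Instr} {s : State} {Q : State → Prop} (h : Q (c.run s)) :
    Runs (.instr c) s 1 Q := ⟨_, _, .instr c s, le_rfl, h⟩

theorem Runs.loop_true {b : Test} {p : Program} {s : State} {c c' : ℕ} {Q : State → Prop}
    (hb : b.Holds s) (h : Runs p s c fun s' => Runs (.loop b p) s' c' Q) :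
    Runs (.loop b p) s (c + c' + 1) Q := by
  obtain ⟨s', t, he, ht, s'', t', he', ht', h⟩ := h
  exact ⟨s'', _, .loop_true hb he he', by omega, h⟩

theorem Runs.loop_false {b : Test} {p : Program} {s : State} {Q : State → Prop}
    (hb : ¬ b.Holds s) (h : Q s) : Runs (.loop b p) s 1 Q :=
  ⟨_, _, .loop_false hb, le_rfl, h⟩

/-- The number registers that a program may change. -/
def regW : Program → List ℕ
  | .instr (.const i _) => [i]
  | .instr (.copy i _) => [i]
  | .instr (.succ i) => [i]
  | .instr (.load i _ _) => [i]
  | .instr _ => []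
  | .seq p q => regW p ++ regW q
  | .branch _ p q => regW p ++ regW q
  | .loop _ p => regW p

/-- The number arrays that a program may change. -/
def arrW : Program → List ℕ
  | .instr (.store a _ _) => [a]
  | .instr _ => []
  | .seq p q => arrW p ++ arrW q
  | .branch _ p q => arrW p ++ arrW q
  | .loop _ p => arrW p

/-- The weight registers that a program may change. -/
def wregW : Program → List ℕ
  | .instr (.wcopy i _) => [i]
  | .instr (.wadd i _ _) => [i]
  | .instr (.wload i _ _) => [i]
  | .instr _ => []
  | .seq p q => wregW p ++ wregW q
  | .branch _ p q => wregW p ++ wregW q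
  | .loop _ p => wregW p

/-- The weight arrays that a program may change. -/
def warrW : Program → List ℕ
  | .instr (.wstore a _ _) => [a]
  | .instr _ => []
  | .seq p q => warrW p ++ warrW q
  | .branch _ p q => warrW p ++ warrW q
  | .loop _ p => warrW p

/-- `s'` differs from `s` at most in the cells that `p` may change. -/
structure Frame (p : Program) (s s' : State) : Prop where
  reg : ∀ i, i ∉ regW p → s'.reg i = s.reg i
  arr : ∀ a, a ∉ arrW p → s'.arr a = s.arr a
  wreg : ∀ i, i ∉ wregW p → s'.wreg i = s.wreg i
  warr : ∀ a, a ∉ warrW p → s'.warr a = s.warr a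

theorem Frame.refl (p : Program) (s : State) : Frame p s s :=
  ⟨fun _ _ => rfl, fun _ _ => rfl, fun _ _ => rfl, fun _ _ => rfl⟩

theorem Frame.trans {p : Program} {s s' s'' : State} (h : Frame p s s') (h' : Frame p s' s'') :
    Frame p s s'' :=
  ⟨fun i hi => (h'.reg i hi).trans (h.reg i hi), fun a ha => (h'.arr a ha).trans (h.arr a ha),
    fun i hi => (h'.wreg i hi).trans (h.wreg i hi), fun a ha => (h'.warr a ha).trans (h.warr a ha)⟩

theorem Frame.mono {p q : Program} {s s' : State} (h : Frame p s s') (h1 : regW p ⊆ regW q)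
    (h2 : arrW p ⊆ arrW q) (h3 : wregW p ⊆ wregW q) (h4 : warrW p ⊆ warrW q) : Frame q s s' :=
  ⟨fun i hi => h.reg i fun h => hi (h1 h), fun a ha => h.arr a fun h => ha (h2 h),
    fun i hi => h.wreg i fun h => hi (h3 h), fun a ha => h.warr a fun h => ha (h4 h)⟩

theorem Frame.seq_left {p q : Program} {s s' : State} (h : Frame p s s') : Frame (.seq p q) s s' :=
  h.mono (List.subset_append_left _ _) (List.subset_append_left _ _)
    (List.subset_append_left _ _) (List.subset_append_left _ _)

theorem Frame.seq_right {p q : Program} {s s' : State} (h : Frame q s s') :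
    Frame (.seq p q) s s' :=
  h.mono (List.subset_append_right _ _) (List.subset_append_right _ _)
    (List.subset_append_right _ _) (List.subset_append_right _ _)

theorem Frame.loop {b : Test} {p : Program} {s s' : State} (h : Frame p s s') :
    Frame (.loop b p) s s' := ⟨h.reg, h.arr, h.wreg, h.warr⟩

theorem frame_run (c : Instr) (s : State) : Frame (.instr c) s (c.run s) := by
  constructor <;> intro i hi <;> cases c <;>
    simp_all [regW, arrW, wregW, warrW, Instr.run]

/-- The written cells are read off from the syntax, so that preservation of a register or array by a
concrete program is decidable. -/
theorem Exec.frame {p : Program} {s s' : State} {t : ℕ} (h : Exec p s s' t) : Frame p s s' := by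
  induction h with
  | instr c s => exact frame_run c s
  | seq _ _ ih ih' => exact ih.seq_left.trans ih'.seq_right
  | branch_true _ _ ih =>
    exact ih.mono (List.subset_append_left _ _) (List.subset_append_left _ _)
      (List.subset_append_left _ _) (List.subset_append_left _ _)
  | branch_false _ _ ih =>
    exact ih.mono (List.subset_append_right _ _) (List.subset_append_right _ _)
      (List.subset_append_right _ _) (List.subset_append_right _ _)
  | loop_true _ _ _ ih ih' => exact ih.loop.trans ih'
  | loop_false _ => exact .refl _ _

theorem Runs.frame {p : Program} {s : State} {c : ℕ} {Q : State → Prop} (h : Runs p s c Q) :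
    Runs p s c fun s' => Frame p s s' ∧ Q s' := by
  obtain ⟨s', t, he, ht, h⟩ := h
  exact ⟨s', t, he, ht, he.frame, h⟩

end Programs

/-! ### Passes over all adjacency lists -/

section Passes

infixr:60 " ;; " => Program.seq

variable {n : ℕ} {G : SimpleGraph (Fin n)} {w : Sym2 (Fin n) → Weight} {x y : Fin n}

/-- The state contains the input and some constants. -/
structure Input (G : SimpleGraph (Fin n)) (w : Sym2 (Fin n) → Weight) (x y : Fin n)
    (s : State) : Prop where
  size : s.reg 0 = n
  fst : s.reg 1 = x
  snd : s.reg 2 = y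
  first_block : s.arr 0 0 = 0
  block_le : ∀ v : Fin n, s.arr 0 v ≤ s.arr 0 (v + 1)
  block : ∀ v : Fin n, Set.BijOn (s.arr 1) (Set.Ico (s.arr 0 v) (s.arr 0 (v + 1)))
    ((fun u : Fin n => (u : ℕ)) '' G.neighborSet v)
  weight : ∀ v u : Fin n, ∀ i ∈ Set.Ico (s.arr 0 v) (s.arr 0 (v + 1)),
    s.arr 1 i = u → s.warr 0 i = w s(v, u)
  const : ∀ k ≤ 6, s.reg (10 + k) = k

/-- The program changes neither the input nor the constants nor the control registers. -/
def Safe (p : Program) : Prop :=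
  (∀ i ∈ regW p, i = 8 ∨ i = 9 ∨ 17 ≤ i) ∧ (∀ a ∈ arrW p, 2 ≤ a) ∧ (∀ a ∈ warrW p, 1 ≤ a)

instance (p : Program) : Decidable (Safe p) := by
  unfold Safe
  infer_instance

theorem Input.of_eq {s s' : State} (h : Input G w x y s) (h0 : s'.reg 0 = s.reg 0)
    (h1 : s'.reg 1 = s.reg 1) (h2 : s'.reg 2 = s.reg 2)
    (h3 : ∀ k ≤ 6, s'.reg (10 + k) = s.reg (10 + k)) (ha0 : s'.arr 0 = s.arr 0)
    (ha1 : s'.arr 1 = s.arr 1) (hw : s'.warr 0 = s.warr 0) : Input G w x y s' := by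
  obtain ⟨i1, i2, i3, i4, i5, i6, i7, i8⟩ := h
  rw [← h0] at i1
  rw [← h1] at i2
  rw [← h2] at i3
  rw [← ha0] at i4 i5 i6 i7
  rw [← ha1] at i6 i7
  rw [← hw] at i7
  exact ⟨i1, i2, i3, i4, i5, i6, i7, fun k hk => (h3 k hk).trans (i8 k hk)⟩

/-- The control structure for scanning all adjacency lists: `v` is in register 3, `v + 1` in
register 4, the position in the lists in register 6, the current neighbor of `v` in register 7. -/
def pass (pre body post : Program) : Program :=
  .instr (.const 3 0) ;; .instr (.const 6 0) ;;
  .loop (.lt 3 0)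
    (.instr (.copy 4 3) ;; .instr (.succ 4) ;; .instr (.load 5 0 4) ;; pre ;;
      .loop (.lt 6 5) (.instr (.load 7 1 6) ;; body ;; .instr (.succ 6)) ;;
      post ;; .instr (.succ 3))

/-- The number of steps of a pass, per vertex or list entry. -/
def passCost (pre body post : Program) : ℕ := cost pre + cost body + cost post + 9

theorem Input.of_frame {pre body post : Program} {s s' : State} (h : Input G w x y s)
    (hpre : Safe pre) (hbody : Safe body) (hpost : Safe post)
    (hf : Frame (pass pre body post) s s') : Input G w x y s' := by
  have hreg : ∀ i, i < 3 ∨ (10 ≤ i ∧ i < 17) → s'.reg i = s.reg i := by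
    intro i hi
    apply hf.reg
    have h1 : i ∉ regW pre := fun h => by have := hpre.1 i h; omega
    have h2 : i ∉ regW body := fun h => by have := hbody.1 i h; omega
    have h3 : i ∉ regW post := fun h => by have := hpost.1 i h; omega
    simp [pass, regW, h1, h2, h3]
    omega
  have harr : ∀ a, a < 2 → s'.arr a = s.arr a := by
    intro a ha
    apply hf.arr
    have h1 : a ∉ arrW pre := fun h => by have := hpre.2.1 a h; omega
    have h2 : a ∉ arrW body := fun h => by have := hbody.2.1 a h; omega
    have h3 : a ∉ arrW post := fun h => by have := hpost.2.1 a h; omega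
    simp [pass, arrW, h1, h2, h3]
  have hwarr : ∀ a, a < 1 → s'.warr a = s.warr a := by
    intro a ha
    apply hf.warr
    have h1 : a ∉ warrW pre := fun h => by have := hpre.2.2 a h; omega
    have h2 : a ∉ warrW body := fun h => by have := hbody.2.2 a h; omega
    have h3 : a ∉ warrW post := fun h => by have := hpost.2.2 a h; omega
    simp [pass, warrW, h1, h2, h3]
  exact h.of_eq (hreg 0 (by omega)) (hreg 1 (by omega)) (hreg 2 (by omega))
    (fun k hk => hreg _ (by omega)) (harr 0 (by omega)) (harr 1 (by omega)) (hwarr 0 (by omega))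

theorem Safe.reg_eq {p : Program} (hp : Safe p) {s s' : State} (hf : Frame p s s') {i : ℕ}
    (hi : i < 8) : s'.reg i = s.reg i :=
  hf.reg i fun h => by
    have := hp.1 i h
    omega

-- `I` is the invariant between vertices, `J` the one inside the list of a vertex, where `D` is the
-- set of neighbors already handled. The list position in register 6 is never reset within a pass,
-- so the body runs once per list entry in total, which makes the pass linear. The frame hypotheses
-- spare the invariants all unchanged cells.
open Classical in
theorem pass_rule {pre body post : Program} {s₀ : State} (hin : Input G w x y s₀)
    (hpre : Safe pre) (hbody : Safe body) (hpost : Safe post)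
    (I : ℕ → State → Prop) (J : Fin n → Finset (Fin n) → State → Prop)
    (h_init : wp (.instr (.const 3 0) ;; .instr (.const 6 0)) (I 0) s₀)
    (h_pre : ∀ (v : Fin n) (s : State), Input G w x y s → Frame (pass pre body post) s₀ s →
      s.reg 3 = v → I v s →
      wp (.instr (.copy 4 3) ;; .instr (.succ 4) ;; .instr (.load 5 0 4) ;; pre) (J v ∅) s)
    (h_body : ∀ (v b : Fin n) (D : Finset (Fin n)) (s : State), Input G w x y s →
      Frame (pass pre body post) s₀ s → s.reg 3 = v → s.reg 4 = v + 1 → s.arr 1 (s.reg 6) = b →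
      s.warr 0 (s.reg 6) = w s(v, b) → G.Adj v b → b ∉ D → J v D s →
      wp (.instr (.load 7 1 6) ;; body ;; .instr (.succ 6)) (J v (insert b D)) s)
    (h_post : ∀ (v : Fin n) (s : State), Input G w x y s → Frame (pass pre body post) s₀ s →
      s.reg 3 = v → s.reg 4 = v + 1 → J v {b | G.Adj v b} s →
      wp (post ;; .instr (.succ 3)) (I (v + 1)) s) :
    Runs (pass pre body post) s₀ (passCost pre body post * (n + s₀.arr 0 n) + 3)
      fun s => Input G w x y s ∧ Frame (pass pre body post) s₀ s ∧ I n s := by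
  set P := pass pre body post with hP
  have hinput := fun {s} (hf : Frame P s₀ s) => hin.of_frame hpre hbody hpost hf
  have harr0 : ∀ {s}, Frame P s₀ s → s.arr 0 = s₀.arr 0 ∧ s.arr 1 = s₀.arr 1 := by
    intro s hf
    have key : ∀ a < 2, a ∉ arrW P := by
      intro a ha
      have h1 : a ∉ arrW pre := fun h => by have := hpre.2.1 a h; omega
      have h2 : a ∉ arrW body := fun h => by have := hbody.2.1 a h; omega
      have h3 : a ∉ arrW post := fun h => by have := hpost.2.1 a h; omega
      simp [hP, pass, arrW, h1, h2, h3]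
    exact ⟨hf.arr 0 (key 0 (by omega)), hf.arr 1 (key 1 (by omega))⟩
  set off := s₀.arr 0 with hoff
  set dst := s₀.arr 1 with hdst
  -- The neighbors found in the list of `v` before position `i`.
  let Dn : Fin n → ℕ → Finset (Fin n) := fun v i =>
    {b | ∃ k, off v ≤ k ∧ k < i ∧ dst k = b}
  -- the inner loop
  have hinner : ∀ (v : Fin n) (d i : ℕ) (s : State), i + d = off (v + 1) → off v ≤ i →
      Frame P s₀ s → s.reg 3 = v → s.reg 4 = v + 1 → s.reg 5 = off (v + 1) → s.reg 6 = i →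
      J v (Dn v i) s →
      Runs (.loop (.lt 6 5) (.instr (.load 7 1 6) ;; body ;; .instr (.succ 6))) s
        ((cost body + 3) * d + 1) fun s' => Frame P s₀ s' ∧ s'.reg 3 = v ∧ s'.reg 4 = v + 1 ∧
          s'.reg 6 = off (v + 1) ∧ J v {b | G.Adj v b} s' := by
    intro v d
    induction d with
    | zero =>
      intro i s hi hi' hf h3 h4 h5 h6 hJ
      refine Runs.loop_false ?_ ⟨hf, h3, h4, h6.trans hi, ?_⟩
      · simp only [Test.Holds, h5, h6]
        omega
      · have : Dn v i = ({b | G.Adj v b} : Finset (Fin n)) := by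
          ext b
          simp only [Dn, Finset.mem_filter, Finset.mem_univ, true_and]
          constructor
          · rintro ⟨k, hk, hk', hb⟩
            obtain ⟨c, hc, hcb⟩ := (hin.block v).mapsTo (show k ∈ Set.Ico _ _ from ⟨hk, show k < off (v + 1) by omega⟩)
            have : c = b := Fin.ext (hcb.trans hb)
            exact this ▸ hc
          · intro hb
            obtain ⟨k, ⟨hk, hk'⟩, hkb⟩ := (hin.block v).surjOn ⟨b, hb, rfl⟩
            exact ⟨k, hk, by rw [show i = off (v + 1) by omega]; exact hk', hkb⟩
        rwa [this] at hJ
    | succ d ih =>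
      intro i s hi hi' hf h3 h4 h5 h6 hJ
      obtain ⟨e0, e1⟩ := harr0 hf
      have hik : i ∈ Set.Ico (off v) (off (v + 1)) := ⟨hi', by omega⟩
      obtain ⟨b, hb, hbi⟩ := (hin.block v).mapsTo hik
      have hbi' : s.arr 1 (s.reg 6) = b := by rw [e1, h6]; exact hbi.symm
      have hnot : b ∉ Dn v i := by
        simp only [Dn, Finset.mem_filter, Finset.mem_univ, true_and]
        rintro ⟨k, hk, hk', hkb⟩
        have := (hin.block v).injOn ⟨hk, show k < off (v + 1) by omega⟩ hik (hkb.trans hbi)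
        omega
      have hins : insert b (Dn v i) = Dn v (i + 1) := by
        ext c
        simp only [Dn, Finset.mem_insert, Finset.mem_filter, Finset.mem_univ, true_and]
        constructor
        · rintro (rfl | ⟨k, hk, hk', hkc⟩)
          · exact ⟨i, hi', by omega, hbi.symm⟩
          · exact ⟨k, hk, by omega, hkc⟩
        · rintro ⟨k, hk, hk', hkc⟩
          by_cases h : k = i
          · left
            subst h
            exact Fin.ext (hkc.symm.trans hbi.symm)
          · exact Or.inr ⟨k, hk, by omega, hkc⟩
      have hwt : s.warr 0 (s.reg 6) = w s(v, b) :=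
        (hinput hf).weight v b _ (by rw [e0, h6]; exact hik) hbi'
      have hstep := h_body v b (Dn v i) s (hinput hf) hf h3 h4 hbi' hwt hb hnot hJ
      rw [hins] at hstep
      have hsub : ∀ {s s' : State}, Frame (.instr (.load 7 1 6) ;; body ;; .instr (.succ 6)) s s' →
          Frame P s s' := fun h =>
        (((((((h.loop (b := .lt 6 5)).seq_left (q := post ;; .instr (.succ 3))).seq_right
          (p := pre)).seq_right (p := .instr (.load 5 0 4))).seq_right
          (p := .instr (.succ 4))).seq_right (p := .instr (.copy 4 3))).loop
          (b := .lt 3 0)).seq_right.seq_right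
      have hb1 : wp body (fun s' => J v (Dn v (i + 1)) ((Instr.succ 6).run s'))
          ((Instr.load 7 1 6).run s) := hstep
      refine (Runs.loop_true (c := cost body + 2) (c' := (cost body + 3) * d + 1) ?_ ?_).mono
        (by rw [Nat.mul_succ]; omega) fun _ h => h
      · simp only [Test.Holds, h5, h6]
        omega
      · have hr := (runs_of_wp hb1).frame
        have hrun : Runs (.instr (.load 7 1 6) ;; body ;; .instr (.succ 6)) s
            (1 + (cost body + 1)) fun s' => J v (Dn v (i + 1)) s' ∧ s'.reg 3 = s.reg 3 ∧
              s'.reg 4 = s.reg 4 ∧ s'.reg 5 = s.reg 5 ∧ s'.reg 6 = s.reg 6 + 1 := by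
          refine Runs.seq (Runs.instr (Runs.seq (hr.mono le_rfl ?_)))
          rintro s' ⟨hf', hJ'⟩
          refine Runs.instr ⟨hJ', ?_⟩
          have r3 := hbody.reg_eq hf' (i := 3) (by omega)
          have r4 := hbody.reg_eq hf' (i := 4) (by omega)
          have r5 := hbody.reg_eq hf' (i := 5) (by omega)
          have r6 := hbody.reg_eq hf' (i := 6) (by omega)
          simp [Instr.run] at r3 r4 r5 r6 ⊢
          exact ⟨r3, r4, r5, r6⟩
        refine hrun.frame.mono (by omega) ?_
        rintro s' ⟨hf', hJ', h3', h4', h5', h6'⟩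
        exact ih (i + 1) s' (by omega) (by omega) (hf.trans (hsub hf')) (h3'.trans h3)
          (h4'.trans h4) (h5'.trans h5) (by rw [h6', h6]) hJ'
  -- the outer loop
  have houter : ∀ (d k : ℕ) (s : State), k + d = n → Frame P s₀ s → s.reg 3 = k →
      s.reg 6 = off k → off k ≤ off n ∧ (I k s →
      Runs (.loop (.lt 3 0) (.instr (.copy 4 3) ;; .instr (.succ 4) ;; .instr (.load 5 0 4) ;; pre ;;
        .loop (.lt 6 5) (.instr (.load 7 1 6) ;; body ;; .instr (.succ 6)) ;;
        post ;; .instr (.succ 3))) s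
        (passCost pre body post * (d + (off n - off k)) + 1) fun s' => Frame P s₀ s' ∧ I n s') := by
    intro d
    induction d with
    | zero =>
      intro k s hk hf h3 h6
      obtain rfl : k = n := by omega
      refine ⟨le_rfl, fun hI => Runs.loop_false ?_ ⟨hf, hI⟩ |>.mono (by omega) fun _ h => h⟩
      simp only [Test.Holds, h3, (hinput hf).size]
      omega
    | succ d ih =>
      intro k s hk hf h3 h6
      have hkn : k < n := by omega
      have hle : off k ≤ off (k + 1) := hin.block_le ⟨k, hkn⟩
      -- The bound on `off` is part of the induction claim and does not depend on the invariant. It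
      -- is therefore obtained by applying the hypothesis to a state in which registers 3 and 6 are
      -- set by hand.
      have hle' : off (k + 1) ≤ off n := by
        refine (ih (k + 1) { s with
          reg := Function.update (Function.update s.reg 3 (k + 1)) 6 (off (k + 1)) }
          (by omega) ⟨fun i hi => ?_, hf.arr, hf.wreg, hf.warr⟩ ?_ ?_).1
        · rw [← hf.reg i hi]
          have h1 : i ≠ 3 := by
            rintro rfl
            exact hi (by simp [hP, pass, regW])
          have h2 : i ≠ 6 := by
            rintro rfl
            exact hi (by simp [hP, pass, regW])
          simp [h1, h2]
        · simp
        · simp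
      refine ⟨hle.trans hle', fun hI => ?_⟩
      obtain ⟨e0, e1⟩ := harr0 hf
      have hstep := h_pre ⟨k, hkn⟩ s (hinput hf) hf h3 hI
      have hp1 : wp pre (J ⟨k, hkn⟩ ∅) ((Instr.load 5 0 4).run ((Instr.succ 4).run
        ((Instr.copy 4 3).run s))) := hstep
      refine (Runs.loop_true (c := cost pre + ((cost body + 3) * (off (k + 1) - off k) + 1) +
        cost post + 4) (c' := passCost pre body post * (d + (off n - off (k + 1))) + 1) ?_ ?_).mono
        ?_ fun _ h => h
      · simp only [Test.Holds, h3, (hinput hf).size]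
        omega
      · set L := Program.loop (.lt 6 5) (.instr (.load 7 1 6) ;; body ;; .instr (.succ 6)) with hL
        have hrun : Runs (.instr (.copy 4 3) ;; .instr (.succ 4) ;; .instr (.load 5 0 4) ;; pre ;;
            L ;; post ;; .instr (.succ 3)) s
            (1 + (1 + (1 + (cost pre + (((cost body + 3) * (off (k + 1) - off k) + 1) +
              (cost post + 1)))))) fun s' => I (k + 1) s' ∧ s'.reg 3 = k + 1 ∧
                s'.reg 6 = off (k + 1) := by
          have hf3 : Frame P s ((Instr.load 5 0 4).run ((Instr.succ 4).run
              ((Instr.copy 4 3).run s))) := by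
            have f1 := (frame_run (.copy 4 3) s).seq_left (q := .instr (.succ 4) ;;
              .instr (.load 5 0 4) ;; pre ;; L ;; post ;; .instr (.succ 3))
            have f2 := ((frame_run (.succ 4) ((Instr.copy 4 3).run s)).seq_left (q :=
              .instr (.load 5 0 4) ;; pre ;; L ;; post ;; .instr (.succ 3))).seq_right
                (p := .instr (.copy 4 3))
            have f3 := (((frame_run (.load 5 0 4) ((Instr.succ 4).run
              ((Instr.copy 4 3).run s))).seq_left (q :=
              pre ;; L ;; post ;; .instr (.succ 3))).seq_right
                (p := .instr (.succ 4))).seq_right (p := .instr (.copy 4 3))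
            exact ((f1.trans f2).trans f3).loop.seq_right.seq_right
          refine Runs.seq (Runs.instr (Runs.seq (Runs.instr (Runs.seq (Runs.instr (Runs.seq
            ((runs_of_wp hp1).frame.mono le_rfl ?_)))))))
          rintro s1 ⟨hf1, hJ1⟩
          have r3 := hpre.reg_eq hf1 (i := 3) (by omega)
          have r4 := hpre.reg_eq hf1 (i := 4) (by omega)
          have r5 := hpre.reg_eq hf1 (i := 5) (by omega)
          have r6 := hpre.reg_eq hf1 (i := 6) (by omega)
          simp [Instr.run, e0, h3, h6] at r3 r4 r5 r6
          have hF1 : Frame P s₀ s1 := (hf.trans hf3).trans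
            ((((hf1.seq_left (q := L ;; post ;; .instr (.succ 3))).seq_right
              (p := .instr (.load 5 0 4))).seq_right (p := .instr (.succ 4))).seq_right
              (p := .instr (.copy 4 3))).loop.seq_right.seq_right
          have hD0 : Dn ⟨k, hkn⟩ (off k) = ∅ := by
            ext b
            simp only [Dn, Finset.mem_filter, Finset.mem_univ, true_and, Finset.notMem_empty,
              iff_false]
            rintro ⟨j, hj, hj', -⟩
            exact absurd hj' (not_lt.2 hj)
          refine Runs.seq ((hinner ⟨k, hkn⟩ (off (k + 1) - off k) (off k) s1 ?_ le_rfl hF1 r3 r4 r5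
            r6 (hD0 ▸ hJ1)).mono le_rfl ?_)
          · show off k + (off (k + 1) - off k) = off (k + 1)
            omega
          rintro s2 ⟨hF2, g3, g4, g6, hJ2⟩
          have hq : wp post (fun s' => I (k + 1) ((Instr.succ 3).run s')) s2 :=
            h_post ⟨k, hkn⟩ s2 (hinput hF2) hF2 g3 g4 hJ2
          refine Runs.seq ((runs_of_wp hq).frame.mono le_rfl ?_)
          rintro s4 ⟨hf4, hI4⟩
          refine Runs.instr ⟨hI4, ?_⟩
          have q3 := hpost.reg_eq hf4 (i := 3) (by omega)
          have q6 := hpost.reg_eq hf4 (i := 6) (by omega)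
          simp [Instr.run, q3, q6, g3, g6]
        refine hrun.frame.mono (by omega) ?_
        rintro s' ⟨hf', hI', h3', h6'⟩
        exact (ih (k + 1) s' (by omega) (hf.trans hf'.loop.seq_right.seq_right) h3' h6').2 hI'
      -- Each list entry is paid with `cost body + 3`, each vertex with the rest; the summand 9 in
      -- `passCost` covers the control instructions and tests.
      · set K := passCost pre body post with hK
        have hKle : cost body + 3 ≤ K := by simp only [hK, passCost]; omega
        have h1 : (cost body + 3) * (off (k + 1) - off k) ≤ K * (off (k + 1) - off k) :=
          Nat.mul_le_mul_right _ hKle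
        have h2 : d + 1 + (off n - off k) = (d + (off n - off (k + 1))) + (off (k + 1) - off k) + 1 := by
          omega
        rw [h2, Nat.mul_add_one, Nat.mul_add K (d + _)]
        have h3 : K = cost pre + cost body + cost post + 9 := rfl
        omega
  have hinit : I 0 ((Instr.const 6 0).run ((Instr.const 3 0).run s₀)) := h_init
  have hf0 : Frame P s₀ ((Instr.const 6 0).run ((Instr.const 3 0).run s₀)) :=
    (frame_run (.const 3 0) s₀).seq_left.trans
      (frame_run (.const 6 0) ((Instr.const 3 0).run s₀)).seq_left.seq_right
  have hmain := (houter n 0 _ (by omega) hf0 (by simp [Instr.run])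
    (by simp [Instr.run, hoff, hin.first_block])).2 hinit
  refine (Runs.seq (Runs.instr (Runs.seq (Runs.instr hmain)))).mono ?_ ?_
  · have : off 0 = 0 := hin.first_block
    rw [this, Nat.sub_zero]
    omega
  · rintro s ⟨hf, hI⟩
    exact ⟨hinput hf, hf, hI⟩

end Passes

/-! ### Passes for the levels, for neighbors in the same level, and for the sets `T u` -/

section LevelPasses

variable {n : ℕ} {G : SimpleGraph (Fin n)} {w : Sym2 (Fin n) → Weight} {x y : Fin n}

/-- The pairs of adjacent vertices that a pass has handled if it has handled all neighbors of
the vertices before `v` and the neighbors of `v` in `D`. -/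
def Seen (G : SimpleGraph (Fin n)) (v : ℕ) (D : Finset (Fin n)) (a b : Fin n) : Prop :=
  G.Adj a b ∧ (a.val < v ∨ (a.val = v ∧ b ∈ D))

theorem seen_zero {a b : Fin n} : ¬ Seen G 0 ∅ a b := by
  simp [Seen]

theorem seen_insert [DecidableEq (Fin n)] {v c a b : Fin n} {D : Finset (Fin n)} (h : G.Adj v c) :
    Seen G v (insert c D) a b ↔ Seen G v D a b ∨ (a = v ∧ b = c) := by
  simp only [Seen, Finset.mem_insert, Fin.val_inj]
  constructor
  · rintro ⟨h1, h2 | ⟨rfl, rfl | h2⟩⟩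
    · exact Or.inl ⟨h1, Or.inl h2⟩
    · exact Or.inr ⟨rfl, rfl⟩
    · exact Or.inl ⟨h1, Or.inr ⟨rfl, h2⟩⟩
  · rintro (⟨h1, h2 | ⟨rfl, h2⟩⟩ | ⟨rfl, rfl⟩)
    · exact ⟨h1, Or.inl h2⟩
    · exact ⟨h1, Or.inr ⟨rfl, Or.inr h2⟩⟩
    · exact ⟨h, Or.inr ⟨rfl, Or.inl rfl⟩⟩

open Classical in
theorem seen_all {v a b : Fin n} :
    Seen G v ({b | G.Adj v b} : Finset (Fin n)) a b ↔ Seen G (v + 1) ∅ a b := by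
  simp only [Seen, Finset.mem_filter, Finset.mem_univ, true_and, Finset.notMem_empty, and_false,
    or_false, Fin.val_inj]
  constructor
  · rintro ⟨h1, h2 | ⟨rfl, h2⟩⟩
    · exact ⟨h1, by omega⟩
    · exact ⟨h1, by omega⟩
  · rintro ⟨h1, h2⟩
    refine ⟨h1, ?_⟩
    rcases Nat.lt_succ_iff_lt_or_eq.1 h2 with h | h
    · exact Or.inl h
    · obtain rfl := Fin.ext h
      exact Or.inr ⟨rfl, h1⟩

theorem seen_top {a b : Fin n} : Seen G n ∅ a b ↔ G.Adj a b := by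
  simp [Seen]

theorem Input.c0 {s : State} (h : Input G w x y s) : s.reg 10 = 0 := h.const 0 (by omega)
theorem Input.c1 {s : State} (h : Input G w x y s) : s.reg 11 = 1 := h.const 1 (by omega)
theorem Input.c3 {s : State} (h : Input G w x y s) : s.reg 13 = 3 := h.const 3 (by omega)
theorem Input.c4 {s : State} (h : Input G w x y s) : s.reg 14 = 4 := h.const 4 (by omega)
theorem Input.c5 {s : State} (h : Input G w x y s) : s.reg 15 = 5 := h.const 5 (by omega)
theorem Input.c6 {s : State} (h : Input G w x y s) : s.reg 16 = 6 := h.const 6 (by omega)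

/-- No operation. -/
def skip : Program := .instr (.const 17 0)

theorem safe_skip : Safe skip := by decide

/-! #### Distance levels -/

def levelPre : Program := .instr (.load 20 4 3)

/-- Register `10 + k` holds the constant `k`, so register `11 + d` is compared with the stored form
of level `d`; entry 0 means not yet reached. -/
def levelBody (d : ℕ) : Program :=
  .branch (.eq 20 (11 + d))
    (.instr (.load 21 4 7) ;; .branch (.eq 21 10) (.instr (.store 4 7 (12 + d))) skip) skip

def levelPass (d : ℕ) : Program := pass levelPre (levelBody d) skip

/-- Array 4 holds the levels up to `d`, increased by one. -/
def LevelsUpTo (G : SimpleGraph (Fin n)) (x y : Fin n) (d : ℕ) (s : State) : Prop :=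
  ∀ z : Fin n, s.arr 4 z = if lv G x y z ≤ d then lv G x y z + 1 else 0

-- One pass per layer replaces a queue; this stays linear because only the levels up to five are
-- needed.
open Classical in
theorem levelPass_spec (hc : G.Connected) {d : ℕ} (hd : d ≤ 4) {s₀ : State}
    (hin : Input G w x y s₀) (hlev : LevelsUpTo G x y d s₀) :
    Runs (levelPass d) s₀ (passCost levelPre (levelBody d) skip * (n + s₀.arr 0 n) + 3)
      fun s => Input G w x y s ∧ Frame (levelPass d) s₀ s ∧ LevelsUpTo G x y (d + 1) s := by
  -- Vertices of level `d + 1` get their entry once a handled pair reaches them from level `d`. The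
  -- new entry `d + 2` does not trigger the test for `d + 1` in the same pass.
  let K : (Fin n → Fin n → Prop) → State → Prop := fun R s => ∀ z : Fin n, s.arr 4 z =
    if lv G x y z ≤ d then lv G x y z + 1 else
      if lv G x y z = d + 1 ∧ ∃ a, R a z ∧ lv G x y a = d then d + 2 else 0
  refine (pass_rule hin (by decide) ?_ safe_skip (fun v s => K (Seen G v ∅) s)
    (fun v D s => K (Seen G v D) s ∧ (s.reg 20 = d + 1 ↔ lv G x y v = d)) ?_ ?_ ?_ ?_).mono
    le_rfl ?_
  · interval_cases d <;> decide
  · simp only [wp, Instr.run, K]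
    intro z
    rw [hlev z]
    simp [seen_zero]
  · intro v s hi hf h3 hK
    simp only [levelPre, wp, Instr.run]
    simp [Function.update_apply]
    refine ⟨hK, ?_⟩
    rw [h3, hK v]
    split_ifs with h1 h2
    · omega
    · have := h2.1
      omega
    · exact ⟨fun h => h.elim, fun h => h1 h.le⟩
  · intro v b D s hi hf h3 h4 hb hw hadj hD ⟨hK, h20⟩
    have hc1 : s.reg (11 + d) = d + 1 := by
      rw [show 11 + d = 10 + (d + 1) by omega]
      exact hi.const _ (by omega)
    have hc2 : s.reg (12 + d) = d + 2 := by
      rw [show 12 + d = 10 + (d + 2) by omega]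
      exact hi.const _ (by omega)
    have hl := lv_adj_cases (x := x) (y := y) hc hadj
    have e1 : 11 + d ≠ 7 := by omega
    have e2 : 12 + d ≠ 7 := by omega
    have e3 : 12 + d ≠ 21 := by omega
    simp only [levelBody, skip, wp, Instr.run, Test.Holds]
    simp [Function.update_apply, hb, hc1, hc2, hi.c0, e1, e2, e3, seen_insert hadj, K, h20]
    refine ⟨fun hv => ⟨fun hb0 => ?_, fun hb0 => ?_⟩, fun hv => ?_⟩
    · intro z
      rw [hK b] at hb0
      by_cases hzb : z = b
      · subst hzb
        have hlb : lv G x y z = d + 1 := by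
          split_ifs at hb0 with h1 h2
          omega
        rw [if_pos rfl, if_neg (by omega), if_pos ⟨hlb, v, Or.inr ⟨rfl, rfl⟩, hv⟩]
      · rw [if_neg (fun h => hzb (Fin.ext h)), hK z]
        simp [hzb]
    · intro z
      rw [hK z]
      by_cases hzb : z = b
      · subst hzb
        rw [hK z] at hb0
        split_ifs at hb0 with h1 h2
        · rw [if_pos h1, if_pos h1]
        · rw [if_neg h1, if_neg h1, if_pos h2, if_pos]
          obtain ⟨h, a, ha, ha'⟩ := h2
          exact ⟨h, a, Or.inl ha, ha'⟩
        · exact absurd rfl hb0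
      · simp [hzb]
    · intro z
      rw [hK z]
      have : ∀ a, ((Seen G v D a z ∨ a = v ∧ z = b) ∧ lv G x y a = d) ↔
          (Seen G v D a z ∧ lv G x y a = d) := by
        intro a
        constructor
        · rintro ⟨h | ⟨rfl, -⟩, h'⟩
          · exact ⟨h, h'⟩
          · exact absurd h' hv
        · rintro ⟨h, h'⟩
          exact ⟨Or.inl h, h'⟩
      simp only [this]
  · intro v s hi hf h3 h4 ⟨hK, h20⟩
    simp only [skip, wp, Instr.run]
    simp only [K] at hK ⊢
    simpa only [seen_all] using hK
  · rintro s ⟨hi, hf, hK⟩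
    refine ⟨hi, hf, fun z => ?_⟩
    simp only [K, seen_top] at hK
    rw [hK z]
    by_cases h1 : lv G x y z ≤ d
    · rw [if_pos h1, if_pos (by omega)]
    · rw [if_neg h1]
      by_cases h2 : lv G x y z = d + 1
      · obtain ⟨a, hza, ha⟩ := exists_adj_lv hc h2
        rw [if_pos ⟨h2, a, hza.symm, ha⟩, if_pos (by omega), h2]
      · rw [if_neg (fun h => h2 h.1), if_neg (by omega)]

/-! #### Neighbors in the same level -/

def samePre : Program := .instr (.load 20 4 3) ;; .instr (.const 21 0)

def sameBody : Program :=
  .instr (.load 22 4 7) ;;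
  .branch (.eq 22 20)
    (.branch (.eq 21 11) (.branch (.eq 20 15) (.instr (.const 8 1)) skip) skip ;;
      .instr (.const 21 1)) skip

def samePost : Program :=
  .instr (.store 5 3 21) ;; .branch (.eq 20 16) (.instr (.const 8 1)) skip

def samePass : Program := pass samePre sameBody samePost

-- Register 8 is the failure flag. In stored form, the entry 6 reveals a vertex of N₅, and two
-- neighbors with entry 5 of a vertex with entry 5 violate the test on N₄.
open Classical in
theorem samePass_spec {s₀ : State} (hin : Input G w x y s₀) (h8 : s₀.reg 8 = 0) :
    Runs samePass s₀ (passCost samePre sameBody samePost * (n + s₀.arr 0 n) + 3)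
      fun s => Input G w x y s ∧ Frame samePass s₀ s ∧
        (∀ z : Fin n, s.arr 5 z = 1 ↔ ∃ b, G.Adj z b ∧ s₀.arr 4 b = s₀.arr 4 z) ∧
        (s.reg 8 = 0 ↔ ∀ z : Fin n, s₀.arr 4 z ≠ 6 ∧ (s₀.arr 4 z = 5 → ∀ b b', G.Adj z b →
          G.Adj z b' → s₀.arr 4 b = 5 → s₀.arr 4 b' = 5 → b = b')) := by
  set f := s₀.arr 4 with hf0
  let Ok : Fin n → Prop := fun z => f z ≠ 6 ∧ (f z = 5 → ∀ b b', G.Adj z b → G.Adj z b' →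
    f b = 5 → f b' = 5 → b = b')
  refine (pass_rule hin (by decide) (by decide) (by decide)
    (fun v s => (∀ z : Fin n, z.val < v → (s.arr 5 z = 1 ↔ ∃ b, G.Adj z b ∧ f b = f z)) ∧
      (s.reg 8 = 0 ↔ ∀ z : Fin n, z.val < v → Ok z))
    (fun v D s => (∀ z : Fin n, z.val < v → (s.arr 5 z = 1 ↔ ∃ b, G.Adj z b ∧ f b = f z)) ∧
      s.reg 20 = f v ∧ (s.reg 21 = 1 ↔ ∃ b ∈ D, f b = f v) ∧
      (s.reg 8 = 0 ↔ (∀ z : Fin n, z.val < v → Ok z) ∧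
        (f v = 5 → ∀ b ∈ D, ∀ b' ∈ D, f b = 5 → f b' = 5 → b = b'))) ?_ ?_ ?_ ?_).mono
    le_rfl ?_
  · simp only [wp, Instr.run]
    simp [h8]
  · intro v s hi hf h3 ⟨h1, h2⟩
    have e4 : s.arr 4 = f := hf.arr 4 (by decide)
    simp only [samePre, wp, Instr.run]
    simp [Function.update_apply, h3, e4, h2]
    exact h1
  · intro v b D s hi hf h3 h4 hb hw hadj hD ⟨h1, h20, h21, h8⟩
    have e4 : s.arr 4 = f := hf.arr 4 (by decide)
    simp only [sameBody, skip, wp, Instr.run, Test.Holds]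
    simp [Function.update_apply, hb, hi.c1, hi.c5, e4, h20, h21]
    refine ⟨fun hbv => ⟨fun c hc hcv => ⟨fun h5 => ⟨h1, Or.inl hbv, fun _ => ?_⟩,
      fun h5 => ⟨h1, Or.inl hbv, ?_⟩⟩, fun hno => ⟨h1, Or.inl hbv, ?_⟩⟩, fun hbv => ⟨h1, ?_, ?_⟩⟩
    · rw [h5] at hbv hcv
      exact ⟨h5, fun h => absurd (h c hc hbv hcv) fun h => hD (h ▸ hc)⟩
    · rw [h8]
      exact and_congr_right fun _ => ⟨fun _ h => absurd h h5, fun _ h => absurd h h5⟩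
    · rw [h8]
      refine and_congr_right fun _ => imp_congr_right fun h5 => ?_
      have hno' : ∀ c ∈ D, f c ≠ 5 := fun c hc h => hno c hc (h.trans h5.symm)
      constructor
      · exact fun _ => ⟨fun a ha _ h => absurd h (hno' a ha), fun a ha => ⟨fun h => absurd h (hno' a ha),
          fun a' _ h => absurd h (hno' a ha)⟩⟩
      · exact fun _ a ha a' _ h => absurd h (hno' a ha)
    · exact fun h => absurd h hbv
    · rw [h8]
      refine and_congr_right fun _ => imp_congr_right fun h5 => ?_
      rw [h5] at hbv
      constructor
      · exact fun h => ⟨fun _ _ h => absurd h hbv, fun a ha => ⟨fun _ h => absurd h hbv, h a ha⟩⟩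
      · exact fun h a ha => (h.2 a ha).2
  · intro v s hi hf h3 h4 ⟨h1, h20, h21, h8⟩
    simp only [samePost, skip, wp, Instr.run, Test.Holds]
    simp [Function.update_apply, h3, h20, hi.c6]
    have key : ∀ z : Fin n, z.val < v + 1 →
        ((if (z : ℕ) = v then s.reg 21 else s.arr 5 z) = 1 ↔ ∃ b, G.Adj z b ∧ f b = f z) := by
      intro z hz
      by_cases hzv : z = v
      · subst hzv
        rw [if_pos rfl, h21]
        simp
      · rw [if_neg (fun h => hzv (Fin.ext h))]
        exact h1 z (lt_of_le_of_ne (Nat.lt_succ_iff.1 hz) fun h => hzv (Fin.ext h))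
    refine ⟨fun h6 => ⟨fun z hz => key z (Nat.lt_succ_of_le hz), v, le_rfl, fun h => absurd h6 h.1⟩,
      fun h6 => ⟨fun z hz => key z (Nat.lt_succ_of_le hz), ?_⟩⟩
    rw [h8]
    constructor
    · rintro ⟨h, h'⟩ z hz
      by_cases hzv : z = v
      · subst hzv
        refine ⟨h6, fun h5 b b' hb hb' => h' h5 b (by simpa using hb) b' (by simpa using hb')⟩
      · exact h z (lt_of_le_of_ne (show z.val ≤ v.val from hz) fun h => hzv (Fin.ext h))
    · intro h
      refine ⟨fun z hz => h z (le_of_lt hz), fun h5 b hb b' hb' => ?_⟩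
      exact (h v le_rfl).2 h5 b b' (by simpa using hb) (by simpa using hb')
  · rintro s ⟨hi, hf, h1, h2⟩
    exact ⟨hi, hf, fun z => h1 z z.2, h2.trans ⟨fun h z => h z z.2, fun h z _ => h z⟩⟩

/-! #### The sets `T_u` -/

def ownPre : Program :=
  .instr (.load 20 4 3) ;; .instr (.const 21 0) ;; .instr (.const 22 0)

/-- Register 21 keeps the first neighbor in S₂, register 22 records a reason for not belonging to
any `T u`. The weight of the edge to the owner is saved at once, because it is available only at
this list position. -/
def ownBody : Program :=
  .instr (.load 23 4 7) ;; .instr (.load 24 5 7) ;;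
  .branch (.eq 23 13)
    (.branch (.eq 24 11) (.instr (.const 22 1))
      (.branch (.eq 21 10)
        (.instr (.copy 21 7) ;; .instr (.succ 21) ;; .instr (.wload 1 0 6))
        (.instr (.const 22 1))))
    (.branch (.eq 23 15) (.branch (.eq 24 11) (.instr (.const 22 1)) skip) skip)

def ownPost : Program :=
  .instr (.wstore 1 3 1) ;;
  .branch (.eq 20 14)
    (.branch (.eq 22 10) (.instr (.store 6 3 21)) (.instr (.store 6 3 10)))
    (.instr (.store 6 3 10))

def ownPass : Program := pass ownPre ownBody ownPost

/-- The condition, in terms of the level array `f` and the array `g` of the previous pass, that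
`z` belongs to `T_u`. -/
def Owns (G : SimpleGraph (Fin n)) (f g : ℕ → ℕ) (z u : Fin n) : Prop :=
  f z = 4 ∧ G.Adj z u ∧ f u = 3 ∧ g u ≠ 1 ∧
    (∀ b, G.Adj z b → ¬ ((f b = 3 ∨ f b = 5) ∧ g b = 1)) ∧
    ∀ b, G.Adj z b → f b = 3 → g b ≠ 1 → b = u

open Classical in
theorem ownPass_spec {s₀ : State} (hin : Input G w x y s₀) :
    Runs ownPass s₀ (passCost ownPre ownBody ownPost * (n + s₀.arr 0 n) + 3)
      fun s => Input G w x y s ∧ Frame ownPass s₀ s ∧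
        ∀ z : Fin n, (s.arr 6 z = 0 ∧ ∀ u, ¬ Owns G (s₀.arr 4) (s₀.arr 5) z u) ∨
          ∃ u : Fin n, Owns G (s₀.arr 4) (s₀.arr 5) z u ∧ s.arr 6 z = u + 1 ∧
            s.warr 1 z = w s(z, u) := by
  set f := s₀.arr 4 with hf0
  set g := s₀.arr 5 with hg0
  let C : Fin n → State → Prop := fun z s => (s.arr 6 z = 0 ∧ ∀ u, ¬ Owns G f g z u) ∨
    ∃ u : Fin n, Owns G f g z u ∧ s.arr 6 z = u + 1 ∧ s.warr 1 z = w s(z, u)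
  let Bad : Fin n → Prop := fun b => (f b = 3 ∨ f b = 5) ∧ g b = 1
  let Su : Fin n → Prop := fun b => f b = 3 ∧ g b ≠ 1
  -- A second neighbor in S₂ sets register 22 and does not overwrite register 21.
  let W : Fin n → Finset (Fin n) → State → Prop := fun v D s =>
    (s.reg 21 = 0 ∧ ∀ b ∈ D, ¬ Su b) ∨
      ∃ b ∈ D, Su b ∧ s.reg 21 = b + 1 ∧ s.wreg 1 = w s(v, b)
  refine (pass_rule hin (by decide) (by decide) (by decide)
    (fun v s => ∀ z : Fin n, z.val < v → C z s)
    (fun v D s => (∀ z : Fin n, z.val < v → C z s) ∧ s.reg 20 = f v ∧ W v D s ∧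
      (s.reg 22 = 0 ↔ (∀ b ∈ D, ¬ Bad b) ∧ ∀ b ∈ D, ∀ b' ∈ D, Su b → Su b' → b = b'))
    ?_ ?_ ?_ ?_).mono le_rfl ?_
  · simp only [wp, Instr.run]
    simp
  · intro v s hi hf h3 h1
    have e4 : s.arr 4 = f := hf.arr 4 (by decide)
    simp only [ownPre, wp, Instr.run]
    simp [Function.update_apply, h3, e4, W]
    exact h1
  · intro v b D s hi hf h3 h4 hb hw hadj hD ⟨h1, h20, hW, h22⟩
    have e4 : s.arr 4 = f := hf.arr 4 (by decide)
    have e5 : s.arr 5 = g := hf.arr 5 (by decide)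
    have hW' : ¬ Su b → W v (insert b D) s := by
      intro hSu
      rcases hW with ⟨h, h'⟩ | ⟨c, hc, h⟩
      · refine Or.inl ⟨h, fun c hc => ?_⟩
        rcases Finset.mem_insert.1 hc with rfl | hc
        · exact hSu
        · exact h' c hc
      · exact Or.inr ⟨c, Finset.mem_insert_of_mem hc, h⟩
    have hsu : ¬ Su b → ¬ Bad b → (s.reg 22 = 0 ↔ (∀ c ∈ insert b D, ¬ Bad c) ∧
        ∀ c ∈ insert b D, ∀ c' ∈ insert b D, Su c → Su c' → c = c') := by
      intro hSu hBad
      rw [h22]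
      simp only [Finset.forall_mem_insert, hSu, hBad, not_false_iff, true_and, false_imp_iff,
        implies_true, and_true]
    simp only [ownBody, skip, wp, Instr.run, Test.Holds]
    simp [Function.update_apply, hb, hi.c0, hi.c1, hi.c3, hi.c5, e4, e5, h20]
    refine ⟨fun hb3 => ⟨fun hg => ⟨h1, hW' fun h => h.2 hg, ?_⟩, fun hg => ⟨fun h21 => ⟨h1, ?_, ?_⟩,
      fun h21 => ⟨h1, ?_, ?_⟩⟩⟩, fun hb3 => ⟨fun hb5 => ⟨fun hg => ⟨h1, hW' fun h => h.2 hg, ?_⟩,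
      fun hg => ⟨h1, hW' fun h => hb3 h.1, by simpa using hsu (fun h => hb3 h.1) fun h => hg h.2⟩⟩,
      fun hb5 => ⟨h1, hW' fun h => hb3 h.1, by simpa using hsu (fun h => hb3 h.1) fun h => h.1.elim hb3 hb5⟩⟩⟩
    · exact fun h => absurd ⟨Or.inl hb3, hg⟩ h
    · exact Or.inr ⟨b, Finset.mem_insert_self _ _, ⟨hb3, hg⟩, by simp, by simpa using hw⟩
    · rw [h22]
      have hno : ∀ c ∈ D, ¬ Su c := by
        rcases hW with ⟨-, h⟩ | ⟨c, hc, -, h, -⟩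
        · exact h
        · omega
      have hBad : ¬ Bad b := fun h => hg h.2
      refine and_congr ⟨fun h => ⟨hBad, h⟩, fun h => h.2⟩ ⟨fun h => ⟨fun c hc _ h' => absurd h' (hno c hc),
        fun c hc => ⟨fun h' => absurd h' (hno c hc), h c hc⟩⟩, fun h c hc => (h.2 c hc).2⟩
    · rcases hW with ⟨h, -⟩ | ⟨c, hc, h⟩
      · exact absurd h h21
      · exact Or.inr ⟨c, Finset.mem_insert_of_mem hc, h⟩
    · rcases hW with ⟨h, -⟩ | ⟨c, hc, hSu, -, -⟩
      · exact absurd h h21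
      · refine fun _ _ h => absurd (h c hc ⟨hb3, hg⟩ hSu) ?_
        rintro rfl
        exact hD hc
    · exact fun h => absurd ⟨Or.inr hb5, hg⟩ h
  · intro v s hi hf h3 h4 ⟨h1, h20, hW, h22⟩
    have hmem : ∀ b, b ∈ ({b | G.Adj v b} : Finset (Fin n)) ↔ G.Adj v b := fun b => by simp
    simp only [hmem] at h22
    have key : ∀ s' : State, (∀ z : Fin n, z ≠ v → s'.arr 6 z = s.arr 6 z ∧ s'.warr 1 z = s.warr 1 z) →
        C v s' → ∀ z : Fin n, z.val < v + 1 → C z s' := by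
      intro s' h hv z hz
      by_cases hzv : z = v
      · exact hzv ▸ hv
      · have := h1 z (lt_of_le_of_ne (Nat.lt_succ_iff.1 hz) fun h => hzv (Fin.ext h))
        simp only [C, (h z hzv).1, (h z hzv).2]
        exact this
    simp only [ownPost, wp, Instr.run, Test.Holds]
    simp only [Function.update_apply, h3, h20, hi.c4, hi.c0]
    refine ⟨fun hv4 => ⟨fun h0 => key _ ?_ ?_, fun h0 => key _ ?_ (Or.inl ⟨by simp [hi.c0], ?_⟩)⟩,
      fun hv4 => key _ ?_ (Or.inl ⟨by simp [hi.c0], fun u hu => hv4 hu.1⟩)⟩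
    · intro z hz
      have : (z : ℕ) ≠ v := fun h => hz (Fin.ext h)
      simp [this, Function.update_apply]
    · obtain ⟨h5, h6⟩ := h22.1 h0
      rcases hW with ⟨h21, h⟩ | ⟨b, hb, hSu, h21, hw⟩
      · refine Or.inl ⟨by simp [h21], fun u hu => ?_⟩
        exact h u ((hmem u).2 hu.2.1) ⟨hu.2.2.1, hu.2.2.2.1⟩
      · rw [hmem] at hb
        refine Or.inr ⟨b, ⟨hv4, hb, hSu.1, hSu.2, h5, fun c hc h3 hg => h6 c hc b hb ⟨h3, hg⟩ hSu⟩,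
          by simp [h21], by simp [hw]⟩
    · intro z hz
      have : (z : ℕ) ≠ v := fun h => hz (Fin.ext h)
      simp [this, Function.update_apply]
    · intro u hu
      refine h0 (h22.2 ⟨hu.2.2.2.2.1, fun b hb b' hb' h h' => ?_⟩)
      rw [hu.2.2.2.2.2 b hb h.1 h.2, hu.2.2.2.2.2 b' hb' h'.1 h'.2]
    · intro z hz
      have : (z : ℕ) ≠ v := fun h => hz (Fin.ext h)
      simp [this, Function.update_apply]
  · rintro s ⟨hi, hf, h1⟩
    exact ⟨hi, hf, fun z => h1 z z.2⟩

end LevelPasses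

section PairPass

variable {n : ℕ} {G : SimpleGraph (Fin n)} {w : Sym2 (Fin n) → Weight} {x y : Fin n}

/-! #### Pairs -/

def pairPre : Program :=
  .instr (.load 20 6 3) ;; .instr (.const 21 0) ;; .instr (.const 22 0)

/-- On the first edge between two unpaired sets, the entries of both sets are written together; so
the two stored ends belong to the same edge. Any later disagreement sets the flag. -/
def pairBody : Program :=
  .instr (.load 23 6 7) ;;
  .branch (.eq 20 10) skip (.branch (.eq 23 10) skip
    (.branch (.eq 20 23) (.instr (.const 21 1))
      (.instr (.const 22 1) ;; .instr (.load 24 7 20) ;; .instr (.load 25 7 23) ;;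
        .branch (.eq 24 23) skip (.branch (.eq 24 10)
          (.branch (.eq 25 10)
            (.instr (.store 7 20 23) ;; .instr (.store 7 23 20) ;; .instr (.store 8 20 4) ;;
              .instr (.copy 26 7) ;; .instr (.succ 26) ;; .instr (.store 8 23 26))
            (.instr (.const 8 1)))
          (.instr (.const 8 1))))))

def pairPost : Program :=
  .branch (.eq 21 11) (.branch (.eq 22 11) (.instr (.const 8 1)) skip) skip

def pairPass : Program := pass pairPre pairBody pairPost

/-- The edge `ab` joins two different sets `T_u`, given by the array `o`. -/
def Cross (G : SimpleGraph (Fin n)) (o : ℕ → ℕ) (a b : Fin n) : Prop :=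
  G.Adj a b ∧ o a ≠ 0 ∧ o b ≠ 0 ∧ o a ≠ o b

theorem Cross.symm {o : ℕ → ℕ} {a b : Fin n} (h : Cross G o a b) : Cross G o b a :=
  ⟨h.1.symm, h.2.2.1, h.2.1, h.2.2.2.symm⟩

/-- The arrays `p` and `q` hold the partner of every set and an end of an edge to the partner. -/
def PairData (G : SimpleGraph (Fin n)) (o p q : ℕ → ℕ) : Prop :=
  (∀ i, p i ≠ 0 → ∃ a b, Cross G o a b ∧ o a = i ∧ o b = p i ∧ p (p i) = i ∧ q i = a + 1 ∧
    q (p i) = b + 1) ∧ ∀ i, p i = 0 → q i = 0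

/-- The vertex `v` has a neighbor in its own set and one in another set. -/
def StarSees (G : SimpleGraph (Fin n)) (o : ℕ → ℕ) (v : Fin n) : Prop :=
  (∃ b, G.Adj v b ∧ o v ≠ 0 ∧ o b = o v) ∧ ∃ b, Cross G o v b

theorem PairData.zero {o p q : ℕ → ℕ} (h : PairData G o p q) : p 0 = 0 := by
  by_contra h0
  obtain ⟨a, b, hab, ha, -⟩ := h.1 0 h0
  exact hab.2.1 ha

/-- Old pairs are undisturbed: a set paired with `o a` or `o b` would have to be the partner of an
unpaired set. -/
theorem PairData.insert {o p q : ℕ → ℕ} {a b : Fin n} (h : PairData G o p q)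
    (hab : Cross G o a b) (ha : p (o a) = 0) (hb : p (o b) = 0) :
    PairData G o (Function.update (Function.update p (o a) (o b)) (o b) (o a))
      (Function.update (Function.update q (o a) (a + 1)) (o b) (b + 1)) := by
  have h0 := h.zero
  constructor
  · intro i hi
    by_cases hib : i = o b
    · subst hib
      refine ⟨b, a, hab.symm, rfl, ?_⟩
      simp [Function.update_apply, hab.2.2.2]
    · by_cases hia : i = o a
      · subst hia
        refine ⟨a, b, hab, rfl, ?_⟩
        simp [Function.update_apply, hib]
      · simp [Function.update_apply, hib, hia] at hi ⊢
        obtain ⟨c, d, hcd, hc, hd, hpp, hq, hq'⟩ := h.1 i hi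
        have h1 : p i ≠ o a := by
          intro h
          rw [h, ha] at hpp
          exact hcd.2.1 (hc.trans hpp.symm)
        have h2 : p i ≠ o b := by
          intro h
          rw [h, hb] at hpp
          exact hcd.2.1 (hc.trans hpp.symm)
        simp [h1, h2]
        exact ⟨c, d, hcd, hc, hd, hpp, hq, hq'⟩
  · intro i hi
    by_cases hib : i = o b
    · simp [hib, Function.update_apply, hab.2.1] at hi
    · by_cases hia : i = o a
      · subst hia
        simp [Function.update_apply, hib, hab.2.2.1] at hi
      · simp [Function.update_apply, hib, hia] at hi ⊢
        exact h.2 i hi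

-- `PairData` holds even if the flag is set, since a conflict leaves the arrays unchanged. The
-- agreement of all edges with the partner array is what later yields `TestC`.
open Classical in
theorem pairPass_spec {s₀ : State} (hin : Input G w x y s₀) (h7 : ∀ i, s₀.arr 7 i = 0)
    (h8 : ∀ i, s₀.arr 8 i = 0) :
    Runs pairPass s₀ (passCost pairPre pairBody pairPost * (n + s₀.arr 0 n) + 3)
      fun s => Input G w x y s ∧ Frame pairPass s₀ s ∧
        PairData G (s₀.arr 6) (s.arr 7) (s.arr 8) ∧
        (s.reg 8 = 0 → s₀.reg 8 = 0 ∧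
          (∀ a b, Cross G (s₀.arr 6) a b → s.arr 7 (s₀.arr 6 a) = s₀.arr 6 b) ∧
          ∀ v, ¬ StarSees G (s₀.arr 6) v) ∧
        (s₀.reg 8 = 0 → (∀ v, ¬ StarSees G (s₀.arr 6) v) →
          (∀ a b c d, Cross G (s₀.arr 6) a b → Cross G (s₀.arr 6) c d →
            s₀.arr 6 a = s₀.arr 6 c → s₀.arr 6 b = s₀.arr 6 d) → s.reg 8 = 0) := by
  set o := s₀.arr 6 with ho
  let Good : Prop := s₀.reg 8 = 0 ∧ (∀ v, ¬ StarSees G o v) ∧ ∀ a b c d, Cross G o a b →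
    Cross G o c d → o a = o c → o b = o d
  let I : (Fin n → Fin n → Prop) → ℕ → State → Prop := fun R v s =>
    PairData G o (s.arr 7) (s.arr 8) ∧
    (s.reg 8 = 0 → s₀.reg 8 = 0 ∧ (∀ a b, R a b → Cross G o a b → s.arr 7 (o a) = o b) ∧
      ∀ z : Fin n, z.val < v → ¬ StarSees G o z) ∧
    (Good → s.reg 8 = 0)
  refine (pass_rule hin (by decide) (by decide) (by decide)
    (fun v s => I (Seen G v ∅) v s)
    (fun v D s => I (Seen G v D) v s ∧ s.reg 20 = o v ∧
      (s.reg 21 = 1 ↔ ∃ b ∈ D, o v ≠ 0 ∧ o b = o v) ∧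
      (s.reg 22 = 1 ↔ ∃ b ∈ D, Cross G o v b)) ?_ ?_ ?_ ?_).mono le_rfl ?_
  · simp only [wp, Instr.run, I]
    refine ⟨⟨fun i hi => absurd (h7 i) hi, fun i _ => h8 i⟩, fun h => ⟨h, ?_, ?_⟩, fun h => h.1⟩
    · intro a b h
      exact absurd h seen_zero
    · intro z hz
      omega
  · intro v s hi hf h3 h1
    have e6 : s.arr 6 = o := hf.arr 6 (by decide)
    simp only [pairPre, wp, Instr.run]
    simp [Function.update_apply, h3, e6]
    exact h1
  · intro v b D s hi hf h3 h4 hb hw hadj hD ⟨⟨hP, hF, hG⟩, h20, h21, h22⟩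
    have e6 : s.arr 6 = o := hf.arr 6 (by decide)
    have hsame : ¬ Cross G o v b → (s.reg 8 = 0 → s₀.reg 8 = 0 ∧
        (∀ a c, Seen G v (insert b D) a c → Cross G o a c → s.arr 7 (o a) = o c) ∧
        ∀ z : Fin n, z.val < v → ¬ StarSees G o z) := by
      intro hn h
      obtain ⟨h1, h2, h3⟩ := hF h
      refine ⟨h1, fun a c hac hcr => ?_, h3⟩
      rcases (seen_insert hadj).1 hac with hac | ⟨rfl, rfl⟩
      · exact h2 a c hac hcr
      · exact absurd hcr hn
    have h22' : ¬ Cross G o v b → (s.reg 22 = 1 ↔ ∃ c ∈ insert b D, Cross G o v c) := by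
      intro hn
      rw [h22]
      simp [hn]
    have h21' : ¬ (o v ≠ 0 ∧ o b = o v) → (s.reg 21 = 1 ↔ ∃ c ∈ insert b D, o v ≠ 0 ∧ o c = o v) := by
      intro hn
      rw [h21]
      simp only [Finset.exists_mem_insert, hn, false_or]
    simp only [pairBody, skip, wp, Instr.run, Test.Holds]
    simp only [Function.update_apply, hb, hi.c0, e6, h20, I]
    simp only [reduceIte, Nat.reduceEqDiff, e6, hb, h20, hi.c0, h4]
    refine ⟨fun hv0 => ⟨⟨hP, hsame fun h => h.2.1 hv0, hG⟩, trivial, h21' fun h => h.1 hv0,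
      h22' fun h => h.2.1 hv0⟩, fun hv0 => ⟨fun hb0 => ⟨⟨hP, hsame fun h => h.2.2.1 hb0, hG⟩, trivial,
      h21' fun h => h.1 (h.2.symm.trans hb0), h22' fun h => h.2.2.1 hb0⟩, fun hb0 =>
      ⟨fun hvb => ⟨⟨hP, hsame fun h => h.2.2.2 hvb, hG⟩, trivial, ?_, h22' fun h => h.2.2.2 hvb⟩,
      fun hvb => ?_⟩⟩⟩
    · simp only [true_iff]
      exact ⟨b, Finset.mem_insert_self _ _, hv0, hvb.symm⟩
    have hcr : Cross G o v b := ⟨hadj, hv0, hb0, hvb⟩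
    have h21'' := h21' fun h => hvb h.2.symm
    have h22'' : (True ↔ ∃ c ∈ insert b D, Cross G o v c) :=
      ⟨fun _ => ⟨b, Finset.mem_insert_self _ _, hcr⟩, fun _ => trivial⟩
    -- The recorded edge and the current one lead from one set, that of `v` or that of `b`, to two
    -- different sets.
    have hbad : s.arr 7 (o v) ≠ o b → (s.arr 7 (o v) ≠ 0 ∨ s.arr 7 (o b) ≠ 0) → ¬ Good := by
      rintro h1 h2 ⟨-, -, hg⟩
      rcases h2 with h2 | h2
      · obtain ⟨a, c, hac, ha, hc, -⟩ := hP.1 _ h2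
        exact h1 (hc.symm.trans (hg a c v b hac hcr ha))
      · obtain ⟨a, c, hac, ha, hc, hpp, -⟩ := hP.1 _ h2
        have : s.arr 7 (o b) = o v := hc.symm.trans (hg a c b v hac hcr.symm ha)
        rw [this] at hpp
        exact h1 hpp
    refine ⟨fun hpv => ⟨⟨hP, fun h => ?_, hG⟩, trivial, h21'', h22''⟩, fun hpv => ⟨fun hp0 =>
      ⟨fun hp1 => ⟨⟨?_, fun h => ?_, hG⟩, trivial, h21'', h22''⟩, fun hp1 => ⟨⟨hP, ?_, fun h => ?_⟩, trivial, h21'', h22''⟩⟩,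
        fun hp0 => ⟨⟨hP, ?_, fun h => ?_⟩, trivial, h21'', h22''⟩⟩⟩
    · obtain ⟨h1, h2, h3⟩ := hF h
      refine ⟨h1, fun a c hac hcr' => ?_, h3⟩
      rcases (seen_insert hadj).1 hac with hac | ⟨rfl, rfl⟩
      · exact h2 a c hac hcr'
      · exact hpv
    · have := hP.insert hcr hp0 hp1
      convert this using 1
    · obtain ⟨h1, h2, h3⟩ := hF h
      refine ⟨h1, fun a c hac hcr' => ?_, h3⟩
      rcases (seen_insert hadj).1 hac with hac | ⟨rfl, rfl⟩
      · have h4 := h2 a c hac hcr'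
        have h5 : o a ≠ o v := fun h => by
          rw [h, hp0] at h4
          exact hcr'.2.2.1 h4.symm
        have h6 : o a ≠ o b := fun h => by
          rw [h, hp1] at h4
          exact hcr'.2.2.1 h4.symm
        simp [Function.update_apply, h5, h6, h4]
      · simp [Function.update_apply, hvb]
    · simp
    · exact absurd h (hbad hpv (Or.inr hp1))
    · simp
    · exact absurd h (hbad hpv (Or.inl hp0))
  · intro v s hi hf h3 h4 ⟨⟨hP, hF, hG⟩, h20, h21, h22⟩
    have hst : StarSees G o v ↔ s.reg 21 = 1 ∧ s.reg 22 = 1 := by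
      rw [h21, h22]
      simp only [StarSees, Finset.mem_filter, Finset.mem_univ, true_and]
      exact and_congr_right fun _ => exists_congr fun b => ⟨fun h => ⟨h.1, h⟩, fun h => h.2⟩
    have hF' : ¬ StarSees G o v → s.reg 8 = 0 → s₀.reg 8 = 0 ∧
        (∀ a c, Seen G (v + 1) ∅ a c → Cross G o a c → s.arr 7 (o a) = o c) ∧
        ∀ z : Fin n, z.val < v + 1 → ¬ StarSees G o z := by
      intro hn h
      obtain ⟨h1, h2, h3⟩ := hF h
      refine ⟨h1, fun a c hac => h2 a c (seen_all.2 hac), fun z hz => ?_⟩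
      rcases Nat.lt_succ_iff_lt_or_eq.1 hz with h | h
      · exact h3 z h
      · exact Fin.ext h ▸ hn
    simp only [pairPost, skip, wp, Instr.run, Test.Holds, hi.c1, I]
    refine ⟨fun ha => ⟨fun hb => ⟨hP, by simp, fun hg => absurd (hst.2 ⟨ha, hb⟩) (hg.2.1 v)⟩,
      fun hb => ⟨hP, hF' fun h => hb (hst.1 h).2, hG⟩⟩, fun ha => ⟨hP, hF' fun h => ha (hst.1 h).1, hG⟩⟩
  · rintro s ⟨hi, hf, hP, hF, hG⟩
    refine ⟨hi, hf, hP, fun h => ?_, fun h1 h2 h3 => hG ⟨h1, h2, h3⟩⟩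
    obtain ⟨h1, h2, h3⟩ := hF h
    exact ⟨h1, fun a b h => h2 a b (seen_top.2 h.1) h, fun v => h3 v v.2⟩

end PairPass

section CountPass

variable {n : ℕ} {G : SimpleGraph (Fin n)} {w : Sym2 (Fin n) → Weight} {x y : Fin n}

/-! #### Counting edges -/

open Classical in
/-- The sum of `F a b` over all pairs in `R`. -/
noncomputable def pairSum (R : Fin n → Fin n → Prop) (F : Fin n → Fin n → ℕ) : ℕ :=
  ∑ p ∈ Finset.univ.filter (fun p : Fin n × Fin n => R p.1 p.2), F p.1 p.2

theorem pairSum_zero {F : Fin n → Fin n → ℕ} : pairSum (Seen G 0 ∅) F = 0 := by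
  simp [pairSum, seen_zero]

open Classical in
theorem pairSum_insert {v b : Fin n} {D : Finset (Fin n)} (h : G.Adj v b) (hb : b ∉ D)
    {F : Fin n → Fin n → ℕ} :
    pairSum (Seen G v (insert b D)) F = pairSum (Seen G v D) F + F v b := by
  have hins : Finset.univ.filter (fun p : Fin n × Fin n => Seen G v (insert b D) p.1 p.2) =
      insert (v, b) (Finset.univ.filter (fun p : Fin n × Fin n => Seen G v D p.1 p.2)) := by
    ext p
    simp only [Finset.mem_filter, Finset.mem_univ, true_and, Finset.mem_insert, seen_insert h,
      Prod.ext_iff]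
    tauto
  have hnot : (v, b) ∉ Finset.univ.filter (fun p : Fin n × Fin n => Seen G v D p.1 p.2) := by
    simp [Seen, hb]
  simp only [pairSum]
  rw [hins, Finset.sum_insert hnot, add_comm]

def countPre : Program :=
  .instr (.load 20 6 3) ;; .instr (.load 21 7 20) ;; .instr (.load 22 8 20) ;;
    .instr (.load 23 8 21)

/-- Increase an entry of an array. -/
def incr (a j : ℕ) : Program :=
  .instr (.load 26 a j) ;; .instr (.succ 26) ;; .instr (.store a j 26)

/-- A vertex that sees the stored end in the partner set cannot be chosen together with it and is
marked in array 11. Sets without partner also increase entry 0 of array 10, which the selection of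
candidates never reads. -/
def countBody : Program :=
  .instr (.load 24 4 7) ;; .instr (.copy 25 7) ;; .instr (.succ 25) ;;
  .branch (.eq 20 10) skip (.branch (.eq 24 13) skip
    (incr 9 3 ;; incr 9 7 ;;
      .branch (.eq 25 23) (.instr (.store 11 3 11)) (incr 10 20) ;;
      .branch (.eq 4 22) skip (.branch (.eq 25 22) skip (incr 10 21))))

def countPass : Program := pass countPre countBody skip

/-- The edge `ab` joins a vertex `a` of some set `T_u` to a vertex outside level two. -/
def Leaves (f o : ℕ → ℕ) (a b : Fin n) : Prop := o a ≠ 0 ∧ f b ≠ 3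

open Classical in
/-- Contribution of the edge `ab` to the number of edges at `z`. -/
noncomputable def countAt (f o : ℕ → ℕ) (z a b : Fin n) : ℕ :=
  if Leaves f o a b then (if z = a then 1 else 0) + (if z = b then 1 else 0) else 0

open Classical in
/-- Contribution of the edge `ab` to the number of edges at the set with index `i` or its partner
that are not covered by the chosen end of the edge between them that is in the partner. -/
noncomputable def countSet (f o p q : ℕ → ℕ) (i : ℕ) (a b : Fin n) : ℕ :=
  if Leaves f o a b then (if i = o a ∧ b.val + 1 ≠ q (p (o a)) then 1 else 0) +
    (if i = p (o a) ∧ a.val + 1 ≠ q (o a) ∧ b.val + 1 ≠ q (o a) then 1 else 0) else 0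

-- The sums run over ordered pairs, that is, list entries. An edge between two vertices of sets `T`
-- contributes from both ends, consistently in the count at a vertex and in the total of a set.
open Classical in
theorem countPass_spec {s₀ : State} (hin : Input G w x y s₀) (h9 : ∀ i, s₀.arr 9 i = 0)
    (h10 : ∀ i, s₀.arr 10 i = 0) (h11 : ∀ i, s₀.arr 11 i = 0) :
    Runs countPass s₀ (passCost countPre countBody skip * (n + s₀.arr 0 n) + 3)
      fun s => Input G w x y s ∧ Frame countPass s₀ s ∧
        (∀ z : Fin n, s.arr 9 z = pairSum G.Adj (countAt (s₀.arr 4) (s₀.arr 6) z)) ∧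
        (∀ i, s.arr 10 i =
          pairSum G.Adj (countSet (s₀.arr 4) (s₀.arr 6) (s₀.arr 7) (s₀.arr 8) i)) ∧
        ∀ z : Fin n, s.arr 11 z = 1 ↔ ∃ b, G.Adj z b ∧ Leaves (s₀.arr 4) (s₀.arr 6) z b ∧
          b.val + 1 = s₀.arr 8 (s₀.arr 7 (s₀.arr 6 z)) := by
  set f := s₀.arr 4 with hf0
  set o := s₀.arr 6 with ho
  set p := s₀.arr 7 with hp
  set q := s₀.arr 8 with hq
  let I : (Fin n → Fin n → Prop) → State → Prop := fun R s =>
    (∀ z : Fin n, s.arr 9 z = pairSum R (countAt f o z)) ∧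
    (∀ i, s.arr 10 i = pairSum R (countSet f o p q i)) ∧
    ∀ z : Fin n, s.arr 11 z = 1 ↔ ∃ b, R z b ∧ Leaves f o z b ∧ b.val + 1 = q (p (o z))
  refine (pass_rule hin (by decide) (by decide) (by decide)
    (fun v s => I (Seen G v ∅) s)
    (fun v D s => I (Seen G v D) s ∧ s.reg 20 = o v ∧ s.reg 21 = p (o v) ∧ s.reg 22 = q (o v) ∧
      s.reg 23 = q (p (o v))) ?_ ?_ ?_ ?_).mono le_rfl ?_
  · simp only [wp, Instr.run, I]
    simp [pairSum_zero, seen_zero, h9, h10, h11]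
  · intro v s hi hf h3 h1
    have e6 : s.arr 6 = o := hf.arr 6 (by decide)
    have e7 : s.arr 7 = p := hf.arr 7 (by decide)
    have e8 : s.arr 8 = q := hf.arr 8 (by decide)
    simp only [countPre, wp, Instr.run]
    simp [Function.update_apply, h3, e6, e7, e8]
    exact h1
  · intro v b D s hi hf h3 h4 hb hw hadj hD ⟨⟨h9, h10, h11⟩, h20, h21, h22, h23⟩
    have e4 : s.arr 4 = f := hf.arr 4 (by decide)
    have hvb : v.val ≠ b.val := fun h => hadj.ne (Fin.ext h)
    have hbv := hvb.symm
    -- The invariant is rewritten as the increment caused by one list entry, which leaves a finite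
    -- case distinction.
    have hI : I (Seen G v (insert b D)) = fun s' =>
        (∀ z : Fin n, s'.arr 9 z = s.arr 9 z + countAt f o z v b) ∧
        (∀ i, s'.arr 10 i = s.arr 10 i + countSet f o p q i v b) ∧
        ∀ z : Fin n, s'.arr 11 z = 1 ↔ s.arr 11 z = 1 ∨
          (z = v ∧ Leaves f o v b ∧ b.val + 1 = q (p (o v))) := by
      funext s'
      simp only [I, pairSum_insert hadj hD, h9, h10, h11, seen_insert hadj]
      refine congrArg₂ _ rfl (congrArg₂ _ rfl (forall_congr fun z => ?_))
      refine congrArg₂ _ rfl (propext ⟨?_, ?_⟩)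
      · rintro ⟨c, h | ⟨rfl, rfl⟩, h'⟩
        · exact Or.inl ⟨c, h, h'⟩
        · exact Or.inr ⟨rfl, h'⟩
      · rintro (⟨c, h, h'⟩ | ⟨rfl, h'⟩)
        · exact ⟨c, Or.inl h, h'⟩
        · exact ⟨b, Or.inr ⟨rfl, rfl⟩, h'⟩
    have hat : ∀ z : Fin n, ((z : ℕ) = v ↔ z = v) ∧ ((z : ℕ) = b ↔ z = b) := fun z =>
      ⟨Fin.val_inj, Fin.val_inj⟩
    rw [hI]
    clear hI h9 h10 h11
    simp only [countBody, incr, skip, wp, Instr.run, Test.Holds]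
    simp only [Function.update_apply, hb, h3, h4, hi.c0, hi.c1, hi.c3, e4, h20, h21, h22, h23,
      reduceIte, Nat.reduceEqDiff, countAt, countSet, Leaves]
    refine ⟨fun hv0 => ⟨⟨?_, ?_, ?_⟩, by simp⟩, fun hv0 => ⟨fun hb3 => ⟨⟨?_, ?_, ?_⟩, by simp⟩, fun hb3 =>
      ⟨fun hbq => ⟨fun hvq => ⟨⟨?_, ?_, ?_⟩, by simp⟩, fun hvq => ⟨fun hbq' => ⟨⟨?_, ?_, ?_⟩, by simp⟩,
        fun hbq' => ⟨⟨?_, ?_, ?_⟩, by simp⟩⟩⟩,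
       fun hbq => ⟨fun hvq => ⟨⟨?_, ?_, ?_⟩, by simp⟩, fun hvq => ⟨fun hbq' => ⟨⟨?_, ?_, ?_⟩, by simp⟩,
        fun hbq' => ⟨⟨?_, ?_, ?_⟩, by simp⟩⟩⟩⟩⟩⟩
    all_goals
      intro z
      clear_value f o p q
      clear hi hf hw hadj e4 h9 h10 h11 hin hf0 ho hp hq I hD
      grind
  · intro v s hi hf h3 h4 ⟨⟨h9, h10, h11⟩, _⟩
    simp only [skip, wp, Instr.run, I]
    have hs : Seen G (v + 1) ∅ = Seen G v ({b | G.Adj v b} : Finset (Fin n)) := by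
      funext a b
      exact propext seen_all.symm
    rw [hs]
    exact ⟨h9, h10, h11⟩
  · rintro s ⟨hi, hf, h⟩
    have hs : Seen G n ∅ = G.Adj := by
      funext a b
      exact propext seen_top
    simp only [I, hs] at h
    exact ⟨hi, hf, h⟩

end CountPass

section BestPass

variable {n : ℕ} {G : SimpleGraph (Fin n)} {w : Sym2 (Fin n) → Weight} {x y : Fin n}

/-! #### Best vertices -/

/-- Weight array 2 holds the weight of the current best candidate of a set, weight array 3 that of
the stored end of the edge to its partner. -/
def bestPost : Program :=
  .instr (.load 20 6 3) ;;
  .branch (.eq 20 10) skip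
    (.instr (.wload 1 1 3) ;; .instr (.load 21 8 20) ;;
      .branch (.eq 21 4) (.instr (.wstore 3 20 1)) skip ;;
      .instr (.load 22 11 3) ;; .instr (.load 23 9 3) ;; .instr (.load 24 10 20) ;;
      .branch (.eq 22 11) skip (.branch (.eq 23 24)
        (.instr (.load 25 12 20) ;; .instr (.wload 2 2 20) ;;
          .branch (.eq 25 10)
            (.instr (.store 12 20 4) ;; .instr (.wstore 2 20 1))
            (.branch (.wle 2 1) skip
              (.instr (.store 12 20 4) ;; .instr (.wstore 2 20 1))))
        skip))

def bestPass : Program := pass skip skip bestPost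

/-- The vertex `t` is a candidate for the set with index `i`. -/
def Candidate (o mark cnt tot : ℕ → ℕ) (i t : ℕ) : Prop :=
  o t = i ∧ mark t ≠ 1 ∧ cnt t = tot i

/-- `best` and `val` are the best candidate for the set with index `i`, increased by one, and its
value; `best` is zero if there is no candidate among the vertices before `k`. -/
def IsBestEntry (o mark cnt tot : ℕ → ℕ) (val : ℕ → Weight) (k i best : ℕ) (bestVal : Weight) :
    Prop :=
  (best = 0 ∧ ∀ z < k, ¬ Candidate o mark cnt tot i z) ∨
    ∃ t < k, best = t + 1 ∧ Candidate o mark cnt tot i t ∧ bestVal = val t ∧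
      ∀ z < k, Candidate o mark cnt tot i z → val t ≤ val z

variable {o mark cnt tot : ℕ → ℕ} {val : ℕ → Weight} {k i best : ℕ} {bestVal : Weight}

theorem IsBestEntry.skip (h : IsBestEntry o mark cnt tot val k i best bestVal)
    (hk : ¬ Candidate o mark cnt tot i k) :
    IsBestEntry o mark cnt tot val (k + 1) i best bestVal := by
  have hlt : ∀ z, z < k + 1 → Candidate o mark cnt tot i z → z < k := by
    intro z hz hc
    rcases Nat.lt_succ_iff_lt_or_eq.1 hz with h | rfl
    · exact h
    · exact absurd hc hk
  rcases h with ⟨h, h'⟩ | ⟨t, ht, h1, h2, h3, h4⟩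
  · exact Or.inl ⟨h, fun z hz hc => h' z (hlt z hz hc) hc⟩
  · exact Or.inr ⟨t, ht.trans k.lt_succ_self, h1, h2, h3, fun z hz hc => h4 z (hlt z hz hc) hc⟩

theorem IsBestEntry.replace (h : IsBestEntry o mark cnt tot val k i best bestVal)
    (hk : Candidate o mark cnt tot i k) (hb : best = 0 ∨ ¬ bestVal ≤ val k) :
    IsBestEntry o mark cnt tot val (k + 1) i (k + 1) (val k) := by
  refine Or.inr ⟨k, k.lt_succ_self, rfl, hk, rfl, fun z hz hc => ?_⟩
  rcases Nat.lt_succ_iff_lt_or_eq.1 hz with hz | rfl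
  · rcases h with ⟨h, h'⟩ | ⟨t, ht, h1, h2, h3, h4⟩
    · exact absurd hc (h' z hz)
    · rw [h3] at hb
      rcases hb with hb | hb
      · omega
      · exact (not_le.1 hb).le.trans (h4 z hz hc)
  · exact le_rfl

theorem IsBestEntry.keep (h : IsBestEntry o mark cnt tot val k i best bestVal)
    (hb : best ≠ 0) (hb' : bestVal ≤ val k) :
    IsBestEntry o mark cnt tot val (k + 1) i best bestVal := by
  rcases h with ⟨h, -⟩ | ⟨t, ht, h1, h2, h3, h4⟩
  · exact absurd h hb
  · refine Or.inr ⟨t, ht.trans k.lt_succ_self, h1, h2, h3, fun z hz hc => ?_⟩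
    rcases Nat.lt_succ_iff_lt_or_eq.1 hz with hz | rfl
    · exact h4 z hz hc
    · exact h3 ▸ hb'

theorem bestPass_spec {s₀ : State} (hin : Input G w x y s₀) (h12 : ∀ i, s₀.arr 12 i = 0) :
    Runs bestPass s₀ (passCost skip skip bestPost * (n + s₀.arr 0 n) + 3)
      fun s => Input G w x y s ∧ Frame bestPass s₀ s ∧
        (∀ i, i ≠ 0 → IsBestEntry (s₀.arr 6) (s₀.arr 11) (s₀.arr 9) (s₀.arr 10) (s₀.warr 1) n i
          (s.arr 12 i) (s.warr 2 i)) ∧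
        ∀ t : Fin n, s₀.arr 6 t ≠ 0 → s₀.arr 8 (s₀.arr 6 t) = t + 1 →
          s.warr 3 (s₀.arr 6 t) = s₀.warr 1 t := by
  set o := s₀.arr 6 with ho
  set mark := s₀.arr 11 with hmark
  set cnt := s₀.arr 9 with hcnt
  set tot := s₀.arr 10 with htot
  set q := s₀.arr 8 with hq
  set val := s₀.warr 1 with hval
  let I : ℕ → State → Prop := fun k s =>
    (∀ i, i ≠ 0 → IsBestEntry o mark cnt tot val k i (s.arr 12 i) (s.warr 2 i)) ∧
    ∀ t < k, o t ≠ 0 → q (o t) = t + 1 → s.warr 3 (o t) = val t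
  refine (pass_rule hin (by decide) (by decide) (by decide) (fun v s => I v s)
    (fun v D s => I v s) ?_ ?_ ?_ ?_).mono le_rfl ?_
  · simp only [wp, Instr.run, I]
    exact ⟨fun i _ => Or.inl ⟨h12 i, fun z hz => absurd hz (Nat.not_lt_zero _)⟩, fun t ht =>
      absurd ht (Nat.not_lt_zero _)⟩
  · intro v s hi hf h3 h
    exact h
  · intro v b D s hi hf h3 h4 hb hw hadj hD h
    exact h
  · intro v s hi hf h3 h4 ⟨hI, hq3⟩
    have e6 : s.arr 6 = o := hf.arr 6 (by decide)
    have e8 : s.arr 8 = q := hf.arr 8 (by decide)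
    have e11 : s.arr 11 = mark := hf.arr 11 (by decide)
    have e9 : s.arr 9 = cnt := hf.arr 9 (by decide)
    have e10 : s.arr 10 = tot := hf.arr 10 (by decide)
    have w1 : s.warr 1 = val := hf.warr 1 (by decide)
    have hother : ∀ i, i ≠ o v → i ≠ 0 →
        IsBestEntry o mark cnt tot val (v + 1) i (s.arr 12 i) (s.warr 2 i) := fun i hi hi0 =>
      (hI i hi0).skip fun h => hi h.1.symm
    have hq1 : q (o v) ≠ v + 1 →
        ∀ t < v.val + 1, o t ≠ 0 → q (o t) = t + 1 → s.warr 3 (o t) = val t := by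
      intro hne t ht h0 h
      refine hq3 t (lt_of_le_of_ne (Nat.lt_succ_iff.1 ht) ?_) h0 h
      rintro rfl
      exact hne h
    have hq2 : q (o v) = v + 1 → ∀ t < v.val + 1, o t ≠ 0 → q (o t) = t + 1 →
        Function.update (s.warr 3) (o v) (val v) (o t) = val t := by
      intro hov t ht h0 h
      by_cases htv : t = v
      · simp [htv]
      · have h1 : o t ≠ o v := fun h' => htv (by rw [h', hov] at h; omega)
        rw [Function.update_of_ne h1]
        exact hq3 t (lt_of_le_of_ne (Nat.lt_succ_iff.1 ht) htv) h0 h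
    have hskip : ¬ Candidate o mark cnt tot (o v) v →
        ∀ i, i ≠ 0 → IsBestEntry o mark cnt tot val (v + 1) i (s.arr 12 i) (s.warr 2 i) := by
      intro h i hi
      by_cases hiv : i = o v
      · exact hiv ▸ (hI _ (hiv ▸ hi)).skip h
      · exact hother i hiv hi
    have hrep : o v ≠ 0 → Candidate o mark cnt tot (o v) v →
        (s.arr 12 (o v) = 0 ∨ ¬ s.warr 2 (o v) ≤ val v) → ∀ i, i ≠ 0 →
        IsBestEntry o mark cnt tot val (v + 1) i (Function.update (s.arr 12) (o v) (v + 1) i)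
          (Function.update (s.warr 2) (o v) (val v) i) := by
      intro h0 h hb i hi
      by_cases hiv : i = o v
      · subst hiv
        simpa using (hI _ hi).replace h hb
      · simpa [hiv] using hother i hiv hi
    have hkeep : s.arr 12 (o v) ≠ 0 → s.warr 2 (o v) ≤ val v →
        ∀ i, i ≠ 0 → IsBestEntry o mark cnt tot val (v + 1) i (s.arr 12 i) (s.warr 2 i) := by
      intro hb hb' i hi
      by_cases hiv : i = o v
      · exact hiv ▸ (hI _ (hiv ▸ hi)).keep (hiv ▸ hb) (hiv ▸ hb')
      · exact hother i hiv hi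
    have hskip0 : o v = 0 → I (v + 1) s := fun h0 => ⟨fun i hi => hother i (fun h => hi (h.trans h0)) hi,
      fun t ht h => hq3 t (lt_of_le_of_ne (Nat.lt_succ_iff.1 ht) fun h' => h (h' ▸ h0)) h⟩
    simp only [Function.update_apply] at hq2 hrep
    simp only [bestPost, skip, wp, Instr.run, Test.Holds]
    simp only [Function.update_apply, h3, h4, hi.c0, hi.c1, e6, e8, e11, e9, e10, w1, reduceIte,
      Nat.reduceEqDiff, I]
    refine ⟨hskip0, fun h0 => ⟨fun hqv => ⟨fun hm => ⟨hskip fun h => h.2.1 hm, hq2 hqv⟩,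
      fun hm => ⟨fun hct => ⟨fun hb => ⟨hrep h0 ⟨rfl, hm, hct⟩ (Or.inl hb), hq2 hqv⟩,
      fun hb => ⟨fun hle => ⟨hkeep hb hle, hq2 hqv⟩,
      fun hle => ⟨hrep h0 ⟨rfl, hm, hct⟩ (Or.inr hle), hq2 hqv⟩⟩⟩,
      fun hct => ⟨hskip fun h => hct h.2.2, hq2 hqv⟩⟩⟩,
      fun hqv => ⟨fun hm => ⟨hskip fun h => h.2.1 hm, hq1 hqv⟩,
      fun hm => ⟨fun hct => ⟨fun hb => ⟨hrep h0 ⟨rfl, hm, hct⟩ (Or.inl hb), hq1 hqv⟩,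
      fun hb => ⟨fun hle => ⟨hkeep hb hle, hq1 hqv⟩,
      fun hle => ⟨hrep h0 ⟨rfl, hm, hct⟩ (Or.inr hle), hq1 hqv⟩⟩⟩,
      fun hct => ⟨hskip fun h => hct h.2.2, hq1 hqv⟩⟩⟩⟩⟩
  · rintro s ⟨hi, hf, h1, h2⟩
    exact ⟨hi, hf, h1, fun t => h2 t t.2⟩

end BestPass

section ColorPass

variable {n : ℕ} {G : SimpleGraph (Fin n)} {w : Sym2 (Fin n) → Weight} {x y : Fin n}

/-! #### Colors -/

/-- Array 13 is indexed by vertex plus one, so entry 0 absorbs the write for a missing candidate.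
Each pair is handled only at its smaller index. -/
def colorPost : Program :=
  .instr (.load 20 4 3) ;; .instr (.load 21 5 3) ;;
  .branch (.eq 20 11) (.instr (.store 13 4 11)) skip ;;
  .branch (.eq 20 15) (.branch (.eq 21 11) (.instr (.store 13 4 11)) skip) skip ;;
  .branch (.eq 20 13)
    (.instr (.store 13 4 11) ;; .branch (.eq 21 11) skip
      (.instr (.load 22 7 4) ;; .instr (.load 23 12 4) ;;
        .branch (.eq 22 10) (.instr (.store 13 23 11))
          (.branch (.lt 4 22)
            (.instr (.load 24 8 4) ;; .instr (.load 25 12 22) ;; .instr (.load 26 8 22) ;;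
              .branch (.eq 23 10) (.instr (.store 13 24 11) ;; .instr (.store 13 25 11))
                (.branch (.eq 25 10) (.instr (.store 13 23 11) ;; .instr (.store 13 26 11))
                  (.instr (.wload 1 3 4) ;; .instr (.wload 2 2 22) ;; .instr (.wadd 3 1 2) ;;
                    .instr (.wload 1 2 4) ;; .instr (.wload 2 3 22) ;; .instr (.wadd 4 1 2) ;;
                    .branch (.wle 3 4) (.instr (.store 13 24 11) ;; .instr (.store 13 25 11))
                      (.instr (.store 13 23 11) ;; .instr (.store 13 26 11)))))
            skip)))
    skip

def colorPass : Program := pass skip skip colorPost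

/-- For a pair with indices `i`, `j` the end in the first set of the edge between them is chosen,
together with the best candidate of the second set. -/
def PickFirst (best : ℕ → ℕ) (bv qv : ℕ → Weight) (i j : ℕ) : Prop :=
  best i = 0 ∨ (best j ≠ 0 ∧ qv i + bv j ≤ bv i + qv j)

/-- When handling the set with index `i`, the vertex before `m` gets colored. -/
def Chosen (p q best : ℕ → ℕ) (bv qv : ℕ → Weight) (i m : ℕ) : Prop :=
  (p i = 0 ∧ m = best i) ∨ (p i ≠ 0 ∧ i < p i ∧
    ((PickFirst best bv qv i (p i) ∧ (m = q i ∨ m = best (p i))) ∨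
      (¬ PickFirst best bv qv i (p i) ∧ (m = best i ∨ m = q (p i)))))

/-- The vertex `z` is colored independently of the choices. -/
def BaseColor (f g : ℕ → ℕ) (z : ℕ) : Prop := f z = 1 ∨ f z = 3 ∨ (f z = 5 ∧ g z = 1)

theorem colorPass_spec {s₀ : State} (hin : Input G w x y s₀) (h13 : ∀ i, s₀.arr 13 i = 0) :
    Runs colorPass s₀ (passCost skip skip colorPost * (n + s₀.arr 0 n) + 3)
      fun s => Input G w x y s ∧ Frame colorPass s₀ s ∧
        ∀ z : Fin n, s.arr 13 (z + 1) = 1 ↔ BaseColor (s₀.arr 4) (s₀.arr 5) z ∨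
          ∃ v : Fin n, s₀.arr 4 v = 3 ∧ s₀.arr 5 v ≠ 1 ∧
            Chosen (s₀.arr 7) (s₀.arr 8) (s₀.arr 12) (s₀.warr 2) (s₀.warr 3) (v + 1) (z + 1) := by
  set f := s₀.arr 4 with hf0
  set g := s₀.arr 5 with hg
  set p := s₀.arr 7 with hp
  set q := s₀.arr 8 with hq
  set best := s₀.arr 12 with hbest
  set bv := s₀.warr 2 with hbv
  set qv := s₀.warr 3 with hqv
  let Col : ℕ → ℕ → Prop := fun v m => (m = v + 1 ∧ BaseColor f g v) ∨
    (f v = 3 ∧ g v ≠ 1 ∧ Chosen p q best bv qv (v + 1) m)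
  let I : ℕ → State → Prop := fun k s => ∀ m, s.arr 13 m = 1 ↔ ∃ v < k, Col v m
  refine (pass_rule hin (by decide) (by decide) (by decide) (fun v s => I v s)
    (fun v D s => I v s) ?_ ?_ ?_ ?_).mono le_rfl ?_
  · simp only [wp, Instr.run, I]
    simp [h13]
  · intro v s hi hf h3 h
    exact h
  · intro v b D s hi hf h3 h4 hb hw hadj hD h
    exact h
  · intro v s hi hf h3 h4 hI
    have e4 : s.arr 4 = f := hf.arr 4 (by decide)
    have e5 : s.arr 5 = g := hf.arr 5 (by decide)
    have e7 : s.arr 7 = p := hf.arr 7 (by decide)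
    have e8 : s.arr 8 = q := hf.arr 8 (by decide)
    have e12 : s.arr 12 = best := hf.arr 12 (by decide)
    have w2 : s.warr 2 = bv := hf.warr 2 (by decide)
    have w3 : s.warr 3 = qv := hf.warr 3 (by decide)
    have hstep : I (v + 1) = fun s' => ∀ m, s'.arr 13 m = 1 ↔ s.arr 13 m = 1 ∨ Col v m := by
      funext s'
      refine propext (forall_congr' fun m => ?_)
      rw [hI m]
      refine iff_congr Iff.rfl ⟨?_, ?_⟩
      · rintro ⟨z, hz, h⟩
        rcases Nat.lt_succ_iff_lt_or_eq.1 hz with hz | rfl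
        · exact Or.inl ⟨z, hz, h⟩
        · exact Or.inr h
      · rintro (⟨z, hz, h⟩ | h)
        · exact ⟨z, hz.trans v.val.lt_succ_self, h⟩
        · exact ⟨v, v.val.lt_succ_self, h⟩
    rw [hstep]
    simp only [colorPost, skip, wp, Instr.run, Test.Holds]
    simp only [Function.update_apply, h3, h4, hi.c0, hi.c1, hi.c3, hi.c5, e4, e5, e7, e8, e12,
      w2, w3, reduceIte, Nat.reduceEqDiff, Col, Chosen, BaseColor, PickFirst]
    clear_value f g p q best bv qv
    clear hstep hi hf hin hf0 hg hp hq hbest hbv hqv hI I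
    clear e4 e5 e7 e8 e12 w2 w3 h3 h4
    generalize s.arr 13 = col
    generalize f v = a
    generalize g v = b
    generalize hc : v.val + 1 = c
    generalize bv c + qv (p c) = W1
    generalize qv c + bv (p c) = W2
    repeat' first | apply And.intro | intro _
    all_goals grind
  · rintro s ⟨hi, hf, h1⟩
    refine ⟨hi, hf, fun z => ?_⟩
    rw [h1]
    constructor
    · rintro ⟨v, hv, ⟨hz, h⟩ | h⟩
      · obtain rfl : z = v := by omega
        exact Or.inl h
      · exact Or.inr ⟨⟨v, hv⟩, h⟩
    · rintro (h | ⟨v, h⟩)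
      · exact ⟨z, z.2, Or.inl ⟨rfl, h⟩⟩
      · exact ⟨v, v.2, Or.inr h⟩

end ColorPass

section VerifyPass

variable {n : ℕ} {G : SimpleGraph (Fin n)} {w : Sym2 (Fin n) → Weight} {x y : Fin n}

/-! #### Verification and output -/

def verifyPre : Program :=
  .instr (.load 20 13 4) ;; .instr (.const 21 0) ;; .instr (.const 22 0)

/-- An edge with two white ends sets the flag, and so does a second black neighbor of a black
vertex. Register 22 keeps the black neighbor. -/
def verifyBody : Program :=
  .instr (.copy 23 7) ;; .instr (.succ 23) ;; .instr (.load 24 13 23) ;;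
  .branch (.eq 24 11)
    (.branch (.eq 20 11)
      (.branch (.eq 21 10) (.instr (.const 21 1) ;; .instr (.copy 22 7)) (.instr (.const 8 1)))
      skip)
    (.branch (.eq 20 11) skip (.instr (.const 8 1)))

/-- Every matching edge is listed from its smaller end, hence only once; register 9 counts them. -/
def verifyPost : Program :=
  .branch (.eq 20 11)
    (.branch (.eq 21 10) (.instr (.const 8 1))
      (.branch (.lt 3 22)
        (.instr (.store 2 9 3) ;; .instr (.store 3 9 22) ;; .instr (.succ 9)) skip))
    skip

def verifyPass : Program := pass verifyPre verifyBody verifyPost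

/-- The colors of the neighbors of `v` in `D` are as required for a d.i.m. -/
def ColorOk (B : Set (Fin n)) (v : Fin n) (D : Finset (Fin n)) : Prop :=
  (v ∉ B → ∀ b ∈ D, b ∈ B) ∧ (v ∈ B → ∀ b ∈ D, ∀ c ∈ D, b ∈ B → c ∈ B → b = c)

theorem ColorOk.anti {B : Set (Fin n)} {v : Fin n} {D D' : Finset (Fin n)} (h : ColorOk B v D)
    (hD : D' ⊆ D) : ColorOk B v D' :=
  ⟨fun hv b hb => h.1 hv b (hD hb), fun hv b hb c hc => h.2 hv b (hD hb) c (hD hc)⟩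

/-- The first `k` entries of the arrays `f` and `g` list the edges between vertices of `B` whose
smaller end is less than `m`, provided that `P` holds. -/
structure Lists (G : SimpleGraph (Fin n)) (B : Set (Fin n)) (P : Prop) (m k : ℕ) (f g : ℕ → ℕ) :
    Prop where
  edge : ∀ i < k, ∃ a b : Fin n, f i = a ∧ g i = b ∧ a.val < m ∧ a < b ∧ a ∈ B ∧ b ∈ B ∧ G.Adj a b
  lt : ∀ i j, i < j → j < k → f i < f j
  mem : P → ∀ a b : Fin n, a.val < m → a < b → a ∈ B → b ∈ B → G.Adj a b →
    ∃ i < k, f i = a ∧ g i = b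

theorem Lists.skip {B : Set (Fin n)} {P P' : Prop} {k : ℕ} {f g : ℕ → ℕ} {v : Fin n}
    (h : Lists G B P v k f g) (hP : P' → P)
    (hv : P' → ∀ b, v < b → v ∈ B → b ∈ B → ¬ G.Adj v b) :
    Lists G B P' (v + 1) k f g := by
  refine ⟨fun i hi => ?_, h.lt, fun hp a b ha hab hab' hb hadj => ?_⟩
  · obtain ⟨a, b, h1, h2, h3, h4⟩ := h.edge i hi
    exact ⟨a, b, h1, h2, by omega, h4⟩
  · rcases Nat.lt_succ_iff_lt_or_eq.1 ha with ha | ha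
    · exact h.mem (hP hp) a b ha hab hab' hb hadj
    · obtain rfl := Fin.ext ha
      exact absurd hadj (hv hp b hab hab' hb)

theorem Lists.push {B : Set (Fin n)} {P : Prop} {k : ℕ} {f g : ℕ → ℕ} {v b : Fin n}
    (h : Lists G B P v k f g) (hvb : v < b) (hv : v ∈ B) (hb : b ∈ B) (hadj : G.Adj v b)
    (huniq : P → ∀ c ∈ B, G.Adj v c → c = b) :
    Lists G B P (v + 1) (k + 1) (Function.update f k v) (Function.update g k b) := by
  refine ⟨fun i hi => ?_, fun i j hij hj => ?_, fun hp a c ha hac hab' hc hadj' => ?_⟩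
  · by_cases hik : i = k
    · subst hik
      exact ⟨v, b, by simp, by simp, by omega, hvb, hv, hb, hadj⟩
    · obtain ⟨a, b, h1, h2, h3, h4⟩ := h.edge i (by omega)
      exact ⟨a, b, by simp [hik, h1], by simp [hik, h2], by omega, h4⟩
  · by_cases hjk : j = k
    · subst hjk
      obtain ⟨a, b, h1, h2, h3, h4⟩ := h.edge i hij
      rw [Function.update_of_ne (by omega), Function.update_self]
      omega
    · rw [Function.update_of_ne (by omega), Function.update_of_ne hjk]
      exact h.lt i j hij (by omega)
  · rcases Nat.lt_succ_iff_lt_or_eq.1 ha with ha | ha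
    · obtain ⟨i, hi, h1, h2⟩ := h.mem hp a c ha hac hab' hc hadj'
      exact ⟨i, by omega, by rw [Function.update_of_ne (by omega), h1],
        by rw [Function.update_of_ne (by omega), h2]⟩
    · obtain rfl := Fin.ext ha
      exact ⟨k, by omega, by simp, by rw [huniq hp c hc hadj']; simp⟩

-- Verification applies to an arbitrary coloring `B`, however it was found. Completeness of the list
-- is claimed only while the flag is unset, since only then is the stored black neighbor known to be
-- unique.
open Classical in
theorem verifyPass_spec {s₀ : State} (hin : Input G w x y s₀) (h9 : s₀.reg 9 = 0)
    {B : Set (Fin n)} (hB : ∀ z : Fin n, s₀.arr 13 (z + 1) = 1 ↔ z ∈ B) :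
    Runs verifyPass s₀ (passCost verifyPre verifyBody verifyPost * (n + s₀.arr 0 n) + 3)
      fun s => Input G w x y s ∧ Frame verifyPass s₀ s ∧
        (s.reg 8 = 0 ↔ s₀.reg 8 = 0 ∧ DimColor G B) ∧
        (s.reg 8 = 0 → Lists G B True n (s.reg 9) (s.arr 2) (s.arr 3)) := by
  let Ok : Fin n → Prop := fun z => ColorOk B z {b | G.Adj z b} ∧ (z ∈ B → ∃ b ∈ B, G.Adj z b)
  refine (pass_rule hin (by decide) (by decide) (by decide)
    (fun v s => (s.reg 8 = 0 ↔ s₀.reg 8 = 0 ∧ ∀ z : Fin n, z.val < v → Ok z) ∧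
      Lists G B (s.reg 8 = 0) v (s.reg 9) (s.arr 2) (s.arr 3))
    (fun v D s => (s.reg 8 = 0 ↔ (s₀.reg 8 = 0 ∧ ∀ z : Fin n, z.val < v → Ok z) ∧ ColorOk B v D) ∧
      Lists G B (s.reg 8 = 0) v (s.reg 9) (s.arr 2) (s.arr 3) ∧
      (s.reg 20 = 1 ↔ v ∈ B) ∧ (v ∈ B → (s.reg 21 = 0 ∧ ∀ b ∈ D, b ∉ B) ∨
        ∃ b ∈ D, b ∈ B ∧ s.reg 21 = 1 ∧ s.reg 22 = b)) ?_ ?_ ?_ ?_).mono le_rfl ?_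
  · simp only [wp, Instr.run]
    refine ⟨by simp, ?_, ?_, ?_⟩ <;> simp [h9]
  · intro v s hi hf h3 ⟨h1, h2⟩
    have e13 : s.arr 13 = s₀.arr 13 := hf.arr 13 (by decide)
    simp only [verifyPre, wp, Instr.run]
    simp [Function.update_apply, h3, e13, hB, ColorOk]
    exact ⟨h1, h2⟩
  · intro v b D s hi hf h3 h4 hb hw hadj hD ⟨h8, hL, h20, h21⟩
    have e13 : s.arr 13 = s₀.arr 13 := hf.arr 13 (by decide)
    have hL' : ∀ {P : Prop}, (P → s.reg 8 = 0) →
        Lists G B P v (s.reg 9) (s.arr 2) (s.arr 3) := fun h =>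
      ⟨hL.edge, hL.lt, fun hp => hL.mem (h hp)⟩
    simp only [verifyBody, skip, wp, Instr.run, Test.Holds]
    simp only [Function.update_apply, hb, hi.c0, hi.c1, e13, reduceIte, Nat.reduceEqDiff, h20, hB]
    have hok : (v ∈ B → b ∉ B) → (v ∉ B → b ∈ B) → (ColorOk B v (insert b D) ↔ ColorOk B v D) := by
      intro h1 h2
      refine ⟨fun h => h.anti (Finset.subset_insert _ _), fun h => ⟨fun hv c hc => ?_,
        fun hv c hc d hd hcB hdB => ?_⟩⟩
      · rcases Finset.mem_insert.1 hc with rfl | hc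
        · exact h2 hv
        · exact h.1 hv c hc
      · rcases Finset.mem_insert.1 hc with rfl | hc
        · exact absurd hcB (h1 hv)
        · rcases Finset.mem_insert.1 hd with rfl | hd
          · exact absurd hdB (h1 hv)
          · exact h.2 hv c hc d hd hcB hdB
    refine ⟨fun hbB => ⟨fun hvB => ⟨fun h0 => ⟨?_, hL, trivial, fun _ => Or.inr
      ⟨b, Finset.mem_insert_self _ _, hbB, trivial, rfl⟩⟩, fun h0 => ⟨?_, hL' (by simp), trivial, fun _ => ?_⟩⟩,
      fun hvB => ⟨?_, hL, trivial, fun h => absurd h hvB⟩⟩, fun hbB => ⟨fun hvB => ⟨?_, hL, trivial, fun _ => ?_⟩,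
      fun hvB => ⟨?_, hL' (by simp), trivial, fun h => absurd h hvB⟩⟩⟩
    · rw [h8]
      refine and_congr_right fun _ => ⟨fun h => ⟨fun hv => absurd hvB hv, fun _ c hc d hd hcB hdB => ?_⟩,
        fun h => h.anti (Finset.subset_insert _ _)⟩
      have hno : ∀ c ∈ D, c ∉ B := by
        rcases h21 hvB with ⟨-, h⟩ | ⟨c, -, -, h, -⟩
        · exact h
        · omega
      rcases Finset.mem_insert.1 hc with rfl | hc
      · rcases Finset.mem_insert.1 hd with rfl | hd
        · rfl
        · exact absurd hdB (hno d hd)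
      · exact absurd hcB (hno c hc)
    · rcases h21 hvB with ⟨h, -⟩ | ⟨c, hc, hcB, -⟩
      · exact absurd h h0
      · simp only [one_ne_zero, false_iff]
        rintro ⟨-, h⟩
        have := h.2 hvB b (Finset.mem_insert_self _ _) c (Finset.mem_insert_of_mem hc) hbB hcB
        exact hD (this ▸ hc)
    · rcases h21 hvB with ⟨h, -⟩ | ⟨c, hc, h⟩
      · exact absurd h h0
      · exact Or.inr ⟨c, Finset.mem_insert_of_mem hc, h⟩
    · rw [h8, hok (fun h => absurd h hvB) fun _ => hbB]
    · rw [h8, hok (fun _ => hbB) fun h => absurd hvB h]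
    · rcases h21 hvB with ⟨h, h'⟩ | ⟨c, hc, h⟩
      · refine Or.inl ⟨h, fun c hc => ?_⟩
        rcases Finset.mem_insert.1 hc with rfl | hc
        · exact hbB
        · exact h' c hc
      · exact Or.inr ⟨c, Finset.mem_insert_of_mem hc, h⟩
    · simp only [one_ne_zero, false_iff]
      rintro ⟨-, h⟩
      exact hbB (h.1 hvB b (Finset.mem_insert_self _ _))
  · intro v s hi hf h3 h4 ⟨h8, hL, h20, h21⟩
    have hmem : ∀ b, b ∈ ({b | G.Adj v b} : Finset (Fin n)) ↔ G.Adj v b := fun b => by simp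
    simp only [hmem] at h21
    have hOk : (∀ z : Fin n, z.val < v + 1 → Ok z) ↔ (∀ z : Fin n, z.val < v → Ok z) ∧ Ok v := by
      constructor
      · exact fun h => ⟨fun z hz => h z (by omega), h v (by omega)⟩
      · rintro ⟨h, h'⟩ z hz
        rcases Nat.lt_succ_iff_lt_or_eq.1 hz with hz | hz
        · exact h z hz
        · exact Fin.ext hz ▸ h'
    simp only [verifyPost, skip, wp, Instr.run, Test.Holds]
    simp only [Function.update_apply, hi.c0, hi.c1, h3, reduceIte, Nat.reduceEqDiff, h20, hOk]
    have hcongr : (v ∈ B → ∃ b ∈ B, G.Adj v b) → (s.reg 8 = 0 ↔ s₀.reg 8 = 0 ∧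
        (∀ z : Fin n, z.val < v → Ok z) ∧ Ok v) := by
      intro h
      rw [h8]
      simp only [Ok]
      tauto
    refine ⟨fun hvB => ⟨fun h0 => ⟨?_, hL.skip (by simp) (by simp)⟩, fun h0 => ?_⟩,
      fun hvB => ⟨hcongr fun h => absurd h hvB, hL.skip id fun _ _ _ h => absurd h hvB⟩⟩
    · simp only [one_ne_zero, false_iff]
      rintro ⟨-, -, h⟩
      obtain ⟨b, hb, hvb⟩ := h.2 hvB
      rcases h21 hvB with ⟨-, h'⟩ | ⟨c, -, -, h, -⟩
      · exact h' b hvb hb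
      · omega
    · rcases h21 hvB with ⟨h, -⟩ | ⟨c, hc, hcB, h1, h22⟩
      · exact absurd h h0
      have huniq : s.reg 8 = 0 → ∀ d ∈ B, G.Adj v d → d = c := fun h d hd hvd =>
        (h8.1 h).2.2 hvB d ((hmem d).2 hvd) c ((hmem c).2 hc) hd hcB
      rw [h22]
      refine ⟨fun hlt => ⟨hcongr fun _ => ⟨c, hcB, hc⟩, ?_⟩, fun hlt => ⟨hcongr fun _ => ⟨c, hcB, hc⟩,
        hL.skip id fun h d hvd _ hd hadj => hlt (huniq h d hd hadj ▸ hvd)⟩⟩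
      have := hL.push hlt hvB hcB hc huniq
      exact this
  · rintro s ⟨hi, hf, h8, hL⟩
    refine ⟨hi, hf, ?_, fun h => ⟨hL.edge, hL.lt, fun _ => hL.mem h⟩⟩
    rw [h8]
    refine and_congr_right fun _ => ⟨fun h => ⟨fun a b hab => ?_, fun a ha => ?_, fun a ha b hb c hc hab hac => ?_⟩,
      fun h z _ => ⟨⟨fun hz b hb => (h.cover z b (by simpa using hb)).resolve_left hz,
        fun hz b hb c hc hbB hcB => h.unique z hz b hbB c hcB (by simpa using hb) (by simpa using hc)⟩,
        fun hz => h.exists_adj z hz⟩⟩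
    · by_cases ha : a ∈ B
      · exact Or.inl ha
      · exact Or.inr ((h a a.2).1.1 ha b (by simpa using hab))
    · exact (h a a.2).2 ha
    · exact (h a a.2).1.2 ha b (by simpa using hab) c (by simpa using hac) hb hc

/-- The listed edges are those of `edgesIn G B`, without repetition. -/
theorem Lists.outputs [Nonempty (Fin n)] {B : Set (Fin n)} {s : State}
    (h : Lists G B True n (s.reg 1) (s.arr 2) (s.arr 3)) (h0 : s.reg 0 = 1) :
    ∃ M : Finset (Sym2 (Fin n)), (M : Set (Sym2 (Fin n))) = edgesIn G B ∧ Outputs s (some M) := by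
  classical
  choose! a b h1 h2 h3 h4 h5 h6 h7 using h.edge
  have hinj : Set.InjOn (fun i => s(a i, b i)) (Finset.range (s.reg 1)) := by
    intro i hi j hj hij
    simp only [Finset.coe_range, Set.mem_Iio] at hi hj
    have hne : a i = a j → i = j := by
      intro hab
      by_contra hne
      rcases lt_or_gt_of_ne hne with hlt | hlt
      · have := h.lt i j hlt hj
        rw [h1 i hi, h1 j hj, hab] at this
        omega
      · have := h.lt j i hlt hi
        rw [h1 i hi, h1 j hj, hab] at this
        omega
    simp only [Sym2.eq_iff] at hij
    rcases hij with ⟨h, -⟩ | ⟨h, h'⟩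
    · exact hne h
    · have := h4 i hi
      have := h4 j hj
      rw [h, h'] at *
      omega
  refine ⟨(Finset.range (s.reg 1)).image fun i => s(a i, b i), ?_, h0, ?_, ?_⟩
  · ext e
    simp only [Finset.coe_image, Finset.coe_range, Set.mem_image, Set.mem_Iio]
    constructor
    · rintro ⟨i, hi, rfl⟩
      exact mem_edgesIn.2 ⟨h7 i hi, h5 i hi, h6 i hi⟩
    · induction e using Sym2.ind with
      | _ c d =>
        intro he
        have he' := mem_edgesIn.1 he
        rcases lt_or_gt_of_ne he'.1.ne with hlt | hlt
        · obtain ⟨i, hi, hc, hd⟩ := h.mem trivial c d c.2 hlt he'.2.1 he'.2.2 he'.1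
          refine ⟨i, hi, ?_⟩
          rw [Fin.ext ((h1 i hi).symm.trans hc), Fin.ext ((h2 i hi).symm.trans hd)]
        · obtain ⟨i, hi, hc, hd⟩ := h.mem trivial d c d.2 hlt he'.2.2 he'.2.1 he'.1.symm
          refine ⟨i, hi, ?_⟩
          rw [Fin.ext ((h1 i hi).symm.trans hc), Fin.ext ((h2 i hi).symm.trans hd), Sym2.eq_swap]
  · rw [Finset.card_image_of_injOn hinj, Finset.card_range]
  · intro e
    simp only [Finset.mem_image, Finset.mem_range]
    constructor
    · rintro ⟨i, hi, rfl⟩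
      exact ⟨i, hi, a i, b i, h1 i hi, h2 i hi, rfl⟩
    · rintro ⟨i, hi, c, d, hc, hd, rfl⟩
      refine ⟨i, hi, ?_⟩
      rw [Fin.ext ((h1 i hi).symm.trans hc), Fin.ext ((h2 i hi).symm.trans hd)]

end VerifyPass

/-! ### Meaning of the computed arrays -/

section Analysis

variable {n : ℕ} {G : SimpleGraph (Fin n)} {w : Sym2 (Fin n) → Weight} {x y : Fin n}

/-- The arrays `f`, `g`, `o`, `val` hold the levels, the marks of the vertices with a neighbor in
their level, the sets `T_u` and the weights of the edges between `u` and `T_u`. -/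
structure LevelData (G : SimpleGraph (Fin n)) (w : Sym2 (Fin n) → Weight) (x y : Fin n)
    (f g o : ℕ → ℕ) (val : ℕ → Weight) : Prop where
  conn : G.Connected
  level_val : ∀ z : Fin n, f z = if lv G x y z ≤ 5 then lv G x y z + 1 else 0
  same : ∀ z : Fin n, g z = 1 ↔ ∃ b : Fin n, G.Adj z b ∧ f b = f z
  own : ∀ z : Fin n, (o z = 0 ∧ ∀ u, ¬ Owns G f g z u) ∨
    ∃ u : Fin n, Owns G f g z u ∧ o z = u + 1 ∧ val z = w s(z, u)

variable {f g o p q mark cnt tot best : ℕ → ℕ} {val bv qv : ℕ → Weight}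

namespace LevelData

/-- Levels above five are stored as 0, which is confused neither with level four nor with level
five; so no bound on the levels is needed. -/
theorem level_tests_iff
    (hf : ∀ z : Fin n, f z = if lv G x y z ≤ 5 then lv G x y z + 1 else 0) :
    (∀ z : Fin n, f z ≠ 6 ∧ (f z = 5 → ∀ b b' : Fin n, G.Adj z b → G.Adj z b' → f b = 5 →
      f b' = 5 → b = b')) ↔ level G x y 5 = ∅ ∧ IsEdgesAndVertices G (level G x y 4) := by
  have h6 : ∀ z : Fin n, f z = 6 ↔ lv G x y z = 5 := by
    intro z
    rw [hf z]
    split_ifs <;> constructor <;> intro h <;> first | omega | exact h.elim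
  have h5 : ∀ z : Fin n, f z = 5 ↔ lv G x y z = 4 := by
    intro z
    rw [hf z]
    split_ifs <;> constructor <;> intro h <;> first | omega | exact h.elim
  simp only [h5, ne_eq, h6]
  constructor
  · intro h
    refine ⟨Set.eq_empty_iff_forall_notMem.2 fun z hz => (h z).1 hz, fun z hz a ha b hb hza hzb => ?_⟩
    exact (h z).2 hz a b hza hzb ha hb
  · rintro ⟨h, h'⟩ z
    exact ⟨fun hz => Set.eq_empty_iff_forall_notMem.1 h z hz,
      fun hz a b hza hzb ha hb => h' z hz a ha b hb hza hzb⟩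

variable (hd : LevelData G w x y f g o val) (h5 : level G x y 5 = ∅)

include hd h5

theorem level_eq (z : Fin n) : f z = lv G x y z + 1 := by
  have := lv_le_four hd.conn h5 z
  rw [hd.level_val z, if_pos (by omega)]

theorem same_iff (z : Fin n) : g z = 1 ↔ Dbl G x y z := by
  rw [hd.same z]
  simp only [hd.level_eq h5, Nat.add_right_cancel_iff]
  rfl

theorem mem_S2_iff (u : Fin n) : (f u = 3 ∧ g u ≠ 1) ↔ u ∈ S2 G x y := by
  rw [mem_S2, hd.level_eq h5, ne_eq, hd.same_iff h5]
  simp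

theorem owns_iff (t u : Fin n) : Owns G f g t u ↔ u ∈ S2 G x y ∧ t ∈ T G x y u := by
  have hS : ∀ v : Fin n, v ∈ S2 G x y ↔ f v = 3 ∧ g v ≠ 1 := fun v => (hd.mem_S2_iff h5 v).symm
  constructor
  · rintro ⟨h1, h2, h3, h4, h6, h7⟩
    have hu := (hd.mem_S2_iff h5 u).1 ⟨h3, h4⟩
    refine ⟨hu, (mem_T hu).2 ⟨?_, h2, fun v hv hvt => ?_, fun v hv hvd hvt => h6 v hvt ⟨?_, ?_⟩⟩⟩
    · rw [hd.level_eq h5] at h1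
      omega
    · rw [hS] at hv
      exact h7 v hvt hv.1 hv.2
    · rw [hd.level_eq h5]
      omega
    · exact (hd.same_iff h5 v).2 hvd
  · rintro ⟨hu, ht⟩
    have hu' := (hS u).1 hu
    obtain ⟨h1, h2, h3, h4⟩ := (mem_T hu).1 ht
    refine ⟨by rw [hd.level_eq h5, h1], h2, hu'.1, hu'.2, fun b hb h => ?_, fun b hb h6 h7 => ?_⟩
    · rw [hd.level_eq h5, hd.same_iff h5] at h
      exact h4 b (by omega) h.2 hb
    · exact h3 b ((hS b).2 ⟨h6, h7⟩) hb

theorem own_iff (t u : Fin n) : o t = u + 1 ↔ u ∈ S2 G x y ∧ t ∈ T G x y u := by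
  rw [← hd.owns_iff h5]
  rcases hd.own t with ⟨h, h'⟩ | ⟨v, hv, h, -⟩
  · exact ⟨fun h'' => by omega, fun h'' => absurd h'' (h' u)⟩
  · constructor
    · intro h'
      obtain rfl : v = u := Fin.ext (by omega)
      exact hv
    · intro hu
      have h1 := (hd.owns_iff h5 _ _).1 hv
      have h2 := (hd.owns_iff h5 _ _).1 hu
      rw [h, T_unique h1.1 h2.1 h1.2 h2.2]

theorem own_ne_zero {t : Fin n} (ht : o t ≠ 0) : ∃ u ∈ S2 G x y, t ∈ T G x y u ∧ o t = u + 1 := by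
  rcases hd.own t with ⟨h, -⟩ | ⟨u, hu, h, -⟩
  · exact absurd h ht
  · exact ⟨u, ((hd.own_iff h5 t u).1 h).1, ((hd.own_iff h5 t u).1 h).2, h⟩

theorem val_eq {t u : Fin n} (hu : u ∈ S2 G x y) (ht : t ∈ T G x y u) : val t = w s(u, t) := by
  have h1 := (hd.own_iff h5 t u).2 ⟨hu, ht⟩
  rcases hd.own t with ⟨h, -⟩ | ⟨v, -, h, h'⟩
  · omega
  · obtain rfl : v = u := Fin.ext (by omega)
    rw [h', Sym2.eq_swap]

theorem cross_iff {a b : Fin n} : Cross G o a b ↔ ∃ u v, u ∈ S2 G x y ∧ v ∈ S2 G x y ∧ u ≠ v ∧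
    a ∈ T G x y u ∧ b ∈ T G x y v ∧ G.Adj a b := by
  constructor
  · rintro ⟨h1, h2, h3, h4⟩
    obtain ⟨u, hu, ha, hau⟩ := hd.own_ne_zero h5 h2
    obtain ⟨v, hv, hb, hbv⟩ := hd.own_ne_zero h5 h3
    refine ⟨u, v, hu, hv, ?_, ha, hb, h1⟩
    rintro rfl
    exact h4 (hau.trans hbv.symm)
  · rintro ⟨u, v, hu, hv, huv, ha, hb, hab⟩
    have h1 := (hd.own_iff h5 a u).2 ⟨hu, ha⟩
    have h2 := (hd.own_iff h5 b v).2 ⟨hv, hb⟩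
    refine ⟨hab, by omega, by omega, fun h => huv (Fin.ext (by omega))⟩

theorem star_sees_iff : (∀ v, ¬ StarSees G o v) ↔
    ∀ u ∈ S2 G x y, ∀ v ∈ S2 G x y, u ≠ v → ¬ Sees G (Y G x y u) (T G x y v) := by
  constructor
  · rintro h u hu v hv huv ⟨a, ha, b, hb, hab⟩
    obtain ⟨hau, c, hc, hac⟩ := mem_Y.1 ha
    have h1 := (hd.own_iff h5 a u).2 ⟨hu, hau⟩
    have h2 := (hd.own_iff h5 c u).2 ⟨hu, hc⟩
    exact h a ⟨⟨c, hac, by omega, by omega⟩, b, (hd.cross_iff h5).2 ⟨u, v, hu, hv, huv, hau, hb, hab⟩⟩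
  · rintro h a ⟨⟨c, hac, h0, hca⟩, b, hab⟩
    obtain ⟨u, v, hu, hv, huv, ha, hb, hab⟩ := (hd.cross_iff h5).1 hab
    have h1 := (hd.own_iff h5 a u).2 ⟨hu, ha⟩
    have h2 := (hd.own_iff h5 c u).1 (hca.trans h1)
    exact h u hu v hv huv ⟨a, mem_Y.2 ⟨ha, c, h2.2, hac⟩, b, hb, hab⟩

theorem testC_iff : (∀ a b c d, Cross G o a b → Cross G o c d → o a = o c → o b = o d) ↔
    TestC G x y := by
  constructor
  · rintro h u v v' ⟨hu, hv, huv, a, ha, b, hb, hab⟩ ⟨-, hv', huv', c, hc, d, hd', hcd⟩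
    have h1 := (hd.own_iff h5 a u).2 ⟨hu, ha⟩
    have h2 := (hd.own_iff h5 c u).2 ⟨hu, hc⟩
    have h3 := (hd.own_iff h5 b v).2 ⟨hv, hb⟩
    have h4 := (hd.own_iff h5 d v').2 ⟨hv', hd'⟩
    have := h a b c d ((hd.cross_iff h5).2 ⟨u, v, hu, hv, huv, ha, hb, hab⟩)
      ((hd.cross_iff h5).2 ⟨u, v', hu, hv', huv', hc, hd', hcd⟩) (h1.trans h2.symm)
    exact Fin.ext (by omega)
  · intro h a b c d hab hcd hac
    obtain ⟨u, v, hu, hv, huv, ha, hb, hab⟩ := (hd.cross_iff h5).1 hab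
    obtain ⟨u', v', hu', hv', huv', hc, hd', hcd⟩ := (hd.cross_iff h5).1 hcd
    have h1 := (hd.own_iff h5 a u).2 ⟨hu, ha⟩
    have h2 := (hd.own_iff h5 c u').2 ⟨hu', hc⟩
    have h3 := (hd.own_iff h5 b v).2 ⟨hv, hb⟩
    have h4 := (hd.own_iff h5 d v').2 ⟨hv', hd'⟩
    obtain rfl : u = u' := Fin.ext (by omega)
    rw [h3, h4, h u v v' ⟨hu, hv, huv, a, ha, b, hb, hab⟩ ⟨hu, hv', huv', c, hc, d, hd', hcd⟩]

end LevelData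

/-- The arrays hold the partners of the sets `T_u`, the number of edges at every candidate, the
number of edges to be covered, and the best candidates. -/
structure ChoiceData (G : SimpleGraph (Fin n)) (w : Sym2 (Fin n) → Weight) (x y : Fin n)
    (f g o p q mark cnt tot best : ℕ → ℕ) (val bv qv : ℕ → Weight) : Prop
    extends LevelData G w x y f g o val where
  level_five : level G x y 5 = ∅
  pairs : PairData G o p q
  cross : ∀ a b : Fin n, Cross G o a b → p (o a) = o b
  cnt_eq : ∀ z : Fin n, cnt z = pairSum G.Adj (countAt f o z)
  tot_eq : ∀ i, tot i = pairSum G.Adj (countSet f o p q i)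
  mark_iff : ∀ z : Fin n, mark z = 1 ↔ ∃ b, G.Adj z b ∧ Leaves f o z b ∧ b.val + 1 = q (p (o z))
  best_entry : ∀ i, i ≠ 0 → IsBestEntry o mark cnt tot val n i (best i) (bv i)
  qv_eq : ∀ t : Fin n, o t ≠ 0 → q (o t) = t + 1 → qv (o t) = val t

namespace ChoiceData

variable (hd : ChoiceData G w x y f g o p q mark cnt tot best val bv qv)

include hd

theorem partner_symm {i : ℕ} (hi : p i ≠ 0) : p (p i) = i ∧ p i ≠ i ∧ i ≠ 0 := by
  obtain ⟨a, b, hab, ha, hb, hpp, -⟩ := hd.pairs.1 i hi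
  exact ⟨hpp, fun h => hab.2.2.2 (by omega), fun h => hab.2.1 (ha.trans h)⟩

theorem level_own {t : Fin n} (ht : o t ≠ 0) : f t = 4 := by
  obtain ⟨u, hu, h, -⟩ := hd.own_ne_zero hd.level_five ht
  rw [hd.level_eq hd.level_five, T_lv h]

/-- The end of the edge to `t`'s set that is in the partner of this set. -/
theorem opp_ne {t : Fin n} : t.val + 1 ≠ q (p (o t)) := by
  intro h
  by_cases hp : p (o t) = 0
  · rw [hp, hd.pairs.2 0 hd.pairs.zero] at h
    omega
  · obtain ⟨a, b, hab, ha, hb, hpp, hq, hq'⟩ := hd.pairs.1 _ hp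
    obtain rfl : t = b := Fin.ext (by omega)
    exact (hd.partner_symm hp).2.1 hb.symm

/-- At an unmarked `t` every counted edge also enters the total of its set. The stored end in the
partner is not `t` itself by `opp_ne`, and it is not a neighbor of `t` because `t` is unmarked. -/
theorem countAt_le {t : Fin n} (ht : o t ≠ 0) (hm : mark t ≠ 1) {a b : Fin n} (hab : G.Adj a b) :
    countAt f o t a b ≤ countSet f o p q (o t) a b := by
  rw [ne_eq, hd.mark_iff] at hm
  push Not at hm
  by_cases hl : Leaves f o a b
  · have hne := hab.ne
    simp only [countAt, countSet, if_pos hl]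
    by_cases hta : t = a
    · subst hta
      have := hm b hab hl
      simp [hne, this]
    · by_cases htb : t = b
      · subst htb
        have hta' := hm a hab.symm ⟨ht, by rw [hd.level_own hl.1]; omega⟩
        have hopp := hd.opp_ne (t := t)
        by_cases ho : o a = o t
        · simp [ho, hopp, hta]
        · have h1 := hd.cross a t ⟨hab, hl.1, ht, ho⟩
          have h2 := hd.cross t a ⟨hab.symm, ht, hl.1, fun h => ho h.symm⟩
          rw [h2] at hta' hopp
          simp [h1, hta', hopp, hta]
      · simp [hta, htb]
  · simp [countAt, hl]

/-- Both summands would be 1 only if a set were its own partner. -/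
theorem countSet_le {i : ℕ} {a b : Fin n} (hi : i ≠ 0) : countSet f o p q i a b ≤ 1 := by
  simp only [countSet]
  split_ifs with h1 h2 h3 h3
  · have : p i = i := by rw [h2.1]; exact h3.1.symm.trans h2.1
    exact absurd this (hd.partner_symm (by omega)).2.1
  all_goals omega

/-- The count at `t` is bounded by the total term by term, so equal sums mean equal terms. As each
term of the total is at most 1, this says that every edge still to be covered has `t` as an end. -/
theorem candidate_iff {t : Fin n} (ht : o t ≠ 0) : Candidate o mark cnt tot (o t) t ↔
    (∀ b : Fin n, G.Adj t b → f b ≠ 3 → b.val + 1 ≠ q (p (o t))) ∧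
    ∀ a b : Fin n, G.Adj a b → Leaves f o a b →
      ((o a = o t ∧ b.val + 1 ≠ q (p (o t))) ∨
        (p (o a) = o t ∧ a.val + 1 ≠ q (o a) ∧ b.val + 1 ≠ q (o a))) → a = t ∨ b = t := by
  classical
  have hm : mark t ≠ 1 ↔ ∀ b : Fin n, G.Adj t b → f b ≠ 3 → b.val + 1 ≠ q (p (o t)) := by
    rw [ne_eq, hd.mark_iff]
    push Not
    exact forall_congr' fun b => imp_congr_right fun _ => ⟨fun h h' => h ⟨ht, h'⟩, fun h h' => h h'.2⟩
  simp only [Candidate, true_and, ← hm]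
  refine and_congr_right fun hm' => ?_
  rw [hd.cnt_eq, hd.tot_eq, pairSum, pairSum, Finset.sum_eq_sum_iff_of_le]
  · simp only [Finset.mem_filter, Finset.mem_univ, true_and, Prod.forall]
    refine forall_congr' fun a => forall_congr' fun b => imp_congr_right fun hab => ?_
    have hle := hd.countAt_le ht hm' hab
    have hle' := hd.countSet_le (i := o t) (a := a) (b := b) ht
    constructor
    · intro h hl hor
      by_contra hcon
      push Not at hcon
      have h0 : countAt f o t a b = 0 := by
        simp [countAt, Ne.symm hcon.1, Ne.symm hcon.2]
      rw [h0] at h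
      simp only [countSet, if_pos hl] at h
      rcases hor with ⟨h1, h2⟩ | ⟨h1, h2⟩
      · rw [h1, if_pos ⟨rfl, h2⟩] at h
        omega
      · rw [if_pos (c := o t = p (o a) ∧ _) ⟨h1.symm, h2⟩] at h
        omega
    · intro h
      by_cases hz : countSet f o p q (o t) a b = 0
      · omega
      · have hl : Leaves f o a b := by
          by_contra hl
          exact hz (by simp [countSet, hl])
        have : a = t ∨ b = t := by
          refine h hl ?_
          simp only [countSet, if_pos hl] at hz
          by_contra hcon
          push Not at hcon
          apply hz
          rw [if_neg, if_neg]
          · rintro ⟨h1, h2, h3⟩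
            exact h3 (hcon.2 h1.symm h2)
          · rintro ⟨h1, h2⟩
            rw [h1] at hcon
            exact h2 (hcon.1 rfl)
        have h1 : 1 ≤ countAt f o t a b := by
          simp only [countAt, if_pos hl]
          rcases this with rfl | rfl <;> simp
        omega
  · rintro ⟨a, b⟩ hab
    simp only [Finset.mem_filter, Finset.mem_univ, true_and] at hab
    exact hd.countAt_le ht hm' hab

end ChoiceData

end Analysis

/-! ### The computed coloring comes from an optimal selection -/

section Selection

variable {n : ℕ} {G : SimpleGraph (Fin n)} {w : Sym2 (Fin n) → Weight} {x y : Fin n}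
variable {f g o p q mark cnt tot best : ℕ → ℕ} {val bv qv : ℕ → Weight}

namespace ChoiceData

variable (hd : ChoiceData G w x y f g o p q mark cnt tot best val bv qv)

include hd

theorem partner_of_paired {u v : Fin n} (h : Paired G x y u v) : p (u + 1) = v + 1 := by
  obtain ⟨hu, hv, huv, a, ha, b, hb, hab⟩ := h
  have h1 := (hd.own_iff hd.level_five a u).2 ⟨hu, ha⟩
  have h2 := (hd.own_iff hd.level_five b v).2 ⟨hv, hb⟩
  rw [← h1, ← h2]
  exact hd.cross a b ((hd.cross_iff hd.level_five).2 ⟨u, v, hu, hv, huv, ha, hb, hab⟩)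

theorem exists_edge_of_paired {u v : Fin n} (h : Paired G x y u v) :
    ∃ a ∈ T G x y u, ∃ b ∈ T G x y v, G.Adj a b ∧ q (u + 1) = a + 1 ∧ q (v + 1) = b + 1 := by
  have hp := hd.partner_of_paired h
  obtain ⟨a, b, hab, ha, hb, -, hq, hq'⟩ := hd.pairs.1 (u + 1) (by omega)
  rw [hp] at hb hq'
  exact ⟨a, ((hd.own_iff hd.level_five a u).1 ha).2, b, ((hd.own_iff hd.level_five b v).1 hb).2,
    hab.1, hq, hq'⟩

theorem partner_of_isolated {u : Fin n} (h : IsolatedT G x y u) : p (u + 1) = 0 := by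
  by_contra h0
  obtain ⟨a, b, hab, ha, -⟩ := hd.pairs.1 _ h0
  obtain ⟨u', v, hu', hv, huv, ha', hb, hab'⟩ := (hd.cross_iff hd.level_five).1 hab
  have := (hd.own_iff hd.level_five a u).1 ha
  obtain rfl := T_unique hu' h.1 ha' this.2
  exact h.2 v ⟨hu', hv, huv, a, ha', b, hb, hab'⟩

/-- A neighbor of a vertex of `T u` outside N₂ is in N₃ or N₄, and in N₄ only isolated vertices are
possible. So the edges counted are those in the definition of `Valid`. -/
theorem mem_level_iff {u a b : Fin n} (ha : a ∈ T G x y u) (hu : u ∈ S2 G x y) (hab : G.Adj a b) :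
    f b ≠ 3 ↔ b ∈ level G x y 3 ∪ S4 G x y := by
  have hl := lv_adj_cases (x := x) (y := y) hd.conn hab
  obtain ⟨h3, -, -, h4⟩ := (mem_T hu).1 ha
  rw [hd.level_eq hd.level_five, Set.mem_union, mem_level, mem_S4]
  constructor
  · intro h
    by_cases hb : lv G x y b = 3
    · exact Or.inl hb
    · have hb4 : lv G x y b = 4 := by omega
      exact Or.inr ⟨hb4, fun hdbl => h4 b (Or.inr hb4) hdbl hab⟩
  · omega

theorem own_eq {u a : Fin n} (hu : u ∈ S2 G x y) (ha : a ∈ T G x y u) : o a = u + 1 :=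
  (hd.own_iff hd.level_five a u).2 ⟨hu, ha⟩

/-- Without partner the stored opposite end is `q 0 = 0`, which is not of the form vertex plus one.
So nothing is marked or left out of the count. -/
theorem candidate_isolated {u : Fin n} (h : IsolatedT G x y u) {t : Fin n} :
    Candidate o mark cnt tot (u + 1) t ↔ Valid G x y u u t t := by
  have hp := hd.partner_of_isolated h
  have h0 : q (p (u + 1)) = 0 := by rw [hp, hd.pairs.2 0 hd.pairs.zero]
  by_cases hot : o t = u + 1
  · have hc := hd.candidate_iff (t := t) (by omega)
    rw [hot, h0] at hc
    rw [hc]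
    have ht := ((hd.own_iff hd.level_five t u).1 hot).2
    constructor
    · rintro ⟨-, h1⟩
      refine ⟨ht, ht, G.irrefl, fun c hc d hd' hcd => ?_⟩
      have hcu : c ∈ T G x y u := hc.elim id id
      have := h1 c d hcd ⟨by rw [hd.own_eq h.1 hcu]; omega, (hd.mem_level_iff hcu h.1 hcd).2 hd'⟩
        (Or.inl ⟨hd.own_eq h.1 hcu, by omega⟩)
      tauto
    · intro hv
      refine ⟨fun b _ _ => by omega, fun a b hab hl hor => ?_⟩
      rcases hor with ⟨h1, -⟩ | ⟨h1, -⟩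
      · have ha := ((hd.own_iff hd.level_five a u).1 h1).2
        have := hv.cover a (Or.inl ha) b ((hd.mem_level_iff ha h.1 hab).1 hl.2) hab
        tauto
      · have := hd.partner_symm (i := o a) (by omega)
        rw [h1, hp] at this
        exact absurd this.1.symm hl.1
  · exact ⟨fun h' => absurd h'.1 hot, fun h' => absurd (hd.own_eq h.1 h'.left) hot⟩

/-- The edges covered by the stored end `b` are left out of the total and the neighbors of `b` are
marked. A candidate is thus exactly a vertex that completes `b`. -/
theorem candidate_paired {u v b : Fin n} (h : Paired G x y u v) (hb : b ∈ T G x y v)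
    (hq : q (v + 1) = b + 1) {t : Fin n} :
    Candidate o mark cnt tot (u + 1) t ↔ Valid G x y u v t b := by
  have hp := hd.partner_of_paired h
  have hp' := hd.partner_of_paired h.symm
  have h0 : q (p (u + 1)) = b + 1 := by rw [hp, hq]
  by_cases hot : o t = u + 1
  · have hc := hd.candidate_iff (t := t) (by omega)
    rw [hot, h0] at hc
    rw [hc]
    have ht := ((hd.own_iff hd.level_five t u).1 hot).2
    have hval : ∀ c : Fin n, c.val + 1 ≠ b + 1 ↔ c ≠ b := fun c => by
      rw [ne_eq, Nat.add_right_cancel_iff, Fin.val_inj]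
    simp only [hval]
    constructor
    · rintro ⟨h1, h2⟩
      refine ⟨ht, hb, fun htb => h1 b htb ((hd.mem_level_iff ht h.1 htb).2 (T_subset_level hb)) rfl,
        fun c hc d hd' hcd => ?_⟩
      by_contra hcon
      push Not at hcon
      have := h2 c d hcd
      rcases hc with hc | hc
      · have := this ⟨by rw [hd.own_eq h.1 hc]; omega, (hd.mem_level_iff hc h.1 hcd).2 hd'⟩
          (Or.inl ⟨hd.own_eq h.1 hc, hcon.2.2.2⟩)
        tauto
      · have := this ⟨by rw [hd.own_eq h.2.1 hc]; omega, (hd.mem_level_iff hc h.2.1 hcd).2 hd'⟩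
          (Or.inr ⟨by rw [hd.own_eq h.2.1 hc, hp'], by
            rw [hd.own_eq h.2.1 hc, hq, hval, hval]
            exact ⟨hcon.2.1, hcon.2.2.2⟩⟩)
        tauto
    · intro hv
      refine ⟨fun c hc _ hcb => hv.not_adj (hcb ▸ hc), fun a c hac hl hor => ?_⟩
      rcases hor with ⟨h1, h2⟩ | ⟨h1, h2, h3⟩
      · have ha := ((hd.own_iff hd.level_five a u).1 h1).2
        have := hv.cover a (Or.inl ha) c ((hd.mem_level_iff ha h.1 hac).1 hl.2) hac
        have : a ≠ b := by
          rintro rfl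
          exact h.2.2.1 (T_unique h.1 h.2.1 ha hb)
        tauto
      · have h4 := hd.partner_symm (i := o a) (by omega)
        rw [h1, hp] at h4
        have h5 := h4.1.symm
        rw [h5, hq, hval] at h2 h3
        have ha := ((hd.own_iff hd.level_five a v).1 h5).2
        have := hv.cover a (Or.inr ha) c ((hd.mem_level_iff ha h.2.1 hac).1 hl.2) hac
        tauto
  · exact ⟨fun h' => absurd h'.1 hot, fun h' => absurd (hd.own_eq h.1 h'.left) hot⟩

/-- The entry for the set `T_u`. -/
theorem best_cases (u : Fin n) :
    (best (u + 1) = 0 ∧ ∀ t : Fin n, ¬ Candidate o mark cnt tot (u + 1) t) ∨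
      ∃ t : Fin n, best (u + 1) = t + 1 ∧ Candidate o mark cnt tot (u + 1) t ∧
        bv (u + 1) = val t ∧ ∀ z : Fin n, Candidate o mark cnt tot (u + 1) z → val t ≤ val z := by
  rcases hd.best_entry (u + 1) (by omega) with ⟨h, h'⟩ | ⟨t, ht, h1, h2, h3, h4⟩
  · exact Or.inl ⟨h, fun t => h' t t.2⟩
  · exact Or.inr ⟨⟨t, ht⟩, h1, h2, h3, fun z => h4 z z.2⟩

theorem exists_isolated {u : Fin n} (h : IsolatedT G x y u) (hex : ∃ t, Valid G x y u u t t) :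
    ∃ t : Fin n, Valid G x y u u t t ∧ (∀ t', Valid G x y u u t' t' → w s(u, t) ≤ w s(u, t')) ∧
      ∀ m, Chosen p q best bv qv (u + 1) m ↔ m = t + 1 := by
  have hc := fun t => hd.candidate_isolated h (t := t)
  obtain ⟨t', ht'⟩ := hex
  rcases hd.best_cases u with ⟨-, h'⟩ | ⟨t, h1, h2, -, h4⟩
  · exact absurd ((hc t').2 ht') (h' t')
  · refine ⟨t, (hc t).1 h2, fun z hz => ?_, fun m => ?_⟩
    · rw [← hd.val_eq hd.level_five h.1 ((hc t).1 h2).left, ← hd.val_eq hd.level_five h.1 hz.left]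
      exact h4 z ((hc z).2 hz)
    · simp [Chosen, hd.partner_of_isolated h, h1]

/-- By `Valid.cross` a valid pair contains `a` or `b`, but not both. So an optimum is the better of
`a` with its best completion and `b` with its best completion; green vertices need no separate
treatment, as they are already reflected in the counts. -/
theorem exists_paired {u v : Fin n} (h : Paired G x y u v) (huv : u < v)
    (hex : ∃ a b, Valid G x y u v a b) :
    ∃ a b : Fin n, Opt G x y w u v a b ∧
      ∀ m, Chosen p q best bv qv (u + 1) m ↔ m = a + 1 ∨ m = b + 1 := by
  obtain ⟨a, ha, b, hb, hab, hqa, hqb⟩ := hd.exists_edge_of_paired h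
  have hp := hd.partner_of_paired h
  have hcu := fun t => hd.candidate_paired h hb hqb (t := t)
  have hcv := fun t => hd.candidate_paired h.symm ha hqa (t := t)
  have hva := fun {u t} => hd.val_eq hd.level_five (u := u) (t := t)
  have hwa : qv (u + 1) = w s(u, a) := by
    rw [← hva h.1 ha, ← hd.own_eq h.1 ha]
    refine hd.qv_eq a ?_ ?_ <;> rw [hd.own_eq h.1 ha]
    · omega
    · exact hqa
  have hwb : qv (v + 1) = w s(v, b) := by
    rw [← hva h.2.1 hb, ← hd.own_eq h.2.1 hb]
    refine hd.qv_eq b ?_ ?_ <;> rw [hd.own_eq h.2.1 hb]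
    · omega
    · exact hqb
  have hcross := fun {c d} (hv : Valid G x y u v c d) => hv.cross h ha hb hab
  have hch : ∀ m, Chosen p q best bv qv (u + 1) m ↔
      (PickFirst best bv qv (u + 1) (v + 1) ∧ (m = a + 1 ∨ m = best (v + 1))) ∨
      (¬ PickFirst best bv qv (u + 1) (v + 1) ∧ (m = best (u + 1) ∨ m = b + 1)) := by
    intro m
    have : u.val < v.val := huv
    simp [Chosen, hp, hqa, hqb, this]
  have hfirst : (∃ t, Valid G x y u v a t) → ∃ t : Fin n, best (v + 1) = t + 1 ∧ Valid G x y u v a t ∧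
      bv (v + 1) = w s(v, t) ∧ ∀ t', Valid G x y u v a t' → w s(v, t) ≤ w s(v, t') := by
    rintro ⟨t, ht⟩
    rcases hd.best_cases v with ⟨-, h'⟩ | ⟨t, h1, h2, h3, h4⟩
    · exact absurd ((hcv t).2 ht.symm) (h' t)
    · have hvt := ((hcv t).1 h2).symm
      refine ⟨t, h1, hvt, by rw [h3, hva h.2.1 hvt.right], fun z hz => ?_⟩
      rw [← hva h.2.1 hvt.right, ← hva h.2.1 hz.right]
      exact h4 z ((hcv z).2 hz.symm)
  have hsecond : (∃ t, Valid G x y u v t b) → ∃ t : Fin n, best (u + 1) = t + 1 ∧ Valid G x y u v t b ∧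
      bv (u + 1) = w s(u, t) ∧ ∀ t', Valid G x y u v t' b → w s(u, t) ≤ w s(u, t') := by
    rintro ⟨t, ht⟩
    rcases hd.best_cases u with ⟨-, h'⟩ | ⟨t, h1, h2, h3, h4⟩
    · exact absurd ((hcu t).2 ht) (h' t)
    · have hvt := (hcu t).1 h2
      refine ⟨t, h1, hvt, by rw [h3, hva h.1 hvt.left], fun z hz => ?_⟩
      rw [← hva h.1 hvt.left, ← hva h.1 hz.left]
      exact h4 z ((hcu z).2 hz)
  have hnofirst : (¬ ∃ t, Valid G x y u v a t) → best (v + 1) = 0 := by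
    intro hn
    rcases hd.best_cases v with ⟨h', -⟩ | ⟨t, h1, h2, -⟩
    · exact h'
    · exact absurd ⟨t, ((hcv t).1 h2).symm⟩ hn
  have hnosecond : (¬ ∃ t, Valid G x y u v t b) → best (u + 1) = 0 := by
    intro hn
    rcases hd.best_cases u with ⟨h', -⟩ | ⟨t, h1, h2, -⟩
    · exact h'
    · exact absurd ⟨t, (hcu t).1 h2⟩ hn
  by_cases hpick : PickFirst best bv qv (u + 1) (v + 1)
  · have hf : ∃ t, Valid G x y u v a t := by
      rcases hpick with hpick | hpick
      · obtain ⟨c, d, hv⟩ := hex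
        rcases hcross hv with ⟨rfl, -⟩ | ⟨rfl, -⟩
        · exact ⟨d, hv⟩
        · obtain ⟨t, h1, -⟩ := hsecond ⟨c, hv⟩
          omega
      · by_contra hn
        exact hpick.1 (hnofirst hn)
    obtain ⟨t, h1, h2, h3, h4⟩ := hf |> hfirst
    refine ⟨a, t, ⟨h2, fun c d hv => ?_, fun c hv => ?_, h4⟩, fun m => by simp [hch, hpick, h1]⟩
    · rcases hcross hv with ⟨rfl, -⟩ | ⟨rfl, -⟩
      · gcongr
        exact h4 d hv
      · obtain ⟨t', h1', h2', h3', h4'⟩ := hsecond ⟨c, hv⟩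
        rcases hpick with hpick | hpick
        · omega
        · have := hpick.2
          rw [hwa, h3, h3', hwb] at this
          exact this.trans (by gcongr; exact h4' c hv)
    · rcases hcross hv with ⟨rfl, -⟩ | ⟨rfl, -⟩
      · exact le_rfl
      · exact absurd hab h2.not_adj
  · have hs : ∃ t, Valid G x y u v t b := by
      by_contra hn
      exact hpick (Or.inl (hnosecond hn))
    obtain ⟨t, h1, h2, h3, h4⟩ := hs |> hsecond
    refine ⟨t, b, ⟨h2, fun c d hv => ?_, h4, fun c hv => ?_⟩, fun m => by simp [hch, hpick, h1]⟩
    · rcases hcross hv with ⟨rfl, -⟩ | ⟨rfl, -⟩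
      · obtain ⟨t', h1', h2', h3', h4'⟩ := hfirst ⟨d, hv⟩
        have : ¬ qv (u + 1) + bv (v + 1) ≤ bv (u + 1) + qv (v + 1) := fun h =>
          hpick (Or.inr ⟨by omega, h⟩)
        rw [hwa, h3, h3', hwb] at this
        exact (not_le.1 this).le.trans (by gcongr; exact h4' d hv)
      · gcongr
        exact h4 c hv
    · rcases hcross hv with ⟨rfl, -⟩ | ⟨rfl, -⟩
      · exact absurd hab h2.not_adj
      · exact le_rfl

theorem not_chosen_of_lt {u v : Fin n} (h : Paired G x y u v) (huv : v < u) (m : ℕ) :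
    ¬ Chosen p q best bv qv (u + 1) m := by
  have : v.val < u.val := huv
  simp only [Chosen, hd.partner_of_paired h]
  omega

/-- The computed colors are those of an optimal selection, if there is a valid one. -/
theorem exists_selection (hC : TestC G x y) {σ : Fin n → Fin n} (hσ : ValidSelection G x y σ) :
    ∃ τ : Fin n → Fin n,
      (∀ u, IsolatedT G x y u → Valid G x y u u (τ u) (τ u) ∧
        ∀ t, Valid G x y u u t t → w s(u, τ u) ≤ w s(u, t)) ∧
      (∀ u v, Paired G x y u v → Opt G x y w u v (τ u) (τ v)) ∧
      {z : Fin n | BaseColor f g z ∨ ∃ v : Fin n, f v = 3 ∧ g v ≠ 1 ∧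
        Chosen p q best bv qv (v + 1) (z + 1)} = black G x y τ := by
  classical
  have hiso := fun u h => hd.exists_isolated (u := u) h ⟨_, hσ.isolated u h⟩
  have hpair := fun u v h huv => hd.exists_paired (u := u) (v := v) h huv ⟨_, _, hσ.paired u v h⟩
  have : Nonempty (Fin n) := ⟨x⟩
  choose! C hC1 hC2 hC3 using hiso
  choose! A B hAB hAB' using hpair
  have hpartner : ∀ u, (∃ v, Paired G x y u v) → ∃ v, Paired G x y u v := fun u h => h
  choose! π hπ using hpartner
  -- The pair computed at the smaller index determines both values.
  let τ : Fin n → Fin n := fun u => if ∃ v, Paired G x y u v then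
    if u < π u then A u (π u) else B (π u) u else C u
  have hπ' : ∀ u v, Paired G x y u v → π u = v := fun u v h => hC u _ _ (hπ u ⟨v, h⟩) h
  have hτi : ∀ u, IsolatedT G x y u → τ u = C u := fun u h => if_neg (not_exists.2 h.2)
  have hτ1 : ∀ u v, Paired G x y u v → u < v → τ u = A u v := fun u v h huv => by
    simp only [τ]
    rw [if_pos ⟨v, h⟩, hπ' u v h, if_pos huv]
  have hτ2 : ∀ u v, Paired G x y u v → u < v → τ v = B u v := fun u v h huv => by
    simp only [τ]
    rw [if_pos ⟨u, h.symm⟩, hπ' v u h.symm, if_neg (not_lt.2 huv.le)]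
  have hopt : ∀ u v, Paired G x y u v → u < v → Opt G x y w u v (τ u) (τ v) := fun u v h huv => by
    rw [hτ1 u v h huv, hτ2 u v h huv]
    exact hAB u v h huv
  refine ⟨τ, fun u h => ?_, fun u v h => ?_, ?_⟩
  · rw [hτi u h]
    exact ⟨hC1 u h, hC2 u h⟩
  · rcases lt_or_gt_of_ne h.2.2.1 with huv | huv
    · exact hopt u v h huv
    · exact (hopt v u h.symm huv).symm
  · have hval : ∀ a b : Fin n, a.val + 1 = b + 1 ↔ a = b := fun a b => by
      rw [Nat.add_right_cancel_iff, Fin.val_inj]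
    ext z
    simp only [Set.mem_ofPred_eq, ne_eq, black, BaseColor, hd.level_eq hd.level_five,
      hd.same_iff hd.level_five]
    have hlv : ∀ v : Fin n, (lv G x y v + 1 = 3 ∧ ¬ Dbl G x y v ∧
        Chosen p q best bv qv (v + 1) (z + 1)) ↔ v ∈ S2 G x y ∧
        Chosen p q best bv qv (v + 1) (z + 1) := fun v => by
      rw [mem_S2]
      simp only [Nat.reduceEqDiff, and_assoc]
    have hsel : (∃ v : Fin n, v ∈ S2 G x y ∧ Chosen p q best bv qv (v + 1) (z + 1)) ↔
        ∃ u ∈ S2 G x y, z = τ u := by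
      constructor
      · rintro ⟨v, hv, hch⟩
        rcases isolated_or_paired hv with hi | ⟨v', hp⟩
        · exact ⟨v, hv, by rw [hτi v hi, ← hval, ← hC3 v hi]; exact hch⟩
        · rcases lt_or_gt_of_ne hp.2.2.1 with hlt | hlt
          · rw [hAB' v v' hp hlt, hval, hval] at hch
            rcases hch with hch | hch
            · exact ⟨v, hv, by rw [hτ1 v v' hp hlt, hch]⟩
            · exact ⟨v', hp.2.1, by rw [hτ2 v v' hp hlt, hch]⟩
          · exact absurd hch (hd.not_chosen_of_lt hp hlt _)
      · rintro ⟨u, hu, rfl⟩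
        rcases isolated_or_paired hu with hi | ⟨v, hp⟩
        · exact ⟨u, hu, by rw [hτi u hi, hC3 u hi]⟩
        · rcases lt_or_gt_of_ne hp.2.2.1 with hlt | hlt
          · exact ⟨u, hu, by rw [hAB' u v hp hlt, hτ1 u v hp hlt]; exact Or.inl rfl⟩
          · exact ⟨v, hp.2.1, by rw [hAB' v u hp.symm hlt, hτ2 v u hp.symm hlt]; exact Or.inr rfl⟩
    simp only [hlv, hsel]
    constructor
    · rintro ((h | h | h) | h)
      · exact Or.inl (by omega)
      · exact Or.inr (Or.inl (by omega))
      · exact Or.inr (Or.inr (Or.inl ⟨by omega, h.2⟩))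
      · exact Or.inr (Or.inr (Or.inr h))
    · rintro (h | h | h | h)
      · exact Or.inl (Or.inl (by omega))
      · exact Or.inl (Or.inr (Or.inl (by omega)))
      · exact Or.inl (Or.inr (Or.inr ⟨by omega, h.2⟩))
      · exact Or.inr h

end ChoiceData

end Selection

/-! ### The program -/

section Main

variable {n : ℕ} {G : SimpleGraph (Fin n)} {w : Sym2 (Fin n) → Weight} {x y : Fin n}

/-- The total length of the lists is the sum of the degrees. This turns the cost of a pass into a
bound in `n + m`. -/
theorem Input.length_eq {s : State} (h : Input G w x y s) : s.arr 0 n = 2 * G.edgeSet.ncard := by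
  classical
  have hdeg : ∀ v : Fin n, s.arr 0 (v + 1) = s.arr 0 v + G.degree v := by
    intro v
    have h1 := (h.block v).injOn.ncard_image
    rw [(h.block v).image_eq, Set.ncard_image_of_injective _ Fin.val_injective,
      ← Finset.coe_Ico, Set.ncard_coe_finset, Nat.card_Ico, ← SimpleGraph.coe_neighborFinset,
      Set.ncard_coe_finset, SimpleGraph.card_neighborFinset_eq_degree] at h1
    have := h.block_le v
    omega
  have hsum : ∀ k (hk : k ≤ n), s.arr 0 k = ∑ i : Fin k, G.degree (Fin.castLE hk i) := by
    intro k
    induction k with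
    | zero => simpa using h.first_block
    | succ k ih =>
      intro hk
      rw [Fin.sum_univ_castSucc, hdeg ⟨k, hk⟩]
      exact congrArg₂ _ (ih (by omega)) rfl
  rw [hsum n le_rfl, ← SimpleGraph.coe_edgeFinset, Set.ncard_coe_finset,
    ← SimpleGraph.sum_degrees_eq_twice_card_edges]
  rfl

/-- Set the constants and the levels of `x` and `y`. -/
def initProgram : Program :=
  .instr (.const 11 1) ;; .instr (.const 12 2) ;; .instr (.const 13 3) ;; .instr (.const 14 4) ;;
    .instr (.const 15 5) ;; .instr (.const 16 6) ;; .instr (.store 4 1 11) ;;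
    .instr (.store 4 2 11)

/-- Register 10 serves as the constant 0 without being set, as it is 0 initially. -/
theorem initProgram_spec (hc : G.Connected) {s : State} (h : Encodes G w x y s) :
    Runs initProgram s 8 fun s' => Input G w x y s' ∧ LevelsUpTo G x y 0 s' ∧
      s'.reg 8 = 0 ∧ s'.reg 9 = 0 ∧ ∀ a, 5 ≤ a → ∀ i, s'.arr a i = 0 := by
  refine runs_of_wp (p := initProgram) ?_
  simp only [initProgram, wp, Instr.run]
  simp only [Function.update_apply]
  simp only [reduceIte, Nat.reduceEqDiff]
  have h9 := h.reg_zero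
  refine ⟨⟨h.size, h.fst, h.snd, h.first_block, h.block_le, h.block, h.weight, fun k hk => ?_⟩,
    fun z => ?_, h.reg_zero 8 (by omega), h.reg_zero 9 (by omega), fun a ha i => ?_⟩
  · interval_cases k <;> simp [h9]
  · have := h.arr_zero 4 (by omega) z
    have h0 := lv_zero_iff (x := x) (y := y) hc (z := z)
    simp only [reduceIte, Nat.le_zero, h0, h.fst, h.snd, Fin.val_inj, Function.update_apply, this]
    by_cases hy : z = y
    · have := h0.2 (Or.inr hy)
      simp [hy, ← this]
    · by_cases hx : z = x
      · have := h0.2 (Or.inl hx)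
        simp [hx, hy, ← this]
      · simp [hx, hy]
  · have h4 : a ≠ 4 := by omega
    simp [h4, h.arr_zero a (by omega) i]

def levelProgram : Program :=
  levelPass 0 ;; levelPass 1 ;; levelPass 2 ;; levelPass 3 ;; levelPass 4

/-- Report the result. -/
def reportProgram : Program :=
  .branch (.eq 8 10) (.instr (.copy 1 9) ;; .instr (.const 0 1)) (.instr (.const 0 0))

/-- An implementation of Procedure Check. -/
def checkProgram : Program :=
  initProgram ;; levelProgram ;; samePass ;; ownPass ;; pairPass ;; countPass ;; bestPass ;;
    colorPass ;; verifyPass ;; reportProgram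

theorem levelPass_zero_of_frame {d : ℕ} (hd : d ≤ 4) {s s' : State} (hf : Frame (levelPass d) s s') :
    s'.arr 0 = s.arr 0 ∧ s'.reg 8 = s.reg 8 ∧ s'.reg 9 = s.reg 9 ∧
      ∀ a, 5 ≤ a → s'.arr a = s.arr a := by
  refine ⟨hf.arr 0 ?_, hf.reg 8 ?_, hf.reg 9 ?_, fun a ha => hf.arr a ?_⟩
  · interval_cases d <;> decide
  · interval_cases d <;> decide
  · interval_cases d <;> decide
  · have : arrW (levelPass d) = [4] := by interval_cases d <;> rfl
    rw [this]
    simp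
    omega

theorem levelProgram_spec (hc : G.Connected) {s₀ : State} (hin : Input G w x y s₀)
    (hlev : LevelsUpTo G x y 0 s₀) (h8 : s₀.reg 8 = 0) (h9 : s₀.reg 9 = 0)
    (harr : ∀ a, 5 ≤ a → ∀ i, s₀.arr a i = 0) :
    Runs levelProgram s₀ (100 * (n + s₀.arr 0 n) + 15) fun s => Input G w x y s ∧
      LevelsUpTo G x y 5 s ∧ s.arr 0 n = s₀.arr 0 n ∧ s.reg 8 = 0 ∧ s.reg 9 = 0 ∧
        ∀ a, 5 ≤ a → ∀ i, s.arr a i = 0 := by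
  have step : ∀ d ≤ 4, ∀ s, Input G w x y s ∧ LevelsUpTo G x y d s ∧ s.arr 0 n = s₀.arr 0 n ∧
      s.reg 8 = 0 ∧ s.reg 9 = 0 ∧ (∀ a, 5 ≤ a → ∀ i, s.arr a i = 0) →
      Runs (levelPass d) s (20 * (n + s₀.arr 0 n) + 3) fun s' => Input G w x y s' ∧
        LevelsUpTo G x y (d + 1) s' ∧ s'.arr 0 n = s₀.arr 0 n ∧
          s'.reg 8 = 0 ∧ s'.reg 9 = 0 ∧ ∀ a, 5 ≤ a → ∀ i, s'.arr a i = 0 := by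
    rintro d hd s ⟨hi, hl, h0, h8, h9, ha⟩
    refine (levelPass_spec hc hd hi hl).mono ?_ ?_
    · rw [h0]
      gcongr
      simp [passCost, levelPre, levelBody, skip, cost]
    · rintro s' ⟨hi', hf, hl'⟩
      obtain ⟨f0, f8, f9, fa⟩ := levelPass_zero_of_frame hd hf
      exact ⟨hi', hl', by rw [f0, h0], by rw [f8, h8], by rw [f9, h9],
        fun a h i => by rw [fa a h, ha a h]⟩
  refine (Runs.seq ((step 0 (by omega) s₀ ⟨hin, hlev, rfl, h8, h9, harr⟩).mono le_rfl fun s1 h1 =>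
    Runs.seq ((step 1 (by omega) s1 h1).mono le_rfl fun s2 h2 =>
    Runs.seq ((step 2 (by omega) s2 h2).mono le_rfl fun s3 h3 =>
    Runs.seq ((step 3 (by omega) s3 h3).mono le_rfl fun s4 h4 => step 4 (by omega) s4 h4))))).mono
      ?_ fun s h => h
  omega

theorem cost_le : passCost samePre sameBody samePost ≤ 100 ∧
    passCost ownPre ownBody ownPost ≤ 100 ∧ passCost pairPre pairBody pairPost ≤ 100 ∧
    passCost countPre countBody skip ≤ 100 ∧ passCost skip skip bestPost ≤ 100 ∧
    passCost skip skip colorPost ≤ 100 ∧ passCost verifyPre verifyBody verifyPost ≤ 100 := by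
  decide

/-- All passes are executed even if the flag is already set; their specifications do not assume
success. The tests outside `PathTests` are never computed: a verified coloring implies them through
`IsColor.tests`. -/
theorem checkProgram_spec (hc : G.Connected) (hP : EdgeInP3 G x y) {s₀ : State}
    (hs : Encodes G w x y s₀) : Runs checkProgram s₀ (2000 * (n + G.edgeSet.ncard)) fun s =>
      ∃ r, Outputs s r ∧ Check G x y w r := by
  have hadj := hP.1
  have : Nonempty (Fin n) := ⟨x⟩
  -- This absorbs the additive constants. Seven passes of cost at most 100 and the level passes of
  -- total cost 100, per vertex or list entry, give `800 * (n + 2 * m)` plus a constant, which is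
  -- below `2000 * (n + m)`.
  have hn : 1 ≤ n := Fin.pos x
  obtain ⟨c1, c2, c3, c4, c5, c6, c7⟩ := cost_le
  obtain ⟨sa, ta, ea, hta, hia, hla, ha8, ha9, haz⟩ := initProgram_spec hc hs
  obtain ⟨sb, tb, eb, htb, hib, hlb, hb0, hb8, hb9, hbz⟩ :=
    levelProgram_spec hc hia hla ha8 ha9 haz
  obtain ⟨sc, tc, ec, htc, hic, hfc, hsame, hc8⟩ := samePass_spec hib hb8
  obtain ⟨sd, td, ed, htd, hid, hfd, hown⟩ := ownPass_spec hic
  have zero : ∀ {p : Program} {s s' : State} {a : ℕ}, Frame p s s' → a ∉ arrW p →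
      (∀ i, s.arr a i = 0) → ∀ i, s'.arr a i = 0 := fun hf ha h i => by rw [hf.arr _ ha, h]
  have zd : ∀ a ∈ [7, 8, 9, 10, 11, 12, 13], ∀ i, sd.arr a i = 0 := by
    intro a ha
    refine zero hfd ?_ (zero hfc ?_ (hbz a ?_)) <;> fin_cases ha <;> decide
  obtain ⟨se, te, ee, hte, hie, hfe, hpair, he8, he8'⟩ := pairPass_spec hid
    (zd 7 (by simp)) (zd 8 (by simp))
  have ze : ∀ a ∈ [9, 10, 11, 12, 13], ∀ i, se.arr a i = 0 := by
    intro a ha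
    refine zero hfe ?_ (zd a ?_) <;> fin_cases ha <;> decide
  obtain ⟨sf, tf, ef, htf, hif, hff, hcnt, htot, hmark⟩ := countPass_spec hie
    (ze 9 (by simp)) (ze 10 (by simp)) (ze 11 (by simp))
  have zf : ∀ a ∈ [12, 13], ∀ i, sf.arr a i = 0 := by
    intro a ha
    refine zero hff ?_ (ze a ?_) <;> fin_cases ha <;> decide
  obtain ⟨sg, tg, eg, htg, hig, hfg, hbest, hqv⟩ := bestPass_spec hif (zf 12 (by simp))
  obtain ⟨sh, th, eh, hth, hih, hfh, hcol⟩ := colorPass_spec hig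
    (zero hfg (by decide) (zf 13 (by simp)))
  have r9 : sh.reg 9 = 0 := by
    rw [hfh.reg 9 (by decide), hfg.reg 9 (by decide), hff.reg 9 (by decide),
      hfe.reg 9 (by decide), hfd.reg 9 (by decide), hfc.reg 9 (by decide), hb9]
  obtain ⟨si, ti, ei, hti, hii, hfi, hi8, hlist⟩ := verifyPass_spec hih r9
    (B := {z : Fin n | sh.arr 13 (z + 1) = 1}) (fun z => Iff.rfl)
  -- the values of the arrays
  have f4c : sc.arr 4 = sb.arr 4 := hfc.arr 4 (by decide)
  have f4d : sd.arr 4 = sb.arr 4 := (hfd.arr 4 (by decide)).trans f4c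
  have f4e : se.arr 4 = sb.arr 4 := (hfe.arr 4 (by decide)).trans f4d
  have f4g : sg.arr 4 = sb.arr 4 :=
    (hfg.arr 4 (by decide)).trans ((hff.arr 4 (by decide)).trans f4e)
  have f5g : sg.arr 5 = sc.arr 5 := (hfg.arr 5 (by decide)).trans ((hff.arr 5 (by decide)).trans
    ((hfe.arr 5 (by decide)).trans (hfd.arr 5 (by decide))))
  have f6e : se.arr 6 = sd.arr 6 := hfe.arr 6 (by decide)
  have f6f : sf.arr 6 = sd.arr 6 := (hff.arr 6 (by decide)).trans f6e
  have f7g : sg.arr 7 = se.arr 7 := (hfg.arr 7 (by decide)).trans (hff.arr 7 (by decide))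
  have f8f : sf.arr 8 = se.arr 8 := hff.arr 8 (by decide)
  have f8g : sg.arr 8 = se.arr 8 := (hfg.arr 8 (by decide)).trans f8f
  have w1f : sf.warr 1 = sd.warr 1 := (hff.warr 1 (by decide)).trans (hfe.warr 1 (by decide))
  rw [f4c] at hown
  rw [f4e, f6e] at hcnt htot hmark
  rw [f6f, w1f] at hbest hqv
  rw [f8f] at hqv
  rw [f4g, f5g, f7g, f8g] at hcol
  have hld : LevelData G w x y (sb.arr 4) (sc.arr 5) (sd.arr 6) (sd.warr 1) :=
    ⟨hc, hlb, hsame, hown⟩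
  have hfail : sh.reg 8 = se.reg 8 := (hfh.reg 8 (by decide)).trans
    ((hfg.reg 8 (by decide)).trans (hff.reg 8 (by decide)))
  have hd8 : sd.reg 8 = sc.reg 8 := hfd.reg 8 (by decide)
  rw [LevelData.level_tests_iff hlb] at hc8
  -- Before verification the flag expresses exactly the tests that a coloring does not imply.
  have htests : sh.reg 8 = 0 ↔ PathTests G x y := by
    rw [hfail]
    constructor
    · intro h
      obtain ⟨h1, h2, h3⟩ := he8 h
      obtain ⟨h5, h4⟩ := hc8.1 (hd8.symm.trans h1)
      exact ⟨h5, h4, (hld.star_sees_iff h5).1 h3, (hld.testC_iff h5).1 fun a b c d hab hcd hac => by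
        rw [← h2 a b hab, ← h2 c d hcd, hac]⟩
    · intro h
      exact he8' (hd8.trans (hc8.2 ⟨h.level_five, h.level_four⟩))
        ((hld.star_sees_iff h.level_five).2 h.star_sees) ((hld.testC_iff h.level_five).2 h.pairs)
  -- the time
  have l0 : sb.arr 0 n = 2 * G.edgeSet.ncard := hib.length_eq
  rw [← hb0, l0] at htb
  rw [l0] at htc
  rw [hic.length_eq] at htd
  rw [hid.length_eq] at hte
  rw [hie.length_eq] at htf
  rw [hif.length_eq] at htg
  rw [hig.length_eq] at hth
  rw [hih.length_eq] at hti
  have htime : ∀ {K t : ℕ}, K ≤ 100 → t ≤ K * (n + 2 * G.edgeSet.ncard) + 3 →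
      t ≤ 100 * (n + 2 * G.edgeSet.ncard) + 3 := fun hK ht =>
    ht.trans (Nat.add_le_add_right (Nat.mul_le_mul_right _ hK) _)
  have t1 := htime c1 htc
  have t2 := htime c2 htd
  have t3 := htime c3 hte
  have t4 := htime c4 htf
  have t5 := htime c5 htg
  have t6 := htime c6 hth
  have t7 := htime c7 hti
  suffices hrep : Runs reportProgram si 4 fun s => ∃ r, Outputs s r ∧ Check G x y w r by
    obtain ⟨sj, tj, ej, htj, hr⟩ := hrep
    refine ⟨sj, _, .seq ea (.seq eb (.seq ec (.seq ed (.seq ee (.seq ef (.seq eg (.seq eh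
      (.seq ei ej)))))))), ?_, hr⟩
    omega
  have hchoice : sh.reg 8 = 0 → ChoiceData G w x y (sb.arr 4) (sc.arr 5) (sd.arr 6) (se.arr 7)
      (se.arr 8) (sf.arr 11) (sf.arr 9) (sf.arr 10) (sg.arr 12) (sd.warr 1) (sg.warr 2)
      (sg.warr 3) := fun h =>
    ⟨hld, (htests.1 h).level_five, hpair, (he8 (hfail.symm.trans h)).2.1, hcnt, htot, hmark, hbest,
      hqv⟩
  have hselect : ∀ {σ}, sh.reg 8 = 0 → ValidSelection G x y σ → ∃ τ : Fin n → Fin n,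
      (∀ u, IsolatedT G x y u → Valid G x y u u (τ u) (τ u) ∧
        ∀ t, Valid G x y u u t t → w s(u, τ u) ≤ w s(u, t)) ∧
      (∀ u v, Paired G x y u v → Opt G x y w u v (τ u) (τ v)) ∧
      {z : Fin n | sh.arr 13 (z + 1) = 1} = black G x y τ := by
    intro σ h hσ
    obtain ⟨τ, h1, h2, h3⟩ := (hchoice h).exists_selection (htests.1 h).pairs hσ
    refine ⟨τ, h1, h2, ?_⟩
    rw [← h3]
    exact Set.ext hcol
  refine runs_of_wp (p := reportProgram) ?_
  simp only [reportProgram, wp, Instr.run, Test.Holds, hii.c0]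
  refine ⟨fun h0 => ?_, fun h0 => ⟨none, by simp [Outputs], ?_⟩⟩
  · obtain ⟨h8, hB⟩ := hi8.1 h0
    have hp := htests.1 h8
    have hbase : ∀ z : Fin n, lv G x y z = 0 → sh.arr 13 (z + 1) = 1 := fun z hz =>
      (hcol z).2 (Or.inl (Or.inl (by rw [hld.level_eq hp.level_five, hz])))
    have hcolor : IsColor G x y {z : Fin n | sh.arr 13 (z + 1) = 1} :=
      ⟨hB, hc, hadj, hbase x ((lv_zero_iff hc).2 (Or.inl rfl)),
        hbase y ((lv_zero_iff hc).2 (Or.inr rfl))⟩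
    obtain ⟨σ, hσ, -⟩ := hcolor.exists_selection hp
    obtain ⟨τ, h1, h2, h3⟩ := hselect h8 hσ
    have hl := hlist h0
    rw [h3] at hl
    obtain ⟨M, hM, hout⟩ := Lists.outputs (s := { si with
      reg := Function.update (Function.update si.reg 1 (si.reg 9)) 0 1 }) (by simpa using hl)
      (by simp)
    exact ⟨some M, hout, check_some_of_selection hc hadj (hcolor.tests hp) h1 h2 hM⟩
  -- If all tests hold and there were a d.i.m. containing `xy`, the computed coloring would come
  -- from a valid selection and pass the verification.
  · by_cases hT : Tests G x y
    · refine check_none_of_no_dim hc hadj ?_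
      rintro ⟨B, hB⟩
      have h8 := htests.2 hT.pathTests
      obtain ⟨σ, hσ, -⟩ := hB.exists_selection hT.pathTests
      obtain ⟨τ, h1, h2, h3⟩ := hselect h8 hσ
      have hτ : ValidSelection G x y τ := ⟨fun u hu => (h1 u hu).1, fun u v h => (h2 u v h).valid⟩
      refine h0 (hi8.2 ⟨h8, ?_⟩)
      rw [h3]
      exact (isColor_black hc hτ hadj hT.1).toDimColor
    · exact .test_failed hT

end Main

end DimCheck

/-- Correctness of Procedure Check on every finite connected graph with an edge `xy` in a `P₃`,
and its implementation by a single program whose number of steps is linear in `n + m`. -/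
theorem mainTheorem2 :
    (∀ (V : Type*) [Finite V] (G : SimpleGraph V) (w : Sym2 V → DimCheck.Weight) (x y : V),
      G.Connected → DimCheck.EdgeInP3 G x y →
        (∃ r, DimCheck.Check G x y w r) ∧
        ∀ r, DimCheck.Check G x y w r → DimCheck.CorrectResult G x y w r) ∧
    ∃ (p : DimCheck.Program) (C : ℕ),
      ∀ (n : ℕ) (G : SimpleGraph (Fin n)) (w : Sym2 (Fin n) → DimCheck.Weight) (x y : Fin n),
        G.Connected → DimCheck.EdgeInP3 G x y →
          ∀ s : DimCheck.State, DimCheck.Encodes G w x y s →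
            ∃ (s' : DimCheck.State) (t : ℕ) (r : Option (Finset (Sym2 (Fin n)))),
              DimCheck.Exec p s s' t ∧ t ≤ C * (n + G.edgeSet.ncard) ∧
                DimCheck.Outputs s' r ∧ DimCheck.Check G x y w r := by
  refine ⟨fun V _ G w x y hc hP => ⟨DimCheck.exists_check hc, fun r h => ?_⟩, ?_⟩
  · cases r with
    | none => exact DimCheck.check_none_correct hc hP.1 hP h
    | some M => exact DimCheck.check_some_correct hc hP.1 h
  · refine ⟨DimCheck.checkProgram, 2000, fun n G w x y hc hP s hs => ?_⟩
    obtain ⟨s', t, he, ht, r, hr, hcheck⟩ := DimCheck.checkProgram_spec hc hP hs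
    exact ⟨s', t, r, he, ht, hr, hcheck⟩
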